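/- **Model.** Let $G$ be a random $d$-regular multigraph on $n$ nodes from the configuration model ($nd$ even): each node has $d$ half-edges, and a uniformly random perfect matching of the $nd$ half-edges gives the edges. Fix a destination $t$ and integers $p\ge 2$, $h\ge 1$, and put $$\ell=\max\bigl(1,\lceil\log_p(n/(2d^2))\rceil\bigr),\qquad \lambda=p^{\ell}d^2/n .$$ Let $WP_0$ be the set of neighbours of $t$ (other than $t$). For $1\le i\le \ell$, each node of $WP_{i-1}$ independently selects a uniformly random set of $p$ of its neighbours outside $\{t\}\cup WP_0\cup\dots\cup WP_{i-1}$ (all of them, if there are fewer than $p$), and $WP_i$ is the set of selected nodes. The inner ring $IR$ consists of the neighbours of $WP_\ell$ that are not $t$ and lie in no $WP_i$; the outer ring $OR$ consists of all nodes that are not $t$ and lie in no other level. A packet is first *sprayed* from its source along one of the $d$ half-edges of the source. Afterwards a node $u\ne t$ forwards it to any one of $h$ randomly selected next hops (all eligible ones, if fewer than $h$). The eligible next hops of $u$ are: $t$, if $u\in WP_0$; its neighbours in $WP_{i-1}$, if $u\in WP_i$ with $1\le i\le \ell$; its neighbours in $WP_\ell$, if $u\in IR$; its neighbours at smallest finite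 graph distance from $IR$, if $u\in OR$. The packet stops as soon as it is at $t$ after the spraying step. There are $nd$ choices of a source (any node) and a spray half-edge; such a choice counts as a path of length $i$ if the packet can reach $t$, and reaches it after exactly $i$ hops (the spraying hop included) whichever selected next hops are used. **Theorem.** Consider a sequence of parameters $(n,d,p,h,t)$ with $n\to\infty$, $nd$ even, $d\ge 2(\ln n+5)$, $2\le p\le d/4$, $h\ge 1$ and $p^{\ell}d=o(n)$ (so that $d=o(n)$), and suppose that $\lambda d\ge c\ln n$ for some constant $c>1$ (this holds in particular if $p\ge (n/d^2)^{1/\ell}$, that is, $\lambda\ge 1$; and, for all large $n$, if $d/\ln n\to\infty$). Then, with probability $1-o(1)$: - there are exactly $d$ paths of length $1$; - for every $2\le i\le \ell+2$, there are $(1\pm o(1))\,p^{i-2}d^2$ paths of length $i$, with the $o(1)$ uniform in $i$; - there are at most $(e^{-\lambda}+o(1))\,nd$ paths of length $\ell+4$; - all remaining choices of a source and a spray half-edge give paths of length $\ell+3$. Moreover, if $n e^{-\lambda}\to\infty$ (for instance, if $\lambda$ is bounded) or $n e^{-\lambda}\to 0$, then with probability $1-o(1)$ there are at most $(1+o(1))\,e^{-\lambda}nd$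 paths of length $\ell+4$. -/

import Mathlib

open Filter Topology

namespace Spraypoint

/-- The half-edges of a graph on `n` nodes of degree `d`: `(v, a)` is the `a`-th half-edge at `v`. -/
abbrev HalfEdge (n d : ℕ) : Type := Fin n × Fin d

/-- A perfect matching of all half-edges, as the fixed-point-free involution that sends every
half-edge to its partner. A uniformly random pairing is the configuration model. -/
abbrev Pairing (n d : ℕ) : Type :=
  {f : Equiv.Perm (HalfEdge n d) // ∀ e, f (f e) = e ∧ f e ≠ e}

/-- For every node `u` and every set `A` of candidates, a subset of `A` with `k` elements
(all of `A`, if `A` has fewer than `k` elements). Under the uniform distribution the subsets chosen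
for different pairs `(u, A)` are independent and each is uniform. -/
abbrev Selection (n k : ℕ) : Type :=
  (u : Fin n) → (A : Finset (Fin n)) → {S : Finset (Fin n) // S ∈ A.powersetCard (min k A.card)}

/-- All the randomness: the graph, the selection of waypoints (`p` by every waypoint of a level below
the last one) and the selection of next hops (`h` by every node). -/
abbrev Outcome (n d p h : ℕ) : Type := Pairing n d × Selection n p × Selection n h

/-- Probability of an event under the uniform distribution on a finite type. -/
noncomputable def prob {Ω : Type} (E : Set Ω) : ℝ := (E.ncard : ℝ) / (Nat.card Ω : ℝ)

/-- The number `ℓ = max(1, ⌈log_p (n / (2 d ^ 2))⌉)` of waypoint levels. -/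
noncomputable def numLevels (n d p : ℕ) : ℕ :=
  max 1 ⌈Real.logb (p : ℝ) ((n : ℝ) / (2 * (d : ℝ) ^ 2))⌉₊

/-- `λ = p ^ ℓ * d ^ 2 / n`. -/
noncomputable def lam (n d p : ℕ) : ℝ :=
  (p : ℝ) ^ numLevels n d p * (d : ℝ) ^ 2 / (n : ℝ)

/-- The adjacency relation between distinct nodes in the multigraph of a pairing. -/
def graph {n d : ℕ} (f : Pairing n d) : SimpleGraph (Fin n) where
  Adj u v := u ≠ v ∧ ∃ a b : Fin d, f.1 (u, a) = (v, b)
  symm := ⟨by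
    rintro u v ⟨huv, a, b, hab⟩
    exact ⟨huv.symm, b, a, by rw [← hab]; exact (f.2 _).1⟩⟩
  loopless := ⟨fun _ hu => hu.1 rfl⟩

section Levels

variable {n : ℕ} (G : SimpleGraph (Fin n)) {k : ℕ} (c : Selection n k) (t : Fin n)

open Classical in
/-- The set of neighbours of `u`. -/
noncomputable def nbrs (u : Fin n) : Finset (Fin n) := Finset.univ.filter fun v => G.Adj u v

open Classical in
/-- The waypoint level `i`, together with the union of `{t}` and the waypoint levels `0, …, i`. -/
noncomputable def waypointsAux : ℕ → Finset (Fin n) × Finset (Fin n)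
  | 0 => (nbrs G t, insert t (nbrs G t))
  | i + 1 =>
    let W := (waypointsAux i).1
    let U := (waypointsAux i).2
    let W' := W.biUnion fun u => (c u (nbrs G u \ U)).1
    (W', U ∪ W')

/-- The waypoint level `WP_i(t)`: the neighbours of `t` for `i = 0`; for `i + 1`, the nodes chosen by
the nodes of `WP_i(t)`, each of which chooses among its neighbours outside
`{t} ∪ WP_0(t) ∪ … ∪ WP_i(t)`. -/
noncomputable def waypoints (i : ℕ) : Finset (Fin n) := (waypointsAux G c t i).1

/-- `{t} ∪ WP_0(t) ∪ … ∪ WP_i(t)`. -/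
noncomputable def core (i : ℕ) : Finset (Fin n) := (waypointsAux G c t i).2

/-- The inner ring: the neighbours of the last waypoint level `WP_ℓ(t)` not in previous levels. -/
def innerRing (l : ℕ) : Set (Fin n) :=
  {v | v ∉ core G c t l ∧ ∃ u ∈ waypoints G c t l, G.Adj u v}

/-- The outer ring: the nodes in no other level. -/
def outerRing (l : ℕ) : Set (Fin n) :=
  {v | v ∉ core G c t l ∧ v ∉ innerRing G c t l}

/-- Graph distance from `v` to the inner ring (infinite if there is no path). -/
noncomputable def distInner (l : ℕ) (v : Fin n) : ℕ∞ := ⨅ w ∈ innerRing G c t l, G.edist v w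

open Classical in
/-- The neighbours of `u` that are eligible as next hops after the spraying step, by the pointing
rules. The levels are disjoint, so at most one of the four rules applies, and none applies to `t`. -/
noncomputable def eligible (l : ℕ) (u : Fin n) : Finset (Fin n) :=
  Finset.univ.filter fun v => G.Adj u v ∧
    ((u ∈ waypoints G c t 0 ∧ v = t) ∨
     (∃ j < l, u ∈ waypoints G c t (j + 1) ∧ v ∈ waypoints G c t j) ∨
     (u ∈ innerRing G c t l ∧ v ∈ waypoints G c t l) ∨
     (u ∈ outerRing G c t l ∧ distInner G c t l v ≠ ⊤ ∧
        ∀ w, G.Adj u w → distInner G c t l v ≤ distInner G c t l w))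

end Levels

/-- `Route next t u m`: a packet at `u` can reach `t` in exactly `m` hops, every hop going from the
current node to one of its next hops. -/
inductive Route {V : Type} (next : V → Finset V) (t : V) : V → ℕ → Prop
  | arrived : Route next t t 0
  | hop {u v : V} {m : ℕ} : v ∈ next u → Route next t v m → Route next t u (m + 1)

section Paths

variable {n d p h : ℕ} (ω : Outcome n d p h) (t : Fin n)

/-- The selected next hops (at most `h`) of `u` for packets with destination `t`. -/
noncomputable def nextHops (u : Fin n) : Finset (Fin n) :=
  (ω.2.2 u (eligible (graph ω.1) ω.2.1 t (numLevels n d p) u)).1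

/-- The lengths of all paths to `t` that a packet can take if its source is the node of the half-edge
`e` and it is sprayed along `e`: one spraying hop to the node of the partner of `e`, followed by
a route to `t`. -/
def pathLengths (e : HalfEdge n d) : Set ℕ :=
  {i | ∃ m, Route (nextHops ω t) t (ω.1.1 e).1 m ∧ i = m + 1}

/-- The choice `e` of a source and a spray edge gives paths to `t` of length `i`: there is such a path
and, whichever next hops are taken, the path has length `i`. -/
def HasLength (e : HalfEdge n d) (i : ℕ) : Prop := pathLengths ω t e = {i}

/-- The number of paths of length `i` to `t`, out of `n * d`, one for every choice of a source and
a spray edge. -/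
noncomputable def pathCount (i : ℕ) : ℕ := {e : HalfEdge n d | HasLength ω t e i}.ncard

end Paths

end Spraypoint

set_option linter.unusedSectionVars false

namespace Spraypoint

/-- The average of `g` over a finite set. -/
noncomputable def avg {β : Type} (s : Finset β) (g : β → ℝ) : ℝ := (∑ i ∈ s, g i) / (s.card : ℝ)

theorem avg_le_iff {β : Type} {s : Finset β} (hs : s.Nonempty) {g : β → ℝ} {b : ℝ} :
    avg s g ≤ b ↔ ∑ i ∈ s, g i ≤ b * s.card := by
  have : (0 : ℝ) < s.card := by exact_mod_cast hs.card_pos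
  rw [avg, div_le_iff₀ this]

theorem avg_mono {β : Type} {s : Finset β} {g g' : β → ℝ} (h : ∀ i ∈ s, g i ≤ g' i) :
    avg s g ≤ avg s g' := by
  unfold avg
  gcongr with i hi
  exact h i hi

theorem avg_congr {β : Type} {s : Finset β} {g g' : β → ℝ} (h : ∀ i ∈ s, g i = g' i) :
    avg s g = avg s g' := by
  unfold avg
  rw [Finset.sum_congr rfl h]

theorem avg_const_mul {β : Type} (s : Finset β) (c : ℝ) (g : β → ℝ) :
    avg s (fun i => c * g i) = c * avg s g := by
  unfold avg
  rw [← Finset.mul_sum, mul_div_assoc]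

theorem avg_const {β : Type} {s : Finset β} (hs : s.Nonempty) (c : ℝ) :
    avg s (fun _ => c) = c := by
  have : (s.card : ℝ) ≠ 0 := by exact_mod_cast hs.card_pos.ne'
  simp [avg, this]

section Involutions

variable {α : Type} [Fintype α] [DecidableEq α]

/-- The fixed-point-free involutions, that is, the perfect matchings of `α`. -/
abbrev Inv (α : Type) : Type := {f : Equiv.Perm α // ∀ e, f (f e) = e ∧ f e ≠ e}

/-- The perfect matchings that agree with `f₀` on `D`. -/
def fib (D : Finset α) (f₀ : Inv α) : Finset (Inv α) :=
  Finset.univ.filter fun f => ∀ e ∈ D, f.1 e = f₀.1 e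

theorem mem_fib {D : Finset α} {f₀ f : Inv α} : f ∈ fib D f₀ ↔ ∀ e ∈ D, f.1 e = f₀.1 e := by
  simp [fib]

theorem self_mem_fib (D : Finset α) (f₀ : Inv α) : f₀ ∈ fib D f₀ := by simp [mem_fib]

theorem fib_nonempty (D : Finset α) (f₀ : Inv α) : (fib D f₀).Nonempty := ⟨_, self_mem_fib D f₀⟩

/-- `D` is a union of pairs of `f`. -/
def Closed (D : Finset α) (f : Inv α) : Prop := ∀ e ∈ D, f.1 e ∈ D

theorem Inv.apply_eq_iff (f : Inv α) {e x : α} : f.1 e = x ↔ f.1 x = e :=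
  ⟨fun h => by rw [← h]; exact (f.2 e).1, fun h => by rw [← h]; exact (f.2 x).1⟩

theorem Closed.apply_mem_iff {D : Finset α} {f : Inv α} (h : Closed D f) {e : α} :
    f.1 e ∈ D ↔ e ∈ D :=
  ⟨fun he => by have := h _ he; rwa [(f.2 e).1] at this, h e⟩

theorem Closed.of_mem_fib {D : Finset α} {f₀ f : Inv α} (h : Closed D f₀) (hf : f ∈ fib D f₀) :
    Closed D f := fun e he => by rw [mem_fib.1 hf e he]; exact h e he

theorem Closed.insert_pair {D : Finset α} {f : Inv α} (h : Closed D f) {e x : α}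
    (hx : f.1 e = x) : Closed (insert e (insert x D)) f := by
  intro y hy
  simp only [Finset.mem_insert] at hy ⊢
  rcases hy with rfl | rfl | hy
  · simp [hx]
  · left; exact f.apply_eq_iff.1 hx
  · right; right; exact h y hy

theorem card_compl_insert_pair {D : Finset α} {e x : α} (he : e ∉ D) (hx : x ∉ D) (hxe : x ≠ e) :
    (insert e (insert x D))ᶜ.card + 2 = Dᶜ.card := by
  have h1 : (insert e (insert x D)).card = D.card + 2 := by
    rw [Finset.card_insert_of_notMem, Finset.card_insert_of_notMem hx]
    simp [he, Ne.symm hxe]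
  have h2 := Finset.card_add_card_compl (insert e (insert x D))
  have h3 := Finset.card_add_card_compl D
  omega

/-- The image of a matching under a swap of two points. -/
def swapInv (x y : α) (f : Inv α) : Inv α :=
  ⟨Equiv.swap x y * f.1 * Equiv.swap x y, fun e => by
    constructor
    · simp [(f.2 _).1]
    · intro h
      have h' : f.1 (Equiv.swap x y e) = Equiv.swap x y e := by
        apply (Equiv.swap x y).injective
        simpa using h
      exact (f.2 _).2 h'⟩

theorem swapInv_swapInv (x y : α) (f : Inv α) : swapInv x y (swapInv x y f) = f := by
  apply Subtype.ext
  ext e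
  simp [swapInv]

theorem card_fib_filter_le {D : Finset α} {f₀ : Inv α} (hD : Closed D f₀) {e x y : α}
    (hx : x ∉ D) (hy : y ∉ D) (hxe : x ≠ e) (hye : y ≠ e) :
    ((fib D f₀).filter fun f => f.1 e = x).card ≤ ((fib D f₀).filter fun f => f.1 e = y).card := by
  apply Finset.card_le_card_of_injOn (swapInv x y)
  · intro f hf
    simp only [Finset.coe_filter, Set.mem_ofPred_eq, mem_fib] at hf ⊢
    have hs : ∀ z, z ∈ D → Equiv.swap x y z = z := fun z hz =>
      Equiv.swap_apply_of_ne_of_ne (fun h => hx (h ▸ hz)) (fun h => hy (h ▸ hz))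
    refine ⟨fun z hz => ?_, ?_⟩
    · have : f.1 z ∈ D := by rw [hf.1 z hz]; exact hD z hz
      simp [swapInv, hs z hz, hs _ this, ← hf.1 z hz]
    · simp [swapInv, Equiv.swap_apply_of_ne_of_ne hxe.symm hye.symm, hf.2]
  · intro f _ f' _ h
    rw [← swapInv_swapInv x y f, h, swapInv_swapInv]

theorem fib_filter_eq {D : Finset α} {f₀ f₁ : Inv α} {e x : α} (hf₁ : f₁ ∈ fib D f₀)
    (h : f₁.1 e = x) : ((fib D f₀).filter fun f => f.1 e = x) = fib (insert e (insert x D)) f₁ := by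
  ext f
  simp only [Finset.mem_filter, mem_fib, Finset.mem_insert, forall_eq_or_imp] at hf₁ ⊢
  constructor
  · rintro ⟨h1, h2⟩
    refine ⟨by rw [h2, h], ?_, fun z hz => by rw [h1 z hz, hf₁ z hz]⟩
    rw [f.apply_eq_iff.1 h2, f₁.apply_eq_iff.1 h]
  · rintro ⟨h1, _, h3⟩
    exact ⟨fun z hz => by rw [h3 z hz, hf₁ z hz], by rw [h1, h]⟩

/-- Revealing the partner of `e`, which is uniform among the other free points. -/
theorem avg_fib_mul_le {D : Finset α} {f₀ : Inv α} (hD : Closed D f₀) {e : α} (he : e ∉ D)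
    {g : Inv α → ℝ} {b : α → ℝ}
    (h : ∀ x, x ∉ D → x ≠ e → ∀ f₁ ∈ fib D f₀, f₁.1 e = x →
      avg (fib (insert e (insert x D)) f₁) g ≤ b x) :
    avg (fib D f₀) g * ((Dᶜ.card : ℝ) - 1) ≤ ∑ x ∈ Dᶜ.erase e, b x := by
  set c := ((fib D f₀).filter fun f => f.1 e = f₀.1 e).card with hc
  have hcpos : 0 < c := Finset.card_pos.2 ⟨f₀, by simp [self_mem_fib]⟩
  have hfe : f₀.1 e ∉ D := fun h => he (hD.apply_mem_iff.1 h)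
  have hcard : ∀ x ∈ Dᶜ.erase e, ((fib D f₀).filter fun f => f.1 e = x).card = c := by
    intro x hx
    simp only [Finset.mem_erase, Finset.mem_compl] at hx
    exact le_antisymm (card_fib_filter_le hD hx.2 hfe hx.1 (f₀.2 e).2)
      (card_fib_filter_le hD hfe hx.2 (f₀.2 e).2 hx.1)
  have hmaps : ∀ f ∈ fib D f₀, f.1 e ∈ Dᶜ.erase e := by
    intro f hf
    simp only [Finset.mem_erase, Finset.mem_compl]
    exact ⟨(f.2 e).2, fun h => he ((hD.of_mem_fib hf).apply_mem_iff.1 h)⟩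
  have hM : (((Dᶜ.erase e).card : ℕ) : ℝ) = (Dᶜ.card : ℝ) - 1 := by
    rw [Finset.card_erase_of_mem (by simpa using he), Nat.cast_sub]
    · simp
    · exact Finset.card_pos.2 ⟨e, by simpa using he⟩
  have htot : ((fib D f₀).card : ℝ) = ((Dᶜ.card : ℝ) - 1) * c := by
    rw [Finset.card_eq_sum_card_fiberwise hmaps, Finset.sum_congr rfl hcard, ← hM]
    simp
  have hsum : ∑ f ∈ fib D f₀, g f ≤ (∑ x ∈ Dᶜ.erase e, b x) * c := by
    rw [← Finset.sum_fiberwise_of_maps_to hmaps, Finset.sum_mul]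
    apply Finset.sum_le_sum
    intro x hx
    have hne : ((fib D f₀).filter fun f => f.1 e = x).Nonempty := by
      rw [← Finset.card_pos, hcard x hx]; exact hcpos
    obtain ⟨f₁, hf₁⟩ := hne
    rw [Finset.mem_filter] at hf₁
    have hx' := hx
    simp only [Finset.mem_erase, Finset.mem_compl] at hx'
    have := h x hx'.2 hx'.1 f₁ hf₁.1 hf₁.2
    rw [avg_le_iff (fib_nonempty _ _), ← fib_filter_eq hf₁.1 hf₁.2, hcard x hx] at this
    exact this
  have hc' : (0 : ℝ) < c := by exact_mod_cast hcpos
  have hM0 : (0 : ℝ) < (Dᶜ.card : ℝ) - 1 := by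
    have : (0 : ℝ) < ((fib D f₀).card : ℝ) := by exact_mod_cast (fib_nonempty D f₀).card_pos
    rw [htot] at this
    exact pos_of_mul_pos_left this hc'.le
  unfold avg
  rw [htot, div_mul_eq_mul_div, div_le_iff₀ (by positivity)]
  nlinarith

theorem two_le_card_compl {D : Finset α} {f₀ : Inv α} (hD : Closed D f₀) {e : α} (he : e ∉ D) :
    2 ≤ Dᶜ.card := by
  have : ({e, f₀.1 e} : Finset α) ⊆ Dᶜ := by
    intro x hx
    simp only [Finset.mem_insert, Finset.mem_singleton] at hx
    rcases hx with rfl | rfl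
    · simpa using he
    · simpa using fun h => he (hD.apply_mem_iff.1 h)
  calc 2 = ({e, f₀.1 e} : Finset α).card := (Finset.card_pair (f₀.2 e).2.symm).symm
    _ ≤ _ := Finset.card_le_card this

/-- A bound for the average over a fibre from bounds after one more partner is revealed. -/
theorem avg_fib_le {D : Finset α} {f₀ : Inv α} (hD : Closed D f₀) {e : α} (he : e ∉ D)
    {g : Inv α → ℝ} {b : α → ℝ} {C : ℝ}
    (h : ∀ x, x ∉ D → x ≠ e → ∀ f₁ ∈ fib D f₀, f₁.1 e = x →
      avg (fib (insert e (insert x D)) f₁) g ≤ b x)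
    (hb : ∑ x ∈ Dᶜ.erase e, b x ≤ C * ((Dᶜ.card : ℝ) - 1)) :
    avg (fib D f₀) g ≤ C := by
  have h2 : (2 : ℝ) ≤ Dᶜ.card := by exact_mod_cast two_le_card_compl hD he
  have := (avg_fib_mul_le hD he h).trans hb
  exact le_of_mul_le_mul_right this (by linarith)

end Involutions

section Involutions

variable {α : Type} [Fintype α] [DecidableEq α]

/-- The number of points of `Y` matched into `V` has an exponential moment like a binomial one. -/
theorem avg_pow_hits_le {θ m₀ : ℝ} (hθ : 1 ≤ θ) (hm₀ : 0 < m₀) (V : Finset α) (k : ℕ) :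
    ∀ (Y D : Finset α) (f₀ : Inv α), Y.card = k → Closed D f₀ → Disjoint Y D → Disjoint Y V →
      m₀ + 2 * k ≤ Dᶜ.card →
      avg (fib D f₀) (fun f => θ ^ (Y.filter fun y => f.1 y ∈ V).card)
        ≤ (1 + (θ - 1) * V.card / m₀) ^ k := by
  have hB : 1 ≤ 1 + (θ - 1) * V.card / m₀ := by
    have : 0 ≤ (θ - 1) * V.card / m₀ := by
      have := sub_nonneg.2 hθ
      positivity
    linarith
  set B := 1 + (θ - 1) * V.card / m₀ with hBdef
  induction k using Nat.strong_induction_on with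
  | _ k ih =>
    intro Y D f₀ hk hD hYD hYV hm
    rcases Y.eq_empty_or_nonempty with rfl | ⟨e, he⟩
    · simp only [Finset.card_empty] at hk
      subst hk
      simp [avg_const (fib_nonempty D f₀)]
    · have heD : e ∉ D := Finset.disjoint_left.1 hYD he
      have hk1 : 1 ≤ k := hk ▸ Finset.card_pos.2 ⟨e, he⟩
      have hk1' : (1 : ℝ) ≤ k := by exact_mod_cast hk1
      refine avg_fib_le hD heD
        (b := fun x => B ^ (k - 1) * (1 + if x ∈ V then θ - 1 else 0)) ?_ ?_
      · intro x hx hxe f₁ hf₁ hfx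
        set Y' := (Y.erase e).erase x with hY'
        have hY'lt : Y'.card ≤ k - 1 := by
          calc Y'.card ≤ (Y.erase e).card := Finset.card_erase_le
            _ = k - 1 := by rw [Finset.card_erase_of_mem he, hk]
        have hY'Y : Y' ⊆ Y := (Finset.erase_subset _ _).trans (Finset.erase_subset _ _)
        have hcard := card_compl_insert_pair heD hx hxe
        have hih := ih Y'.card (by omega) Y' (insert e (insert x D)) f₁ rfl
          ((hD.of_mem_fib hf₁).insert_pair hfx)
          (by
            rw [Finset.disjoint_left] at hYD ⊢
            intro y hy
            simp only [hY', Finset.mem_erase] at hy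
            simp only [Finset.mem_insert, not_or]
            exact ⟨hy.2.1, hy.1, hYD hy.2.2⟩)
          (hYV.mono_left hY'Y)
          (by
            have h1 : (Dᶜ.card : ℝ) = (insert e (insert x D))ᶜ.card + 2 := by
              exact_mod_cast hcard.symm
            have h2 : (Y'.card : ℝ) ≤ (k : ℝ) - 1 := by
              rw [← Nat.cast_one, ← Nat.cast_sub hk1]; exact_mod_cast hY'lt
            linarith)
        have hpt : ∀ f ∈ fib (insert e (insert x D)) f₁,
            θ ^ (Y.filter fun y => f.1 y ∈ V).card ≤
              (1 + if x ∈ V then θ - 1 else 0) * θ ^ (Y'.filter fun y => f.1 y ∈ V).card := by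
          intro f hf
          have hfe : f.1 e = x := by
            rw [mem_fib.1 hf e (by simp), hfx]
          have hsub : (Y.filter fun y => f.1 y ∈ V) ⊆
              (if x ∈ V then {e} else ∅) ∪ (Y'.filter fun y => f.1 y ∈ V) := by
            intro y hy
            simp only [Finset.mem_filter] at hy
            rw [Finset.mem_union]
            by_cases hye : y = e
            · left; subst hye; rw [hfe] at hy; simp [hy.2]
            · right
              have hyx : y ≠ x := by
                rintro rfl
                rw [f.apply_eq_iff.1 hfe] at hy
                exact Finset.disjoint_left.1 hYV he hy.2
              simp [hY', hye, hyx, hy]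
          have hc := (Finset.card_le_card hsub).trans (Finset.card_union_le _ _)
          calc θ ^ (Y.filter fun y => f.1 y ∈ V).card
              ≤ θ ^ ((if x ∈ V then {e} else ∅ : Finset α).card +
                  (Y'.filter fun y => f.1 y ∈ V).card) := pow_le_pow_right₀ hθ hc
            _ = _ := by
                rw [pow_add]
                congr 1
                split_ifs <;> simp
        refine (avg_mono hpt).trans ?_
        rw [avg_const_mul, mul_comm]
        have : 0 ≤ 1 + (if x ∈ V then θ - 1 else 0) := by split_ifs <;> linarith
        gcongr
        exact hih.trans (pow_le_pow_right₀ hB hY'lt)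
      · have h2 : (2 : ℝ) ≤ Dᶜ.card := by exact_mod_cast two_le_card_compl hD heD
        have hce : (((Dᶜ.erase e).card : ℕ) : ℝ) = (Dᶜ.card : ℝ) - 1 := by
          rw [Finset.card_erase_of_mem (by simpa using heD), Nat.cast_sub]
          · simp
          · exact Finset.card_pos.2 ⟨e, by simpa using heD⟩
        rw [← Finset.mul_sum, Finset.sum_add_distrib, ← Finset.sum_filter, Finset.sum_const,
          Finset.sum_const, nsmul_eq_mul, nsmul_eq_mul, hce]
        have hV : (((Dᶜ.erase e).filter (· ∈ V)).card : ℝ) ≤ V.card := by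
          exact_mod_cast Finset.card_le_card fun x hx => (Finset.mem_filter.1 hx).2
        have hBk : B ^ k = B ^ (k - 1) * B := by
          rw [← pow_succ, Nat.sub_add_cancel hk1]
        rw [hBk, mul_assoc]
        have hB0 : 0 ≤ B ^ (k - 1) := by positivity
        apply mul_le_mul_of_nonneg_left _ hB0
        have h3 : (θ - 1) * V.card ≤ (θ - 1) * V.card / m₀ * ((Dᶜ.card : ℝ) - 1) := by
          rw [div_mul_eq_mul_div, le_div_iff₀ hm₀]
          apply mul_le_mul_of_nonneg_left (by linarith)
          have := sub_nonneg.2 hθ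
          positivity
        have h4 := mul_le_mul_of_nonneg_right hV (sub_nonneg.2 hθ)
        rw [hBdef]
        linarith

/-- The probability that all points of `K` are matched into `O`. -/
theorem avg_all_mem_le {X m₀ : ℝ} (hX : 0 < X) (O : Finset α) {kmax : ℝ}
    (hXm : O.card * X + kmax ≤ X ^ 2 * m₀) (k : ℕ) :
    ∀ (K D : Finset α) (f₀ : Inv α), K.card = k → Closed D f₀ → Disjoint K D →
      k ≤ kmax → m₀ + 2 * k ≤ Dᶜ.card →
      avg (fib D f₀) (fun f => if ∀ y ∈ K, f.1 y ∈ O then 1 else 0) ≤ X ^ k := by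
  induction k using Nat.strong_induction_on with
  | _ k ih =>
    intro K D f₀ hk hD hKD hkm hm
    rcases K.eq_empty_or_nonempty with rfl | ⟨e, he⟩
    · simp only [Finset.card_empty] at hk
      subst hk
      simp [avg_const (fib_nonempty D f₀)]
    · have heD : e ∉ D := Finset.disjoint_left.1 hKD he
      have hk1 : 1 ≤ k := hk ▸ Finset.card_pos.2 ⟨e, he⟩
      have hk1' : (1 : ℝ) ≤ k := by exact_mod_cast hk1
      refine avg_fib_le hD heD
        (b := fun x => (if x ∈ O then X ^ (k - 1) else 0) +
          (if x ∈ K then X ^ k / X ^ 2 else 0)) ?_ ?_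
      · intro x hx hxe f₁ hf₁ hfx
        set K' := (K.erase e).erase x with hK'
        have hcard := card_compl_insert_pair heD hx hxe
        have h1 : (Dᶜ.card : ℝ) = (insert e (insert x D))ᶜ.card + 2 := by
          exact_mod_cast hcard.symm
        have hK'lt : K'.card ≤ k - 1 := by
          calc K'.card ≤ (K.erase e).card := Finset.card_erase_le
            _ = k - 1 := by rw [Finset.card_erase_of_mem he, hk]
        have h2 : (K'.card : ℝ) ≤ (k : ℝ) - 1 := by
          rw [← Nat.cast_one, ← Nat.cast_sub hk1]; exact_mod_cast hK'lt
        have hih := ih K'.card (by omega) K' (insert e (insert x D)) f₁ rfl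
          ((hD.of_mem_fib hf₁).insert_pair hfx)
          (by
            rw [Finset.disjoint_left] at hKD ⊢
            intro y hy
            simp only [hK', Finset.mem_erase] at hy
            simp only [Finset.mem_insert, not_or]
            exact ⟨hy.2.1, hy.1, hKD hy.2.2⟩)
          (by linarith)
          (by linarith)
        have hpt : ∀ f ∈ fib (insert e (insert x D)) f₁,
            (if ∀ y ∈ K, f.1 y ∈ O then 1 else 0 : ℝ) ≤
              (if x ∈ O then 1 else 0) * (if ∀ y ∈ K', f.1 y ∈ O then 1 else 0) := by
          intro f hf
          have hfe : f.1 e = x := by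
            rw [mem_fib.1 hf e (by simp), hfx]
          by_cases hall : ∀ y ∈ K, f.1 y ∈ O
          · have hxO : x ∈ O := hfe ▸ hall e he
            have : ∀ y ∈ K', f.1 y ∈ O := fun y hy =>
              hall y (Finset.mem_of_mem_erase (Finset.mem_of_mem_erase hy))
            rw [if_pos hall, if_pos hxO, if_pos this]; norm_num
          · rw [if_neg hall]
            split_ifs <;> norm_num
        refine (avg_mono hpt).trans ?_
        rw [avg_const_mul]
        by_cases hxO : x ∈ O
        · simp only [hxO, if_true, one_mul]
          refine hih.trans ?_
          by_cases hxK : x ∈ K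
          · have hc : K'.card = k - 2 := by
              rw [hK', Finset.card_erase_of_mem (by simp [hxK, hxe]),
                Finset.card_erase_of_mem he, hk]
              omega
            have hk2 : 2 ≤ k := by
              rw [← hk, ← Finset.card_pair hxe.symm]
              exact Finset.card_le_card (by intro z; simp; rintro (rfl | rfl) <;> assumption)
            simp only [hxK, if_true]
            have : X ^ K'.card = X ^ k / X ^ 2 := by
              rw [hc, eq_div_iff (by positivity), ← pow_add]
              congr 1; omega
            rw [this]
            have : 0 ≤ X ^ (k - 1) := by positivity
            linarith
          · have hc : K'.card = k - 1 := by
              rw [hK', Finset.erase_eq_of_notMem (by simp [hxK]),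
                Finset.card_erase_of_mem he, hk]
            simp [hxK, hc]
        · simp only [hxO, if_false, zero_mul, zero_add]
          split_ifs <;> positivity
      · rw [Finset.sum_add_distrib, ← Finset.sum_filter, ← Finset.sum_filter, Finset.sum_const,
          Finset.sum_const, nsmul_eq_mul, nsmul_eq_mul]
        have hO : (((Dᶜ.erase e).filter (· ∈ O)).card : ℝ) ≤ O.card := by
          exact_mod_cast Finset.card_le_card fun x hx => (Finset.mem_filter.1 hx).2
        have hK : (((Dᶜ.erase e).filter (· ∈ K)).card : ℝ) ≤ kmax := by
          refine le_trans ?_ hkm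
          rw [← hk]
          exact_mod_cast Finset.card_le_card fun x hx => (Finset.mem_filter.1 hx).2
        have hXk : X ^ (k - 1) = X ^ k / X ^ 2 * X := by
          rw [div_mul_eq_mul_div, eq_div_iff (by positivity), ← pow_add, ← pow_succ]
          congr 1; omega
        have hXk' : X ^ k = X ^ k / X ^ 2 * X ^ 2 := by field_simp
        rw [hXk]
        nth_rewrite 3 [hXk']
        have h0 : 0 ≤ X ^ k / X ^ 2 := by positivity
        have h5 : X ^ 2 * m₀ ≤ X ^ 2 * ((Dᶜ.card : ℝ) - 1) :=
          mul_le_mul_of_nonneg_left (by linarith) (by positivity)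
        calc _ = X ^ k / X ^ 2 * ((((Dᶜ.erase e).filter (· ∈ O)).card : ℝ) * X +
                (((Dᶜ.erase e).filter (· ∈ K)).card : ℝ)) := by ring
          _ ≤ X ^ k / X ^ 2 * (X ^ 2 * ((Dᶜ.card : ℝ) - 1)) := by
              apply mul_le_mul_of_nonneg_left _ h0
              have := mul_le_mul_of_nonneg_right hO hX.le
              linarith
          _ = _ := by ring

end Involutions

theorem exp_le_one_add_two_mul {y : ℝ} (h0 : 0 ≤ y) (h1 : y ≤ 1) : Real.exp y ≤ 1 + 2 * y := by
  have := Real.abs_exp_sub_one_le (x := y) (by rwa [abs_of_nonneg h0])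
  rw [abs_of_nonneg h0] at this
  linarith [le_abs_self (Real.exp y - 1)]

theorem exp_le_one_add_add_sq {y : ℝ} (h0 : 0 ≤ y) (h1 : y ≤ 1) :
    Real.exp y ≤ 1 + y + y ^ 2 := by
  have := Real.abs_exp_sub_one_sub_id_le (x := y) (by rwa [abs_of_nonneg h0])
  linarith [le_abs_self (Real.exp y - 1 - y)]

theorem one_sub_mul_exp_le {a γ : ℝ} (ha0 : 0 ≤ a) (ha1 : a ≤ 1) (hγ0 : 0 ≤ γ) (hγ1 : γ ≤ 1) :
    (1 - a) * Real.exp (γ * a) ≤ 1 - (1 - γ) * a := by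
  have h1 := exp_le_one_add_add_sq (y := γ * a) (by positivity) (mul_le_one₀ hγ1 ha0 ha1)
  have h2 := mul_le_mul_of_nonneg_left h1 (sub_nonneg.2 ha1)
  have h3 : 0 ≤ γ * a ^ 2 * (1 - γ) := mul_nonneg (by positivity) (by linarith)
  have h4 : 0 ≤ γ ^ 2 * a ^ 3 := by positivity
  nlinarith

section Hits

variable {ν ι : Type} [Fintype ν] [DecidableEq ν] [Fintype ι] [DecidableEq ι]

/-- The product of `1 - a u` over all pairs `(u, w)` in `A × N` outside `B` such that some
half-edge of `W` at `w` is matched to a half-edge at `u`. -/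
noncomputable def hitProd (a : ν → ℝ) (A N : Finset ν) (B : Finset (ν × ν)) (W : Finset (ν × ι))
    (f : Inv (ν × ι)) : ℝ :=
  ∏ z ∈ A ×ˢ N, if z ∉ B ∧ ∃ e ∈ W, e.1 = z.2 ∧ (f.1 e).1 = z.1 then 1 - a z.1 else 1

/-- The total weight of the half-edges outside `D` at nodes of `A`. -/
noncomputable def weight (a : ν → ℝ) (A : Finset ν) (D : Finset (ν × ι)) : ℝ :=
  ∑ x ∈ Dᶜ.filter (fun x => x.1 ∈ A), a x.1

variable {a : ν → ℝ} {A N : Finset ν}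

theorem hitProd_mono (ha0 : ∀ u ∈ A, 0 ≤ a u) (ha1 : ∀ u ∈ A, a u ≤ 1)
    {B B' : Finset (ν × ν)} {W W' : Finset (ν × ι)} (hB : B ⊆ B') (hW : W' ⊆ W)
    (f : Inv (ν × ι)) : hitProd a A N B W f ≤ hitProd a A N B' W' f := by
  apply Finset.prod_le_prod
  · intro z hz
    have := ha1 z.1 (Finset.mem_product.1 hz).1
    split_ifs <;> linarith
  · intro z hz
    have := ha0 z.1 (Finset.mem_product.1 hz).1
    by_cases h : z ∉ B' ∧ ∃ e ∈ W', e.1 = z.2 ∧ (f.1 e).1 = z.1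
    · have h' : z ∉ B ∧ ∃ e ∈ W, e.1 = z.2 ∧ (f.1 e).1 = z.1 := by
        obtain ⟨h1, e, he, h2⟩ := h
        exact ⟨fun hz => h1 (hB hz), e, hW he, h2⟩
      rw [if_pos h, if_pos h']
    · rw [if_neg h]
      split_ifs <;> linarith

theorem hitProd_hit (ha0 : ∀ u ∈ A, 0 ≤ a u) (ha1 : ∀ u ∈ A, a u ≤ 1)
    {B : Finset (ν × ν)} {W W' : Finset (ν × ι)} (hW : W' ⊆ W) {f : Inv (ν × ι)}
    {e : ν × ι} (he : e ∈ W) (heN : e.1 ∈ N) (hA : (f.1 e).1 ∈ A) (hB : ((f.1 e).1, e.1) ∉ B) :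
    hitProd a A N B W f ≤
      (1 - a (f.1 e).1) * hitProd a A N (insert ((f.1 e).1, e.1) B) W' f := by
  have hz : ((f.1 e).1, e.1) ∈ A ×ˢ N := Finset.mem_product.2 ⟨hA, heN⟩
  unfold hitProd
  rw [← Finset.mul_prod_erase _ _ hz, ← Finset.mul_prod_erase _ _ hz]
  rw [if_pos ⟨hB, e, he, rfl, rfl⟩, if_neg (by simp), one_mul]
  apply mul_le_mul_of_nonneg_left _ (by linarith [ha1 _ hA])
  apply Finset.prod_le_prod
  · intro z hz
    have := ha1 z.1 (Finset.mem_product.1 (Finset.mem_of_mem_erase hz)).1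
    split_ifs <;> linarith
  · intro z hz
    have := ha0 z.1 (Finset.mem_product.1 (Finset.mem_of_mem_erase hz)).1
    by_cases h : z ∉ insert ((f.1 e).1, e.1) B ∧ ∃ e ∈ W', e.1 = z.2 ∧ (f.1 e).1 = z.1
    · have h' : z ∉ B ∧ ∃ e ∈ W, e.1 = z.2 ∧ (f.1 e).1 = z.1 := by
        obtain ⟨h1, e, he, h2⟩ := h
        exact ⟨fun hz => h1 (Finset.mem_insert_of_mem hz), e, hW he, h2⟩
      rw [if_pos h, if_pos h']
    · rw [if_neg h]
      split_ifs <;> linarith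

theorem weight_nonneg (ha0 : ∀ u ∈ A, 0 ≤ a u) (D : Finset (ν × ι)) : 0 ≤ weight a A D :=
  Finset.sum_nonneg fun _ hx => ha0 _ (Finset.mem_filter.1 hx).2

theorem weight_anti (ha0 : ∀ u ∈ A, 0 ≤ a u) {D D' : Finset (ν × ι)} (h : D ⊆ D') :
    weight a A D' ≤ weight a A D := by
  apply Finset.sum_le_sum_of_subset_of_nonneg
  · intro _
    simp only [Finset.mem_filter, Finset.mem_compl]
    exact fun hx => ⟨fun hD => hx.1 (h hD), hx.2⟩
  · intro _ hx _
    exact ha0 _ (Finset.mem_filter.1 hx).2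

theorem weight_insert_pair {D : Finset (ν × ι)} {e x : ν × ι} (hx : x ∉ D) (heA : e.1 ∉ A) :
    weight a A (insert e (insert x D)) = weight a A D - if x.1 ∈ A then a x.1 else 0 := by
  unfold weight
  split_ifs with h
  · rw [eq_sub_iff_add_eq, add_comm]
    have hmem : x ∈ Dᶜ.filter (fun x => x.1 ∈ A) := by simp [hx, h]
    rw [← Finset.add_sum_erase _ _ hmem]
    congr 1
    apply Finset.sum_congr _ (fun _ _ => rfl)
    ext y
    simp only [Finset.mem_filter, Finset.mem_compl, Finset.mem_insert, Finset.mem_erase, not_or]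
    constructor
    · rintro ⟨⟨_, h2, h3⟩, h4⟩
      exact ⟨h2, h3, h4⟩
    · rintro ⟨h2, h3, h4⟩
      exact ⟨⟨fun hye => heA (hye ▸ h4), h2, h3⟩, h4⟩
  · rw [sub_zero]
    apply Finset.sum_congr _ (fun _ _ => rfl)
    ext y
    simp only [Finset.mem_filter, Finset.mem_compl, Finset.mem_insert, not_or]
    constructor
    · rintro ⟨⟨_, h2, h3⟩, h4⟩
      exact ⟨h3, h4⟩
    · rintro ⟨h3, h4⟩
      exact ⟨⟨fun hye => heA (hye ▸ h4), fun hyx => h (hyx ▸ h4), h3⟩, h4⟩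

/-- The number of half-edges outside `D` at the node `u`. -/
def freeDeg (D : Finset (ν × ι)) (u : ν) : ℕ := (Dᶜ.filter fun x => x.1 = u).card

theorem freeDeg_anti {D D' : Finset (ν × ι)} (h : D ⊆ D') (u : ν) :
    freeDeg D' u ≤ freeDeg D u := by
  apply Finset.card_le_card
  intro x
  simp only [Finset.mem_filter, Finset.mem_compl]
  exact fun hx => ⟨fun hD => hx.1 (h hD), hx.2⟩

theorem card_filter_fst_eq_le (W : Finset (ν × ι)) (w : ν) :
    (W.filter fun e => e.1 = w).card ≤ Fintype.card ι := by
  rw [← Finset.card_univ]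
  apply Finset.card_le_card_of_injOn Prod.snd (fun _ _ => Finset.mem_coe.2 (Finset.mem_univ _))
  intro x hx y hy h
  simp only [Finset.coe_filter, Set.mem_ofPred_eq] at hx hy
  exact Prod.ext (hx.2.trans hy.2.symm) h

/-- The conditions on the constants in the exponential bounds below. -/
structure Consts (ν ι : Type) [Fintype ι] (a : ν → ℝ) (A : Finset ν)
    (P L K m₀ m₁ γ β : ℝ) : Prop where
  a_nonneg : ∀ u ∈ A, 0 ≤ a u
  a_le : ∀ u ∈ A, a u ≤ 1
  P_nonneg : 0 ≤ P
  P_le : ∀ u ∈ A, P ≤ Fintype.card ι * a u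
  m₀_pos : 0 < m₀
  β_nonneg : 0 ≤ β
  γ_le : γ ≤ 1
  γ_ge : β * K + 2 * (Fintype.card ι : ℝ) ^ 2 / m₀ ≤ γ
  β_le : β * m₁ ≤ 1 - 3 * γ
  βL_le : β * L ≤ 1

variable {P L K m₀ m₁ γ β : ℝ}

theorem Consts.step (h : Consts ν ι a A P L K m₀ m₁ γ β) {Λ b M : ℝ} (hΛ : 0 ≤ Λ) (hb : 0 ≤ b)
    (hm₀ : m₀ ≤ M) (hm₁ : M ≤ m₁) :
    Real.exp (β * Λ - 2 * P / m₀ * b) * (M - (1 - 3 * γ) * Λ + 2 * (b * P)) ≤ M := by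
  have hM : 0 < M := h.m₀_pos.trans_le hm₀
  have h1 : M - (1 - 3 * γ) * Λ + 2 * (b * P) ≤
      M * Real.exp (-(β * Λ - 2 * P / m₀ * b)) := by
    have h2 := Real.add_one_le_exp (-(β * Λ - 2 * P / m₀ * b))
    have h3 := mul_le_mul_of_nonneg_left h2 hM.le
    refine le_trans ?_ h3
    have h4 : β * M * Λ ≤ (1 - 3 * γ) * Λ :=
      mul_le_mul_of_nonneg_right ((mul_le_mul_of_nonneg_left hm₁ h.β_nonneg).trans h.β_le) hΛ
    have h5 : 2 * (b * P) ≤ M * (2 * P / m₀ * b) := by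
      have : 2 * (b * P) = m₀ * (2 * P / m₀ * b) := by
        have := h.m₀_pos.ne'
        field_simp
      rw [this]
      have := h.P_nonneg
      have := h.m₀_pos
      gcongr
    linarith
  have h6 := mul_le_mul_of_nonneg_left h1 (Real.exp_pos (β * Λ - 2 * P / m₀ * b)).le
  refine h6.trans (le_of_eq ?_)
  rw [mul_left_comm, ← Real.exp_add]
  simp

set_option maxHeartbeats 1000000 in
open Classical in
theorem avg_hitProd_le (h : Consts ν ι a A P L K m₀ m₁ γ β) (hAN : Disjoint A N) (k : ℕ) :
    ∀ (W : Finset (ν × ι)) (B : Finset (ν × ν)) (D : Finset (ν × ι)) (f₀ : Inv (ν × ι)),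
      W.card = k → Closed D f₀ → (∀ e ∈ W, e ∉ D ∧ e.1 ∈ N) → (k : ℝ) ≤ K →
      m₀ + 2 * k ≤ Dᶜ.card → (Dᶜ.card : ℝ) ≤ m₁ → (∀ u ∈ A, freeDeg D u * a u ≤ P) →
      weight a A D ≤ L →
      avg (fib D f₀) (hitProd a A N B W) ≤
        Real.exp (-(β * weight a A D * k) +
          2 * P / m₀ * ∑ e ∈ W, ((A.filter fun u => (u, e.1) ∈ B).card : ℝ)) := by
  have hγ0 : 0 ≤ γ ∨ K < 0 := by
    rcases lt_or_ge K 0 with hK | hK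
    · exact Or.inr hK
    · left
      have := h.γ_ge
      have := h.m₀_pos
      have := h.β_nonneg
      refine le_trans ?_ h.γ_ge
      positivity
  induction k using Nat.strong_induction_on with
  | _ k ih =>
    intro W B D f₀ hk hD hW hkK hm hm1 hP hL
    have hγ0 : 0 ≤ γ := hγ0.resolve_right (not_lt.2 (le_trans (Nat.cast_nonneg k) hkK))
    rcases W.eq_empty_or_nonempty with rfl | ⟨e, he⟩
    · simp only [Finset.card_empty] at hk
      subst hk
      rw [avg_congr (g' := fun _ => 1)]
      · simp [avg_const (fib_nonempty D f₀)]
      · intro f _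
        simp [hitProd]
    have heD : e ∉ D := (hW e he).1
    have heN : e.1 ∈ N := (hW e he).2
    have heA : e.1 ∉ A := Finset.disjoint_right.1 hAN heN
    have hk1 : 1 ≤ k := hk ▸ Finset.card_pos.2 ⟨e, he⟩
    have hk1' : (1 : ℝ) ≤ k := by exact_mod_cast hk1
    have hM2 : (2 : ℝ) ≤ Dᶜ.card := by exact_mod_cast two_le_card_compl hD heD
    set Λ := weight a A D with hΛdef
    have hΛ : 0 ≤ Λ := weight_nonneg h.a_nonneg D
    set τ := 2 * P / m₀ with hτdef
    have hτ : 0 ≤ τ := by have := h.P_nonneg; have := h.m₀_pos; positivity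
    set blk : ν → ℝ := fun w => ((A.filter fun u => (u, w) ∈ B).card : ℝ) with hblk
    set S := ∑ e ∈ W, blk e.1 with hS
    have hblk0 : ∀ w, 0 ≤ blk w := fun w => Nat.cast_nonneg _
    set q := Real.exp (β * Λ - τ * blk e.1) with hq
    set Z := Real.exp (-(β * Λ * k) + τ * S) with hZ
    have hsplit : ∀ c, Real.exp ((-(β * Λ * k) + τ * S) + ((β * Λ - τ * blk e.1) + c)) =
        Z * (q * Real.exp c) := fun c => by rw [hZ, hq, ← Real.exp_add, ← Real.exp_add]
    have hβΛ : β * Λ ≤ 1 := (mul_le_mul_of_nonneg_left hL h.β_nonneg).trans h.βL_le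
    have hβΛ0 : 0 ≤ β * Λ := mul_nonneg h.β_nonneg hΛ
    refine avg_fib_le hD heD
      (b := fun x => Z * (q * (1 - (if x.1 ∈ A then (1 - γ) * a x.1 else 0) +
        (if x.1 ∈ A ∧ (x.1, e.1) ∈ B then 2 * a x.1 else 0) +
        (if x ∈ W then 2 * (β * Λ) else 0)))) ?_ ?_
    · intro x hx hxe f₁ hf₁ hfx
      set W' := (W.erase e).erase x with hW'
      have hcard := card_compl_insert_pair heD hx hxe
      have h1 : (Dᶜ.card : ℝ) = (insert e (insert x D))ᶜ.card + 2 := by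
        exact_mod_cast hcard.symm
      have hW'lt : W'.card ≤ k - 1 := by
        calc W'.card ≤ (W.erase e).card := Finset.card_erase_le
          _ = k - 1 := by rw [Finset.card_erase_of_mem he, hk]
      have h2 : (W'.card : ℝ) ≤ (k : ℝ) - 1 := by
        rw [← Nat.cast_one, ← Nat.cast_sub hk1]; exact_mod_cast hW'lt
      have hW'W : W' ⊆ W := (Finset.erase_subset _ _).trans (Finset.erase_subset _ _)
      have hDD : D ⊆ insert e (insert x D) :=
        (Finset.subset_insert _ _).trans (Finset.subset_insert _ _)
      have hIH : ∀ B' : Finset (ν × ν),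
          avg (fib (insert e (insert x D)) f₁) (hitProd a A N B' W') ≤
            Real.exp (-(β * weight a A (insert e (insert x D)) * W'.card) +
              τ * ∑ e ∈ W', ((A.filter fun u => (u, e.1) ∈ B').card : ℝ)) := by
        intro B'
        refine ih W'.card (by omega) W' B' (insert e (insert x D)) f₁ rfl
          ((hD.of_mem_fib hf₁).insert_pair hfx) ?_ (by linarith) (by linarith) (by linarith) ?_
          ((weight_anti h.a_nonneg hDD).trans hL)
        · intro y hy
          simp only [hW', Finset.mem_erase] at hy
          simp only [Finset.mem_insert, not_or]
          exact ⟨⟨hy.2.1, hy.1, (hW y hy.2.2).1⟩, (hW y hy.2.2).2⟩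
        · intro u hu
          refine le_trans ?_ (hP u hu)
          have := freeDeg_anti hDD u
          have := h.a_nonneg u hu
          gcongr
      have hSe : S = blk e.1 + ∑ y ∈ W.erase e, blk y.1 := (Finset.add_sum_erase _ _ he).symm
      have hSW' : ∑ y ∈ W', blk y.1 ≤ S - blk e.1 := by
        rw [hSe, add_sub_cancel_left]
        exact Finset.sum_le_sum_of_subset_of_nonneg (Finset.erase_subset _ _)
          fun y _ _ => hblk0 _
      have hwt := weight_insert_pair (a := a) hx heA
      rw [← hΛdef] at hwt
      have hfe : ∀ f ∈ fib (insert e (insert x D)) f₁, f.1 e = x := fun f hf => by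
        rw [mem_fib.1 hf e (by simp), hfx]
      by_cases hxA : x.1 ∈ A
      · have hax0 := h.a_nonneg _ hxA
        have hax1 := h.a_le _ hxA
        have hxW : x ∉ W := fun hxW => Finset.disjoint_left.1 hAN hxA (hW x hxW).2
        have hcW' : (W'.card : ℝ) = k - 1 := by
          rw [hW', Finset.erase_eq_of_notMem (by simp [hxW]), Finset.card_erase_of_mem he, hk,
            Nat.cast_sub hk1]
          simp
        rw [if_pos hxA] at hwt
        simp only [hxA, hxW, if_true, if_false, true_and, add_zero]
        have hγa : β * a x.1 * (k - 1) + τ * Fintype.card ι ≤ γ * a x.1 := by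
          have h3 := mul_le_mul_of_nonneg_right h.γ_ge hax0
          have h4 : β * a x.1 * (k - 1) ≤ β * K * a x.1 := by
            have : β * a x.1 * (k - 1) ≤ β * a x.1 * K :=
              mul_le_mul_of_nonneg_left (by linarith) (mul_nonneg h.β_nonneg hax0)
            linarith
          have h5 : τ * Fintype.card ι ≤ 2 * (Fintype.card ι : ℝ) ^ 2 / m₀ * a x.1 := by
            rw [hτdef, div_mul_eq_mul_div, div_mul_eq_mul_div]
            apply div_le_div_of_nonneg_right _ h.m₀_pos.le
            have := mul_le_mul_of_nonneg_left (h.P_le _ hxA)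
              (Nat.cast_nonneg (α := ℝ) (Fintype.card ι))
            nlinarith
          linarith
        by_cases hxB : (x.1, e.1) ∈ B
        · simp only [hxB, if_true]
          refine (avg_mono fun f _ =>
            hitProd_mono h.a_nonneg h.a_le (subset_refl B) hW'W f).trans ((hIH B).trans ?_)
          have h6 : -(β * weight a A (insert e (insert x D)) * W'.card) +
              τ * ∑ y ∈ W', blk y.1 ≤
              (-(β * Λ * k) + τ * S) + ((β * Λ - τ * blk e.1) + γ * a x.1) := by
            rw [hwt, hcW']
            have := mul_le_mul_of_nonneg_left hSW' hτ
            have : 0 ≤ τ * (Fintype.card ι : ℝ) := by positivity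
            linarith
          refine (Real.exp_le_exp.2 h6).trans ?_
          rw [hsplit]
          have h7 : Real.exp (γ * a x.1) ≤ 1 - (1 - γ) * a x.1 + 2 * a x.1 := by
            have := exp_le_one_add_two_mul (y := γ * a x.1) (by positivity)
              (mul_le_one₀ h.γ_le hax0 hax1)
            nlinarith [h.γ_le]
          gcongr
        · simp only [hxB, if_false, add_zero]
          have hpt : ∀ f ∈ fib (insert e (insert x D)) f₁, hitProd a A N B W f ≤
              (1 - a x.1) * hitProd a A N (insert (x.1, e.1) B) W' f := by
            intro f hf
            have := hitProd_hit h.a_nonneg h.a_le (B := B) hW'W (f := f) he heN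
              (by rw [hfe f hf]; exact hxA) (by rw [hfe f hf]; exact hxB)
            rwa [hfe f hf] at this
          refine (avg_mono hpt).trans ?_
          rw [avg_const_mul]
          refine (mul_le_mul_of_nonneg_left (hIH _) (sub_nonneg.2 hax1)).trans ?_
          have hS' : ∑ y ∈ W', ((A.filter fun u => (u, y.1) ∈ insert (x.1, e.1) B).card : ℝ) ≤
              S - blk e.1 + Fintype.card ι := by
            have h8 : ∀ y ∈ W', ((A.filter fun u => (u, y.1) ∈ insert (x.1, e.1) B).card : ℝ) ≤
                blk y.1 + if y.1 = e.1 then 1 else 0 := by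
              intro y _
              change _ ≤ ((A.filter fun u => (u, y.1) ∈ B).card : ℝ) + _
              by_cases hy : y.1 = e.1
              · rw [if_pos hy]
                have : (A.filter fun u => (u, y.1) ∈ insert (x.1, e.1) B) ⊆
                    insert x.1 (A.filter fun u => (u, y.1) ∈ B) := by
                  intro u
                  simp only [Finset.mem_filter, Finset.mem_insert, Prod.mk.injEq]
                  tauto
                exact_mod_cast (Finset.card_le_card this).trans (Finset.card_insert_le _ _)
              · rw [if_neg hy, add_zero]
                have : (A.filter fun u => (u, y.1) ∈ insert (x.1, e.1) B) ⊆
                    (A.filter fun u => (u, y.1) ∈ B) := by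
                  intro u
                  simp only [Finset.mem_filter, Finset.mem_insert, Prod.mk.injEq]
                  tauto
                exact_mod_cast Finset.card_le_card this
            refine (Finset.sum_le_sum h8).trans ?_
            rw [Finset.sum_add_distrib, ← Finset.sum_filter, Finset.sum_const, nsmul_eq_mul,
              mul_one]
            have := card_filter_fst_eq_le W' e.1
            have : ((W'.filter fun y => y.1 = e.1).card : ℝ) ≤ Fintype.card ι := by
              exact_mod_cast this
            linarith
          have h6 : -(β * weight a A (insert e (insert x D)) * W'.card) +
              τ * ∑ y ∈ W', ((A.filter fun u => (u, y.1) ∈ insert (x.1, e.1) B).card : ℝ) ≤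
              (-(β * Λ * k) + τ * S) + ((β * Λ - τ * blk e.1) + γ * a x.1) := by
            rw [hwt, hcW']
            have := mul_le_mul_of_nonneg_left hS' hτ
            linarith
          refine (mul_le_mul_of_nonneg_left (Real.exp_le_exp.2 h6) (sub_nonneg.2 hax1)).trans ?_
          rw [hsplit]
          calc (1 - a x.1) * (Z * (q * Real.exp (γ * a x.1)))
              = Z * (q * ((1 - a x.1) * Real.exp (γ * a x.1))) := by ring
            _ ≤ _ := by
              have := one_sub_mul_exp_le hax0 hax1 hγ0 h.γ_le
              gcongr
      · simp only [hxA, if_false, false_and, sub_zero, add_zero]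
        rw [if_neg hxA, sub_zero] at hwt
        refine (avg_mono fun f _ =>
            hitProd_mono h.a_nonneg h.a_le (subset_refl B) hW'W f).trans ((hIH B).trans ?_)
        rw [hwt]
        have hle := mul_le_mul_of_nonneg_left hSW' hτ
        by_cases hxW : x ∈ W
        · simp only [hxW, if_true]
          have hc : W'.card = k - 2 := by
            rw [hW', Finset.card_erase_of_mem (by simp [hxW, hxe]),
              Finset.card_erase_of_mem he, hk]
            omega
          have hk2 : 2 ≤ k := by
            rw [← hk, ← Finset.card_pair hxe.symm]
            exact Finset.card_le_card (by intro z; simp; rintro (rfl | rfl) <;> assumption)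
          have hc' : (W'.card : ℝ) = k - 2 := by rw [hc, Nat.cast_sub hk2]; simp
          have h6 : -(β * Λ * W'.card) + τ * ∑ y ∈ W', blk y.1 ≤
              (-(β * Λ * k) + τ * S) + ((β * Λ - τ * blk e.1) + β * Λ) := by
            rw [hc']
            linarith
          refine (Real.exp_le_exp.2 h6).trans ?_
          rw [hsplit]
          have := exp_le_one_add_two_mul hβΛ0 hβΛ
          gcongr
        · simp only [hxW, if_false, add_zero, mul_one]
          have hcW' : (W'.card : ℝ) = k - 1 := by
            rw [hW', Finset.erase_eq_of_notMem (by simp [hxW]), Finset.card_erase_of_mem he, hk,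
              Nat.cast_sub hk1]
            simp
          have h6 : -(β * Λ * W'.card) + τ * ∑ y ∈ W', blk y.1 ≤
              (-(β * Λ * k) + τ * S) + (β * Λ - τ * blk e.1) := by
            rw [hcW']
            linarith
          refine (Real.exp_le_exp.2 h6).trans ?_
          rw [Real.exp_add]
    · have hce : (((Dᶜ.erase e).card : ℕ) : ℝ) = (Dᶜ.card : ℝ) - 1 := by
        rw [Finset.card_erase_of_mem (by simpa using heD), Nat.cast_sub]
        · simp
        · exact Finset.card_pos.2 ⟨e, by simpa using heD⟩
      rw [← Finset.mul_sum, ← Finset.mul_sum]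
      apply mul_le_mul_of_nonneg_left _ (Real.exp_pos _).le
      refine le_trans ?_ (h.step hΛ (hblk0 e.1) (M := (Dᶜ.card : ℝ) - 1) (by linarith)
        (by linarith))
      apply mul_le_mul_of_nonneg_left _ (Real.exp_pos _).le
      rw [Finset.sum_add_distrib, Finset.sum_add_distrib, Finset.sum_sub_distrib,
        ← Finset.sum_filter, ← Finset.sum_filter, ← Finset.sum_filter, Finset.sum_const,
        Finset.sum_const, nsmul_eq_mul, nsmul_eq_mul, hce, mul_one]
      have e1 : ∑ x ∈ (Dᶜ.erase e).filter (fun x => x.1 ∈ A), (1 - γ) * a x.1 = (1 - γ) * Λ := by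
        rw [← Finset.mul_sum, hΛdef, weight]
        congr 1
        apply Finset.sum_congr _ (fun _ _ => rfl)
        ext y
        simp only [Finset.mem_filter, Finset.mem_erase, Finset.mem_compl]
        constructor
        · rintro ⟨⟨_, h2⟩, h3⟩; exact ⟨h2, h3⟩
        · rintro ⟨h2, h3⟩; exact ⟨⟨fun h => heA (h ▸ h3), h2⟩, h3⟩
      have e2 : ∑ x ∈ (Dᶜ.erase e).filter (fun x => x.1 ∈ A ∧ (x.1, e.1) ∈ B), 2 * a x.1 ≤
          2 * (blk e.1 * P) := by
        rw [← Finset.mul_sum]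
        apply mul_le_mul_of_nonneg_left _ zero_le_two
        have hmaps : ∀ x ∈ (Dᶜ.erase e).filter (fun x => x.1 ∈ A ∧ (x.1, e.1) ∈ B),
            x.1 ∈ A.filter fun u => (u, e.1) ∈ B := by
          intro x hx
          simpa using (Finset.mem_filter.1 hx).2
        rw [← Finset.sum_fiberwise_of_maps_to hmaps, hblk, ← nsmul_eq_mul]
        apply Finset.sum_le_card_nsmul
        intro u hu
        have huA := (Finset.mem_filter.1 hu).1
        refine le_trans ?_ (hP u huA)
        rw [Finset.sum_congr rfl (g := fun _ => a u)
          (fun x hx => by rw [(Finset.mem_filter.1 hx).2]), Finset.sum_const, nsmul_eq_mul]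
        apply mul_le_mul_of_nonneg_right _ (h.a_nonneg u huA)
        exact_mod_cast Finset.card_le_card fun x hx => by
          simp only [Finset.mem_filter, Finset.mem_erase] at hx ⊢
          exact ⟨hx.1.1.2, hx.2⟩
      have e3 : (((Dᶜ.erase e).filter (fun x => x ∈ W)).card : ℝ) * (2 * (β * Λ)) ≤
          2 * γ * Λ := by
        have h8 : (((Dᶜ.erase e).filter (fun x => x ∈ W)).card : ℝ) ≤ K := by
          refine le_trans ?_ hkK
          rw [← hk]
          exact_mod_cast Finset.card_le_card fun x hx => (Finset.mem_filter.1 hx).2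
        have h9 : β * K ≤ γ := by
          have := h.γ_ge
          have : 0 ≤ 2 * (Fintype.card ι : ℝ) ^ 2 / m₀ := by have := h.m₀_pos; positivity
          linarith
        have h10 := mul_le_mul_of_nonneg_right h8 (by positivity : 0 ≤ 2 * (β * Λ))
        have h11 := mul_le_mul_of_nonneg_right h9 hΛ
        linarith
      linarith

end Hits

section Found

variable {ν ι : Type} [Fintype ν] [DecidableEq ν] [Fintype ι] [DecidableEq ι]

open Classical in
/-- The product of `1 - a u` over all adjacent pairs `(u, w)` in `A × N`. -/
noncomputable def adjProd (a : ν → ℝ) (A N : Finset ν) (f : Inv (ν × ι)) : ℝ :=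
  ∏ z ∈ A ×ˢ N, if ∃ b, (f.1 (z.2, b)).1 = z.1 then 1 - a z.1 else 1

open Classical in
/-- The nodes of `N`, and the nodes outside `U ∪ V` at half-edges matched to `K`. -/
noncomputable def found (U V N : Finset ν) (K : Finset (ν × ι)) (f : Inv (ν × ι)) : Finset ν :=
  N ∪ Finset.univ.filter fun w => w ∉ U ∪ V ∧ ∃ e ∈ K, (f.1 e).1 = w

variable {a : ν → ℝ} {A : Finset ν}

theorem adjProd_anti (ha0 : ∀ u ∈ A, 0 ≤ a u) (ha1 : ∀ u ∈ A, a u ≤ 1) {N N' : Finset ν}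
    (h : N ⊆ N') (f : Inv (ν × ι)) : adjProd a A N' f ≤ adjProd a A N f := by
  unfold adjProd
  rw [← Finset.prod_sdiff (Finset.product_subset_product_right (s := A) h)]
  apply mul_le_of_le_one_left
  · apply Finset.prod_nonneg
    intro z hz
    have := ha1 z.1 (Finset.mem_product.1 hz).1
    split_ifs <;> linarith
  · apply Finset.prod_le_one
    · intro z hz
      have := ha1 z.1 (Finset.mem_product.1 (Finset.mem_sdiff.1 hz).1).1
      split_ifs <;> linarith
    · intro z hz
      have := ha0 z.1 (Finset.mem_product.1 (Finset.mem_sdiff.1 hz).1).1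
      split_ifs <;> linarith

theorem adjProd_nonneg (ha1 : ∀ u ∈ A, a u ≤ 1) (N : Finset ν) (f : Inv (ν × ι)) :
    0 ≤ adjProd a A N f := by
  apply Finset.prod_nonneg
  intro z hz
  have := ha1 z.1 (Finset.mem_product.1 hz).1
  split_ifs <;> linarith

theorem adjProd_le_hitProd (ha0 : ∀ u ∈ A, 0 ≤ a u) (ha1 : ∀ u ∈ A, a u ≤ 1) (N : Finset ν)
    (W : Finset (ν × ι)) (f : Inv (ν × ι)) : adjProd a A N f ≤ hitProd a A N ∅ W f := by
  apply Finset.prod_le_prod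
  · intro z hz
    have := ha1 z.1 (Finset.mem_product.1 hz).1
    split_ifs <;> linarith
  · intro z hz
    have := ha0 z.1 (Finset.mem_product.1 hz).1
    by_cases h : z ∉ (∅ : Finset (ν × ν)) ∧ ∃ e ∈ W, e.1 = z.2 ∧ (f.1 e).1 = z.1
    · obtain ⟨h1, e, he, h2, h3⟩ := h
      rw [if_pos ⟨e.2, by rw [← h2]; exact h3⟩, if_pos ⟨h1, e, he, h2, h3⟩]
    · rw [if_neg h]
      split_ifs <;> linarith

variable {P L K₀ m₀ m₁ γ β : ℝ}

theorem avg_adjProd_le (h : Consts ν ι a A P L K₀ m₀ m₁ γ β) {N : Finset ν}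
    (hAN : Disjoint A N) {D : Finset (ν × ι)} {f₀ : Inv (ν × ι)} (hD : Closed D f₀)
    {W : Finset (ν × ι)} (hW : ∀ e ∈ W, e ∉ D ∧ e.1 ∈ N) (hK : (W.card : ℝ) ≤ K₀)
    (hm : m₀ + 2 * W.card ≤ Dᶜ.card) (hm₁ : (Dᶜ.card : ℝ) ≤ m₁)
    (hP : ∀ u ∈ A, freeDeg D u * a u ≤ P) (hL : weight a A D ≤ L) :
    avg (fib D f₀) (adjProd a A N) ≤ Real.exp (-(β * weight a A D * W.card)) := by
  refine (avg_mono fun f _ => adjProd_le_hitProd h.a_nonneg h.a_le N W f).trans ?_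
  refine (avg_hitProd_le h hAN W.card W ∅ D f₀ rfl hD hW hK hm hm₁ hP hL).trans ?_
  simp

theorem sum_card_filter_fst_le (D : Finset (ν × ι)) :
    ∑ x ∈ Dᶜ, ((D.filter fun y => y.1 = x.1).card : ℝ) ≤ Fintype.card ι * D.card := by
  have h1 : ∀ x : ν × ι, ((D.filter fun y => y.1 = x.1).card : ℝ) =
      ∑ y ∈ D, if y.1 = x.1 then (1 : ℝ) else 0 := fun x => by simp
  simp_rw [h1]
  rw [Finset.sum_comm, mul_comm, ← nsmul_eq_mul]
  apply Finset.sum_le_card_nsmul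
  intro y _
  have h2 := card_filter_fst_eq_le Dᶜ y.1
  rw [← Finset.sum_filter, Finset.sum_const, nsmul_eq_mul, mul_one]
  have h3 : (Dᶜ.filter fun x => y.1 = x.1) = Dᶜ.filter fun x => x.1 = y.1 := by
    apply Finset.filter_congr
    intro x _
    exact eq_comm
  rw [h3]
  exact_mod_cast h2

theorem card_filter_add_freeDeg (D : Finset (ν × ι)) (w : ν) :
    (D.filter fun y => y.1 = w).card + freeDeg D w = Fintype.card ι := by
  unfold freeDeg
  rw [← Finset.card_union_of_disjoint, ← Finset.filter_union, Finset.union_compl]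
  · have : (Finset.univ.filter fun y : ν × ι => y.1 = w) =
        Finset.univ.map ⟨fun b : ι => (w, b), fun b b' h => by simpa using h⟩ := by
      ext ⟨v, b⟩
      simp only [Finset.mem_filter, Finset.mem_univ, true_and, Finset.mem_map]
      exact ⟨fun h => ⟨b, Prod.ext h.symm rfl⟩, fun ⟨_, h⟩ => (congrArg Prod.fst h).symm⟩
    rw [this, Finset.card_map, Finset.card_univ]
  · exact Finset.disjoint_filter_filter disjoint_compl_right

set_option maxHeartbeats 1000000 in
theorem avg_adjProd_found_le (h : Consts ν ι a A P L K₀ m₀ m₁ γ β) {U V : Finset ν}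
    (hAU : A ⊆ U) (hUV : Disjoint U V) {ξ : ℝ} (hξ0 : 0 ≤ ξ)
    (hsmall : 2 * (β * L) * Fintype.card ι + γ ≤ 1)
    (hξ : 2 * (β * L) * Fintype.card ι * (Fintype.card (ν × ι) - m₀) +
      2 * (2 * (β * L) * Fintype.card ι + γ) * (K₀ + Fintype.card ι * (V.card + U.card))
        ≤ ξ * m₀) (k : ℕ) :
    ∀ (K : Finset (ν × ι)) (N : Finset ν) (D : Finset (ν × ι)) (f₀ : Inv (ν × ι)),
      K.card = k → Closed D f₀ → (∀ e ∈ K, e ∉ D ∧ e.1 ∈ V) → Disjoint N (U ∪ V) →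
      (((Dᶜ.filter fun x => x.1 ∈ N).card : ℝ) + Fintype.card ι * k ≤ K₀) →
      m₀ + 2 * (((Dᶜ.filter fun x => x.1 ∈ N).card : ℝ) + Fintype.card ι * k) ≤ Dᶜ.card →
      (Dᶜ.card : ℝ) ≤ m₁ → (∀ u ∈ A, freeDeg D u * a u ≤ P) → weight a A D ≤ L →
      avg (fib D f₀) (fun f => adjProd a A (found U V N K f) f) ≤
        Real.exp (-(β * weight a A D *
          ((Dᶜ.filter fun x => x.1 ∈ N).card + ((Fintype.card ι : ℝ) - 1) * k)) + ξ * k) := by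
  induction k using Nat.strong_induction_on with
  | _ k ih =>
    intro K N D f₀ hk hD hK hN hK₀ hm hm1 hP hL
    have hAN : Disjoint A N :=
      (hN.mono_right ((hAU.trans Finset.subset_union_left))).symm
    set W := Dᶜ.filter fun x => x.1 ∈ N with hWdef
    rcases K.eq_empty_or_nonempty with rfl | ⟨e, he⟩
    · simp only [Finset.card_empty] at hk
      subst hk
      have h1 : ∀ f : Inv (ν × ι), found U V N (∅ : Finset (ν × ι)) f = N := by
        intro f; simp [found]
      simp only [h1, Nat.cast_zero, mul_zero, add_zero] at hK₀ hm ⊢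
      exact avg_adjProd_le h hAN hD
        (fun e he => by simpa [hWdef] using he) hK₀ hm hm1 hP hL
    have heD : e ∉ D := (hK e he).1
    have heV : e.1 ∈ V := (hK e he).2
    have heU : e.1 ∉ U := Finset.disjoint_right.1 hUV heV
    have heA : e.1 ∉ A := fun h => heU (hAU h)
    have heN : e.1 ∉ N := fun h =>
      Finset.disjoint_left.1 hN h (Finset.mem_union_right _ heV)
    have hk1 : 1 ≤ k := hk ▸ Finset.card_pos.2 ⟨e, he⟩
    have hk1' : (1 : ℝ) ≤ k := by exact_mod_cast hk1
    have hM2 : (2 : ℝ) ≤ Dᶜ.card := by exact_mod_cast two_le_card_compl hD heD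
    set d : ℝ := (Fintype.card ι : ℝ) with hd
    have hd1 : 1 ≤ d := by
      rw [hd]; exact_mod_cast Fintype.card_pos_iff.2 ⟨e.2⟩
    set Λ := weight a A D with hΛdef
    have hΛ : 0 ≤ Λ := weight_nonneg h.a_nonneg D
    have hβΛL : β * Λ ≤ β * L := mul_le_mul_of_nonneg_left hL h.β_nonneg
    have hβΛ0 : 0 ≤ β * Λ := mul_nonneg h.β_nonneg hΛ
    have hγ0 : 0 ≤ γ := by
      have := h.γ_ge
      have := h.m₀_pos
      have : 0 ≤ β * K₀ := mul_nonneg h.β_nonneg (le_trans (by positivity) hK₀)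
      refine le_trans ?_ h.γ_ge
      positivity
    set Z := Real.exp (-(β * Λ * (W.card + (d - 1) * k)) + ξ * k) with hZ
    set s := 2 * (2 * (β * L) * d + γ) with hs
    have hs0 : 0 ≤ s := by
      have : 0 ≤ β * L := hβΛ0.trans hβΛL
      positivity
    refine avg_fib_le hD heD
      (b := fun x => Z * Real.exp (-ξ) *
        (1 + 2 * (β * L) * ((D.filter fun y => y.1 = x.1).card : ℝ) +
          if x.1 ∈ N ∪ (V ∪ U) then s else 0)) ?_ ?_
    · intro x hx hxe f₁ hf₁ hfx
      set K' := (K.erase e).erase x with hK'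
      set D' := insert e (insert x D) with hD'
      have hcard := card_compl_insert_pair heD hx hxe
      have h1 : (Dᶜ.card : ℝ) = D'ᶜ.card + 2 := by
        exact_mod_cast hcard.symm
      have hK'lt : K'.card ≤ k - 1 := by
        calc K'.card ≤ (K.erase e).card := Finset.card_erase_le
          _ = k - 1 := by rw [Finset.card_erase_of_mem he, hk]
      have h2 : (K'.card : ℝ) ≤ (k : ℝ) - 1 := by
        rw [← Nat.cast_one, ← Nat.cast_sub hk1]; exact_mod_cast hK'lt
      have hK'K : K' ⊆ K := (Finset.erase_subset _ _).trans (Finset.erase_subset _ _)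
      have hDD : D ⊆ D' :=
        (Finset.subset_insert _ _).trans (Finset.subset_insert _ _)
      have hIH : ∀ N' : Finset ν, Disjoint N' (U ∪ V) →
          ((D'ᶜ.filter fun x => x.1 ∈ N').card : ℝ) + d * K'.card ≤ W.card + d * k - 1 →
          avg (fib D' f₁) (fun f => adjProd a A (found U V N' K' f) f) ≤
            Real.exp (-(β * weight a A D' *
              ((D'ᶜ.filter fun x => x.1 ∈ N').card + (d - 1) * K'.card)) + ξ * K'.card) := by
        intro N' hN' hle
        refine ih K'.card (by omega) K' N' D' f₁ rfl
          ((hD.of_mem_fib hf₁).insert_pair hfx) ?_ hN' (by linarith) (by linarith)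
          (by linarith) ?_ ((weight_anti h.a_nonneg hDD).trans hL)
        · intro y hy
          simp only [hK', Finset.mem_erase] at hy
          simp only [hD', Finset.mem_insert, not_or]
          exact ⟨⟨hy.2.1, hy.1, (hK y hy.2.2).1⟩, (hK y hy.2.2).2⟩
        · intro u hu
          refine le_trans ?_ (hP u hu)
          have := freeDeg_anti hDD u
          have := h.a_nonneg u hu
          gcongr
      have hwt := weight_insert_pair (a := a) hx heA
      rw [← hΛdef, ← hD'] at hwt
      have hκd : ((D.filter fun y => y.1 = x.1).card : ℝ) ≤ d := by
        rw [hd]; exact_mod_cast card_filter_fst_eq_le D x.1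
      by_cases hfresh : x.1 ∈ N ∪ (V ∪ U)
      · rw [if_pos hfresh]
        have hpt : ∀ f ∈ fib D' f₁, adjProd a A (found U V N K f) f ≤
            adjProd a A (found U V N K' f) f := by
          intro f _
          apply adjProd_anti h.a_nonneg h.a_le
          apply Finset.union_subset_union_right
          intro w
          simp only [Finset.mem_filter, Finset.mem_univ, true_and]
          rintro ⟨hw, y, hy, hyw⟩
          exact ⟨hw, y, hK'K hy, hyw⟩
        have hW'sub : (D'ᶜ.filter fun x => x.1 ∈ N) ⊆ W := by
          intro y
          simp only [hWdef, Finset.mem_filter, Finset.mem_compl]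
          exact fun hy => ⟨fun hyD => hy.1 (hDD hyD), hy.2⟩
        have hW'card : ((D'ᶜ.filter fun x => x.1 ∈ N).card : ℝ) ≤ W.card := by
          exact_mod_cast Finset.card_le_card hW'sub
        have hW'ge : (W.card : ℝ) - 1 ≤ ((D'ᶜ.filter fun x => x.1 ∈ N).card : ℝ) := by
          have : W ⊆ insert x (D'ᶜ.filter fun x => x.1 ∈ N) := by
            intro y
            simp only [hWdef, hD', Finset.mem_filter, Finset.mem_compl, Finset.mem_insert, not_or]
            rintro ⟨hy1, hy2⟩
            by_cases hyx : y = x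
            · exact Or.inl hyx
            · exact Or.inr ⟨⟨fun hye => heN (hye ▸ hy2), hyx, hy1⟩, hy2⟩
          have := (Finset.card_le_card this).trans (Finset.card_insert_le _ _)
          rw [sub_le_iff_le_add]
          exact_mod_cast this
        have hK'ge : (k : ℝ) - 2 ≤ K'.card := by
          have h3 : (K.erase e).card - 1 ≤ K'.card := Finset.pred_card_le_card_erase
          rw [Finset.card_erase_of_mem he, hk] at h3
          rw [sub_le_iff_le_add]
          have : k ≤ K'.card + 2 := by omega
          exact_mod_cast this
        refine (avg_mono hpt).trans ((hIH N hN (by nlinarith)).trans ?_)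
        set W' := (D'ᶜ.filter fun x => x.1 ∈ N) with hW'
        set κ' : ℝ := W'.card + (d - 1) * K'.card with hκ'
        have hκ'0 : 0 ≤ κ' := by
          have : 0 ≤ d - 1 := by linarith
          positivity
        have hκ'K : κ' ≤ K₀ := by
          have h3 : (d - 1) * K'.card ≤ (d - 1) * k :=
            mul_le_mul_of_nonneg_left (by linarith) (by linarith)
          linarith
        have hκ'ge : W.card + (d - 1) * k - 2 * d ≤ κ' := by
          have h3 : (d - 1) * (k - 2) ≤ (d - 1) * K'.card :=
            mul_le_mul_of_nonneg_left hK'ge (by linarith)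
          linarith
        have hloss : β * Λ * κ' - γ ≤ β * weight a A D' * κ' := by
          rw [hwt]
          have hβK : β * K₀ ≤ γ := by
            have := h.γ_ge
            have : 0 ≤ 2 * d ^ 2 / m₀ := by have := h.m₀_pos; positivity
            linarith
          have h4 : β * (if x.1 ∈ A then a x.1 else 0) * κ' ≤ γ := by
            split_ifs with hxA
            · have h5 : β * a x.1 * κ' ≤ β * κ' := by
                have := mul_le_mul_of_nonneg_left (h.a_le _ hxA) (mul_nonneg h.β_nonneg hκ'0)
                linarith
              have := mul_le_mul_of_nonneg_left hκ'K h.β_nonneg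
              linarith
            · simpa using hγ0
          linarith
        have h6 : -(β * weight a A D' * κ') + ξ * K'.card ≤
            ((-(β * Λ * (W.card + (d - 1) * k)) + ξ * k) + -ξ) + (2 * (β * L) * d + γ) := by
          have h7 := mul_le_mul_of_nonneg_left hκ'ge hβΛ0
          have h8 := mul_le_mul_of_nonneg_left h2 hξ0
          have h9 := mul_le_mul_of_nonneg_right hβΛL (by linarith : (0 : ℝ) ≤ d)
          linarith
        refine (Real.exp_le_exp.2 h6).trans ?_
        rw [Real.exp_add _ (2 * (β * L) * d + γ), Real.exp_add _ (-ξ)]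
        have h10 : 0 ≤ 2 * (β * L) * ((D.filter fun y => y.1 = x.1).card : ℝ) :=
          mul_nonneg (by linarith) (Nat.cast_nonneg _)
        have h11 := exp_le_one_add_two_mul (y := 2 * (β * L) * d + γ) (by linarith) hsmall
        apply mul_le_mul_of_nonneg_left _ (by positivity)
        linarith
      · rw [if_neg hfresh, add_zero]
        simp only [Finset.mem_union, not_or] at hfresh
        obtain ⟨hxN, hxV, hxU⟩ := hfresh
        have hxA : x.1 ∉ A := fun h => hxU (hAU h)
        rw [if_neg hxA, sub_zero] at hwt
        have hxK : x ∉ K := fun h => hxV (hK x h).2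
        have hcK' : (K'.card : ℝ) = k - 1 := by
          rw [hK', Finset.erase_eq_of_notMem (by simp [hxK]), Finset.card_erase_of_mem he, hk,
            Nat.cast_sub hk1]
          simp
        have hW' : ((D'ᶜ.filter fun y => y.1 ∈ insert x.1 N).card : ℝ) =
            W.card + (d - ((D.filter fun y => y.1 = x.1).card : ℝ)) - 1 := by
          have e1 : (D'ᶜ.filter fun y => y.1 ∈ insert x.1 N) =
              W ∪ (Dᶜ.filter fun y => y.1 = x.1).erase x := by
            ext y
            simp only [hWdef, hD', Finset.mem_filter, Finset.mem_compl, Finset.mem_insert, not_or,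
              Finset.mem_union, Finset.mem_erase]
            constructor
            · rintro ⟨⟨_, h4, h5⟩, h6 | h6⟩
              · exact Or.inr ⟨h4, h5, h6⟩
              · exact Or.inl ⟨h5, h6⟩
            · rintro (⟨h4, h5⟩ | ⟨h4, h5, h6⟩)
              · exact ⟨⟨fun h => heN (h ▸ h5), fun h => hxN (h ▸ h5), h4⟩, Or.inr h5⟩
              · exact ⟨⟨fun h => hxV (h6 ▸ h ▸ heV), h4, h5⟩, Or.inl h6⟩
          have e2 : Disjoint W ((Dᶜ.filter fun y => y.1 = x.1).erase x) := by
            rw [Finset.disjoint_left]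
            intro y hy hy'
            simp only [hWdef, Finset.mem_filter, Finset.mem_erase] at hy hy'
            exact hxN (hy'.2.2 ▸ hy.2)
          have e3 : x ∈ Dᶜ.filter fun y => y.1 = x.1 := by simp [hx]
          rw [e1, Finset.card_union_of_disjoint e2, Finset.card_erase_of_mem e3, Nat.cast_add,
            Nat.cast_sub (Finset.card_pos.2 ⟨x, e3⟩)]
          have e4 := card_filter_add_freeDeg D x.1
          have e5 : ((D.filter fun y => y.1 = x.1).card : ℝ) +
              ((Dᶜ.filter fun y => y.1 = x.1).card : ℝ) = d := by
            rw [hd, ← e4]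
            simp [freeDeg]
          push_cast
          linarith
        have hpt : ∀ f ∈ fib D' f₁, adjProd a A (found U V N K f) f ≤
            adjProd a A (found U V (insert x.1 N) K' f) f := by
          intro f hf
          have hfe : f.1 e = x := by rw [mem_fib.1 hf e (by simp [hD']), hfx]
          apply adjProd_anti h.a_nonneg h.a_le
          intro w
          simp only [found, Finset.mem_union, Finset.mem_insert, Finset.mem_filter,
            Finset.mem_univ, true_and]
          rintro ((rfl | hw) | ⟨hw, y, hy, hyw⟩)
          · exact Or.inr ⟨by simp [hxU, hxV], e, he, by rw [hfe]⟩
          · exact Or.inl hw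
          · exact Or.inr ⟨hw, y, hK'K hy, hyw⟩
        have hN' : Disjoint (insert x.1 N) (U ∪ V) := by
          rw [Finset.disjoint_insert_left]
          exact ⟨by simp [hxU, hxV], hN⟩
        have hκ0 : (0 : ℝ) ≤ ((D.filter fun y => y.1 = x.1).card : ℝ) := Nat.cast_nonneg _
        refine (avg_mono hpt).trans ((hIH _ hN' ?_).trans ?_)
        · rw [hW', hcK']; linarith
        · rw [hW', hcK', hwt]
          have h6 : -(β * Λ * (W.card + (d - ((D.filter fun y => y.1 = x.1).card : ℝ)) - 1 +
              (d - 1) * (k - 1))) + ξ * (k - 1) =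
              ((-(β * Λ * (W.card + (d - 1) * k)) + ξ * k) + -ξ) +
                (β * Λ * ((D.filter fun y => y.1 = x.1).card : ℝ)) := by ring
          rw [h6, Real.exp_add _ (β * Λ * ((D.filter fun y => y.1 = x.1).card : ℝ)),
            Real.exp_add _ (-ξ)]
          have h7 : β * Λ * ((D.filter fun y => y.1 = x.1).card : ℝ) ≤
              β * L * ((D.filter fun y => y.1 = x.1).card : ℝ) :=
            mul_le_mul_of_nonneg_right hβΛL hκ0
          have h8 : β * L * ((D.filter fun y => y.1 = x.1).card : ℝ) ≤ β * L * d :=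
            mul_le_mul_of_nonneg_left hκd (by linarith)
          have h9 : 0 ≤ β * L * d := mul_nonneg (by linarith) (by linarith)
          have h11 := exp_le_one_add_two_mul
            (y := β * Λ * ((D.filter fun y => y.1 = x.1).card : ℝ)) (by positivity)
            (by linarith)
          apply mul_le_mul_of_nonneg_left _ (by positivity)
          linarith
    · have hce : (((Dᶜ.erase e).card : ℕ) : ℝ) = (Dᶜ.card : ℝ) - 1 := by
        rw [Finset.card_erase_of_mem (by simpa using heD), Nat.cast_sub]
        · simp
        · exact Finset.card_pos.2 ⟨e, by simpa using heD⟩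
      rw [← Finset.mul_sum, mul_assoc]
      apply mul_le_mul_of_nonneg_left _ (Real.exp_pos _).le
      rw [Finset.sum_add_distrib, Finset.sum_add_distrib, ← Finset.sum_filter, Finset.sum_const,
        Finset.sum_const, nsmul_eq_mul, nsmul_eq_mul, hce, mul_one, ← Finset.mul_sum]
      have hβL : 0 ≤ β * L := hβΛ0.trans hβΛL
      have hdk : d ≤ d * k := by nlinarith
      have e1 : ∑ x ∈ Dᶜ.erase e, ((D.filter fun y => y.1 = x.1).card : ℝ) ≤
          d * (Fintype.card (ν × ι) - m₀) := by
        refine (Finset.sum_le_sum_of_subset_of_nonneg (Finset.erase_subset _ _)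
          fun _ _ _ => Nat.cast_nonneg _).trans ((sum_card_filter_fst_le D).trans ?_)
        apply mul_le_mul_of_nonneg_left _ (by linarith)
        have : (D.card : ℝ) + Dᶜ.card = Fintype.card (ν × ι) := by
          exact_mod_cast Finset.card_add_card_compl D
        have : (0 : ℝ) ≤ W.card := Nat.cast_nonneg _
        linarith
      have e2 : (((Dᶜ.erase e).filter fun x => x.1 ∈ N ∪ (V ∪ U)).card : ℝ) ≤
          K₀ + d * (V.card + U.card) := by
        have hsub : ((Dᶜ.erase e).filter fun x => x.1 ∈ N ∪ (V ∪ U)) ⊆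
            W ∪ (V ∪ U) ×ˢ (Finset.univ : Finset ι) := by
          intro y
          simp only [hWdef, Finset.mem_filter, Finset.mem_erase, Finset.mem_union,
            Finset.mem_product, Finset.mem_univ, and_true]
          tauto
        have h3 := (Finset.card_le_card hsub).trans (Finset.card_union_le _ _)
        rw [Finset.card_product, Finset.card_univ] at h3
        have h4 : ((V ∪ U).card : ℝ) ≤ V.card + U.card := by
          exact_mod_cast Finset.card_union_le V U
        have h5 : (((Dᶜ.erase e).filter fun x => x.1 ∈ N ∪ (V ∪ U)).card : ℝ) ≤
            W.card + (V ∪ U).card * d := by rw [hd]; exact_mod_cast h3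
        have h6 : (W.card : ℝ) ≤ K₀ := by linarith
        nlinarith
      have e3 := mul_le_mul_of_nonneg_left e1 (by linarith : 0 ≤ 2 * (β * L))
      have e4 := mul_le_mul_of_nonneg_right e2 hs0
      have hm' : m₀ ≤ (Dᶜ.card : ℝ) - 1 := by
        have : (0 : ℝ) ≤ W.card := Nat.cast_nonneg _
        linarith
      have e5 := mul_le_mul_of_nonneg_left hm' hξ0
      have e6 : 1 + ξ ≤ Real.exp ξ := by linarith [Real.add_one_le_exp ξ]
      have e7 : ((Dᶜ.card : ℝ) - 1) + ξ * ((Dᶜ.card : ℝ) - 1) ≤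
          Real.exp ξ * ((Dᶜ.card : ℝ) - 1) := by
        have := mul_le_mul_of_nonneg_right e6 (by linarith : (0 : ℝ) ≤ (Dᶜ.card : ℝ) - 1)
        linarith
      have e8 : ((Dᶜ.card : ℝ) - 1) + 2 * (β * L) *
          ∑ x ∈ Dᶜ.erase e, ((D.filter fun y => y.1 = x.1).card : ℝ) +
          (((Dᶜ.erase e).filter fun x => x.1 ∈ N ∪ (V ∪ U)).card : ℝ) * s ≤
          Real.exp ξ * ((Dᶜ.card : ℝ) - 1) := by
        refine le_trans ?_ e7
        linarith
      have e9 := mul_le_mul_of_nonneg_left e8 (Real.exp_pos (-ξ)).le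
      refine e9.trans (le_of_eq ?_)
      rw [← mul_assoc, ← Real.exp_add]
      simp

end Found

section Averages

theorem avg_product {β β' : Type} (s : Finset β) (s' : Finset β') (g : β × β' → ℝ) :
    avg (s ×ˢ s') g = avg s fun x => avg s' fun y => g (x, y) := by
  unfold avg
  rw [Finset.sum_product, Finset.card_product, Nat.cast_mul, ← Finset.sum_div, div_div, mul_comm]

/-- The average of the averages over the classes of a partition. -/
theorem sum_avg_class {Ω : Type} [Fintype Ω] (cl : Ω → Finset Ω) (hself : ∀ ω, ω ∈ cl ω)
    (hcl : ∀ ω ω', ω' ∈ cl ω → cl ω' = cl ω) (g : Ω → ℝ) :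
    ∑ ω, avg (cl ω) g = ∑ ω, g ω := by
  classical
  have hsymm : ∀ ω ω', ω' ∈ cl ω ↔ ω ∈ cl ω' := fun ω ω' =>
    ⟨fun h => by rw [hcl ω ω' h]; exact hself ω, fun h => by rw [hcl ω' ω h]; exact hself ω'⟩
  have h1 : ∀ ω, avg (cl ω) g = ∑ ω', if ω' ∈ cl ω then g ω' / (cl ω').card else 0 := by
    intro ω
    rw [avg, Finset.sum_div, ← Finset.sum_filter]
    apply Finset.sum_congr
    · ext; simp
    · intro ω' hω'
      rw [hcl ω ω' (by simpa using hω')]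
  simp_rw [h1]
  rw [Finset.sum_comm]
  apply Finset.sum_congr rfl
  intro ω' _
  rw [← Finset.sum_filter, Finset.sum_const, nsmul_eq_mul]
  have h2 : (Finset.univ.filter fun ω => ω' ∈ cl ω) = cl ω' := by
    ext ω
    simp [hsymm ω ω']
  have h3 : ((cl ω').card : ℝ) ≠ 0 := by
    exact_mod_cast (Finset.card_pos.2 ⟨ω', hself ω'⟩).ne'
  rw [h2]
  field_simp

/-- Choosing a set of `k` among `a` elements avoids `s` of them. -/
theorem choose_le_pow_mul_choose {x : ℝ} (hx0 : 0 ≤ x) (hx1 : x ≤ 1) (k m : ℕ) :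
    ∀ s : ℕ, x * (m + s : ℕ) ≤ k →
      (m.choose k : ℝ) ≤ (1 - x) ^ s * ((m + s).choose k : ℝ) := by
  intro s
  induction s with
  | zero => intro _; simp
  | succ s ih =>
    intro h
    have hms : x * ((m + s : ℕ) : ℝ) ≤ k := by
      refine le_trans ?_ h
      gcongr
      omega
    refine (ih hms).trans ?_
    rw [pow_succ, mul_assoc]
    have : 0 ≤ (1 - x) ^ s := pow_nonneg (by linarith) _
    apply mul_le_mul_of_nonneg_left _ this
    rcases lt_or_ge (m + s) k with hk | hk
    · rw [Nat.choose_eq_zero_of_lt hk]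
      have : 0 ≤ 1 - x := by linarith
      simp only [Nat.cast_zero]
      positivity
    · have h1 : ((m + s).choose k : ℝ) * (m + s + 1) =
          ((m + s + 1).choose k : ℝ) * (m + s + 1 - k) := by
        have := Nat.choose_mul_succ_eq (m + s) k
        have h2 : (((m + s + 1 - k : ℕ)) : ℝ) = (m : ℝ) + s + 1 - k := by
          rw [Nat.cast_sub (by omega)]; push_cast; ring
        rw [← h2]
        exact_mod_cast this
      have h3 : (0 : ℝ) < (m : ℝ) + s + 1 := by positivity
      have h4 : ((m + s).choose k : ℝ) =
          ((m + s + 1).choose k : ℝ) * (m + s + 1 - k) / (m + s + 1) := by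
        rw [← h1]; field_simp
      rw [h4, div_le_iff₀ h3, ← add_assoc m s 1]
      have h5 : (0 : ℝ) ≤ ((m + s + 1).choose k : ℝ) := Nat.cast_nonneg _
      push_cast at h
      nlinarith

end Averages

section Select

variable {n k : ℕ}

/-- The selections that agree with `c` at the nodes of `U`. -/
noncomputable def selFib (U : Finset (Fin n)) (c : Selection n k) : Finset (Selection n k) :=
  Fintype.piFinset fun u => if u ∈ U then {c u} else Finset.univ

theorem mem_selFib {U : Finset (Fin n)} {c c' : Selection n k} :
    c' ∈ selFib U c ↔ ∀ u ∈ U, c' u = c u := by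
  simp only [selFib, Fintype.mem_piFinset]
  apply forall_congr'
  intro u
  by_cases h : u ∈ U <;> simp [h]

theorem selFib_nonempty (U : Finset (Fin n)) (c : Selection n k) : (selFib U c).Nonempty :=
  ⟨c, mem_selFib.2 fun _ _ => rfl⟩

theorem card_filter_powersetCard_disjoint (A N : Finset (Fin n)) (m : ℕ) :
    (Finset.univ.filter fun s : {S : Finset (Fin n) // S ∈ A.powersetCard m} =>
      Disjoint s.1 N).card = ((A \ N).card).choose m := by
  rw [← Finset.card_powersetCard]
  apply Finset.card_bij (fun s _ => s.1)
  · intro s hs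
    have h1 := Finset.mem_powersetCard.1 s.2
    rw [Finset.mem_powersetCard]
    exact ⟨Finset.subset_sdiff.2 ⟨h1.1, (Finset.mem_filter.1 hs).2⟩, h1.2⟩
  · intro s _ s' _ h
    exact Subtype.ext h
  · intro s hs
    have h1 := Finset.mem_powersetCard.1 hs
    refine ⟨⟨s, Finset.mem_powersetCard.2 ⟨h1.1.trans Finset.sdiff_subset, h1.2⟩⟩, ?_, rfl⟩
    simpa using (Finset.subset_sdiff.1 h1.1).2

theorem card_filter_choice_le (A N : Finset (Fin n)) {x : ℝ} (hx0 : 0 ≤ x) (hx1 : x ≤ 1)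
    (hx : x * A.card ≤ (min k A.card : ℕ)) :
    ((Finset.univ.filter fun g : (A : Finset (Fin n)) →
      {S : Finset (Fin n) // S ∈ A.powersetCard (min k A.card)} =>
        Disjoint (g A).1 N).card : ℝ) ≤
    (1 - x) ^ (A ∩ N).card * (Fintype.card ((A : Finset (Fin n)) →
      {S : Finset (Fin n) // S ∈ A.powersetCard (min k A.card)}) : ℝ) := by
  classical
  have h1 : (Finset.univ.filter fun g : (A : Finset (Fin n)) →
      {S : Finset (Fin n) // S ∈ A.powersetCard (min k A.card)} => Disjoint (g A).1 N) =
      Fintype.piFinset fun A' : Finset (Fin n) =>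
        Finset.univ.filter fun s : {S : Finset (Fin n) // S ∈ A'.powersetCard (min k A'.card)} =>
          A' = A → Disjoint s.1 N := by
    ext g
    simp
  rw [h1, Fintype.card_piFinset, Fintype.card_pi, ← Finset.mul_prod_erase _ _ (Finset.mem_univ A),
    ← Finset.mul_prod_erase _ (fun A' : Finset (Fin n) => Fintype.card
      {S : Finset (Fin n) // S ∈ A'.powersetCard (min k A'.card)}) (Finset.mem_univ A)]
  have h2 : ∏ A' ∈ Finset.univ.erase A, (Finset.univ.filter fun s :
      {S : Finset (Fin n) // S ∈ A'.powersetCard (min k A'.card)} =>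
          A' = A → Disjoint s.1 N).card = ∏ A' ∈ Finset.univ.erase A, Fintype.card
      {S : Finset (Fin n) // S ∈ A'.powersetCard (min k A'.card)} := by
    apply Finset.prod_congr rfl
    intro A' hA'
    rw [← Finset.card_univ]
    congr 1
    apply Finset.filter_true_of_mem
    intro s _ h
    exact absurd h (Finset.ne_of_mem_erase hA')
  rw [h2, Nat.cast_mul, Nat.cast_mul, ← mul_assoc]
  apply mul_le_mul_of_nonneg_right _ (Nat.cast_nonneg _)
  simp only [forall_const]
  rw [card_filter_powersetCard_disjoint, Fintype.card_coe, Finset.card_powersetCard]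
  have h3 : (A \ N).card + (A ∩ N).card = A.card := Finset.card_sdiff_add_card_inter A N
  have := choose_le_pow_mul_choose hx0 hx1 (min k A.card) (A \ N).card (A ∩ N).card
    (by rw [h3]; exact hx)
  rwa [h3] at this

theorem avg_selFib_disjoint_le {U A₀ : Finset (Fin n)} (hUA : Disjoint U A₀)
    (c : Selection n k) (A : Fin n → Finset (Fin n)) (N : Finset (Fin n)) {x : Fin n → ℝ}
    (hx0 : ∀ u ∈ A₀, 0 ≤ x u) (hx1 : ∀ u ∈ A₀, x u ≤ 1)
    (hx : ∀ u ∈ A₀, x u * (A u).card ≤ (min k (A u).card : ℕ)) :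
    avg (selFib U c) (fun c' => if ∀ u ∈ A₀, Disjoint (c' u (A u)).1 N then 1 else 0) ≤
      ∏ u ∈ A₀, (1 - x u) ^ (A u ∩ N).card := by
  classical
  rw [avg_le_iff (selFib_nonempty _ _), ← Finset.sum_filter, Finset.sum_const, nsmul_eq_mul,
    mul_one]
  set S : (u : Fin n) → Finset ((A : Finset (Fin n)) →
      {S : Finset (Fin n) // S ∈ A.powersetCard (min k A.card)}) :=
    fun u => if u ∈ U then {c u} else Finset.univ with hS
  have h1 : ((selFib U c).filter fun c' => ∀ u ∈ A₀, Disjoint (c' u (A u)).1 N) =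
      Fintype.piFinset fun u => (S u).filter fun g => u ∈ A₀ → Disjoint (g (A u)).1 N := by
    ext c'
    simp only [selFib, Finset.mem_filter, Fintype.mem_piFinset, hS]
    exact ⟨fun h u => ⟨h.1 u, h.2 u⟩, fun h => ⟨fun u => (h u).1, fun u => (h u).2⟩⟩
  have h2 : (selFib U c).card = ∏ u, (S u).card := by
    rw [selFib, Fintype.card_piFinset]
  have h3 : ∏ u ∈ A₀, (1 - x u) ^ (A u ∩ N).card =
      ∏ u, if u ∈ A₀ then (1 - x u) ^ (A u ∩ N).card else 1 := by
    rw [Finset.prod_ite_mem, Finset.univ_inter]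
  rw [h1, h2, h3, Fintype.card_piFinset, Nat.cast_prod, Nat.cast_prod, ← Finset.prod_mul_distrib]
  apply Finset.prod_le_prod
  · intro u _; positivity
  · intro u _
    by_cases hu : u ∈ A₀
    · have huU : u ∉ U := Finset.disjoint_right.1 hUA hu
      simp only [hS, hu, huU, if_true, if_false, forall_const]
      exact card_filter_choice_le (A u) N (hx0 u hu) (hx1 u hu) (hx u hu)
    · simp only [hu, if_false, one_mul, false_imp_iff, Finset.filter_true]
      exact le_rfl

end Select

section Exploration

variable {n d p : ℕ}

/-- The levels `{t}, WP_0, WP_1, …`. -/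
noncomputable def lv (t : Fin n) (ω : Pairing n d × Selection n p) : ℕ → Finset (Fin n)
  | 0 => {t}
  | i + 1 => waypoints (graph ω.1) ω.2 t i

/-- The union of the levels before level `j`. -/
noncomputable def past (t : Fin n) (ω : Pairing n d × Selection n p) : ℕ → Finset (Fin n)
  | 0 => ∅
  | 1 => {t}
  | i + 2 => core (graph ω.1) ω.2 t i

variable (t : Fin n) (ω ω' : Pairing n d × Selection n p)

theorem mem_nbrs {G : SimpleGraph (Fin n)} {u v : Fin n} : v ∈ nbrs G u ↔ G.Adj u v := by
  simp [nbrs]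

theorem past_succ (j : ℕ) : past t ω (j + 1) = past t ω j ∪ lv t ω j := by
  match j with
  | 0 => simp [past, lv]
  | 1 => rfl
  | i + 2 => rfl

theorem lv_succ_succ (j : ℕ) : lv t ω (j + 2) =
    (lv t ω (j + 1)).biUnion fun u => (ω.2 u (nbrs (graph ω.1) u \ past t ω (j + 2))).1 := rfl

theorem choice_subset {k : ℕ} (c : Selection n k) (u : Fin n) (A : Finset (Fin n)) :
    (c u A).1 ⊆ A := (Finset.mem_powersetCard.1 (c u A).2).1

theorem card_choice {k : ℕ} (c : Selection n k) (u : Fin n) (A : Finset (Fin n)) :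
    (c u A).1.card = min k A.card := (Finset.mem_powersetCard.1 (c u A).2).2

theorem disjoint_past_lv (j : ℕ) : Disjoint (past t ω j) (lv t ω j) := by
  match j with
  | 0 => simp [past]
  | 1 =>
    simp only [past, lv, Finset.disjoint_singleton_left]
    intro h
    exact (mem_nbrs.1 h).1 rfl
  | i + 2 =>
    rw [lv_succ_succ, Finset.disjoint_biUnion_right]
    intro u _
    exact Finset.disjoint_of_subset_right (choice_subset _ _ _) Finset.disjoint_sdiff

theorem nbrs_congr {f f' : Pairing n d} {u : Fin n} (h : ∀ a, f'.1 (u, a) = f.1 (u, a)) :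
    nbrs (graph f') u = nbrs (graph f) u := by
  ext v
  rw [mem_nbrs, mem_nbrs]
  simp only [graph]
  simp_rw [h]

variable {t ω ω'}

theorem past_mono {i j : ℕ} (h : i ≤ j) : past t ω i ⊆ past t ω j := by
  induction j, h using Nat.le_induction with
  | base => exact subset_rfl
  | succ j _ ih => rw [past_succ]; exact ih.trans Finset.subset_union_left

theorem lv_subset_past {i j : ℕ} (h : i < j) : lv t ω i ⊆ past t ω j :=
  (by rw [past_succ]; exact Finset.subset_union_right : lv t ω i ⊆ past t ω (i + 1)).trans
    (past_mono h)

theorem past_lv_congr {j : ℕ} (hf : ∀ e : HalfEdge n d, e.1 ∈ past t ω j → ω'.1.1 e = ω.1.1 e)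
    (hc : ∀ u ∈ past t ω j, ω'.2 u = ω.2 u) :
    past t ω' j = past t ω j ∧ lv t ω' j = lv t ω j := by
  induction j with
  | zero => simp [past, lv]
  | succ j ih =>
    have hsub := past_mono (t := t) (ω := ω) (Nat.le_succ j)
    obtain ⟨h1, h2⟩ := ih (fun e he => hf e (hsub he)) (fun u hu => hc u (hsub hu))
    have h3 : past t ω' (j + 1) = past t ω (j + 1) := by
      rw [past_succ, past_succ, h1, h2]
    refine ⟨h3, ?_⟩
    match j with
    | 0 =>
      change nbrs (graph ω'.1) t = nbrs (graph ω.1) t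
      exact nbrs_congr fun a => hf (t, a) (by simp [past])
    | i + 1 =>
      rw [lv_succ_succ, lv_succ_succ, h2]
      apply Finset.biUnion_congr rfl
      intro u hu
      have hu' : u ∈ past t ω (i + 2) := lv_subset_past (Nat.lt_succ_self _) hu
      have h4 : nbrs (graph ω'.1) u = nbrs (graph ω.1) u :=
        nbrs_congr fun a => hf (u, a) hu'
      rw [h4, h3, hc u hu']

variable (t ω)

/-- The half-edges at nodes of `U`, and their partners. -/
def exposedAt (f : Pairing n d) (U : Finset (Fin n)) : Finset (HalfEdge n d) :=
  Finset.univ.filter fun e => e.1 ∈ U ∨ (f.1 e).1 ∈ U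

/-- The outcomes that agree with `ω` at the nodes before level `j`. -/
noncomputable def cls (j : ℕ) : Finset (Pairing n d × Selection n p) :=
  fib (exposedAt ω.1 (past t ω j)) ω.1 ×ˢ selFib (past t ω j) ω.2

theorem closed_exposedAt (f : Pairing n d) (U : Finset (Fin n)) : Closed (exposedAt f U) f := by
  intro e he
  simp only [exposedAt, Finset.mem_filter, Finset.mem_univ, true_and] at he ⊢
  rw [(f.2 e).1]
  exact he.symm

variable {t ω}

theorem mem_fib_exposedAt {f f' : Pairing n d} {U : Finset (Fin n)} :
    f' ∈ fib (exposedAt f U) f ↔ ∀ e : HalfEdge n d, e.1 ∈ U → f'.1 e = f.1 e := by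
  rw [mem_fib]
  constructor
  · intro h e he
    exact h e (by simp [exposedAt, he])
  · intro h e he
    simp only [exposedAt, Finset.mem_filter, Finset.mem_univ, true_and] at he
    rcases he with he | he
    · exact h e he
    · have h1 := h _ he
      rw [(f.2 e).1] at h1
      have h2 := (Inv.apply_eq_iff f').1 h1
      exact h2

theorem mem_cls {j : ℕ} : ω' ∈ cls t ω j ↔
    (∀ e : HalfEdge n d, e.1 ∈ past t ω j → ω'.1.1 e = ω.1.1 e) ∧
      ∀ u ∈ past t ω j, ω'.2 u = ω.2 u := by
  rw [cls, Finset.mem_product, mem_fib_exposedAt, mem_selFib]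

theorem self_mem_cls (j : ℕ) : ω ∈ cls t ω j := mem_cls.2 ⟨fun _ _ => rfl, fun _ _ => rfl⟩

theorem past_eq_of_mem_cls {j : ℕ} (h : ω' ∈ cls t ω j) : past t ω' j = past t ω j :=
  (past_lv_congr (mem_cls.1 h).1 (mem_cls.1 h).2).1

theorem lv_eq_of_mem_cls {j : ℕ} (h : ω' ∈ cls t ω j) : lv t ω' j = lv t ω j :=
  (past_lv_congr (mem_cls.1 h).1 (mem_cls.1 h).2).2

theorem past_succ_eq_of_mem_cls {j : ℕ} (h : ω' ∈ cls t ω j) :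
    past t ω' (j + 1) = past t ω (j + 1) := by
  rw [past_succ, past_succ, past_eq_of_mem_cls h, lv_eq_of_mem_cls h]

theorem cls_eq_of_mem {j : ℕ} (h : ω' ∈ cls t ω j) : cls t ω' j = cls t ω j := by
  ext ω''
  rw [mem_cls, mem_cls, past_eq_of_mem_cls h]
  obtain ⟨h1, h2⟩ := mem_cls.1 h
  constructor
  · rintro ⟨h3, h4⟩
    exact ⟨fun e he => (h3 e he).trans (h1 e he), fun u hu => (h4 u hu).trans (h2 u hu)⟩
  · rintro ⟨h3, h4⟩
    exact ⟨fun e he => (h3 e he).trans (h1 e he).symm, fun u hu => (h4 u hu).trans (h2 u hu).symm⟩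

variable (t) in
theorem sum_le_of_avg_cls (j : ℕ) {g b : Pairing n d × Selection n p → ℝ}
    (h : ∀ ω, avg (cls t ω j) g ≤ b ω) : ∑ ω, g ω ≤ ∑ ω, b ω := by
  rw [← sum_avg_class (fun ω => cls t ω j) (fun ω => self_mem_cls j)
    (fun ω ω' h => cls_eq_of_mem h) g]
  exact Finset.sum_le_sum fun ω _ => h ω

variable (d p) in
/-- The number of next-level nodes selected by a node of level `j`. -/
def quota : ℕ → ℕ
  | 0 => d
  | _ + 1 => p

variable (t ω) in
/-- A lower bound for the probability that a node of level `j` selects a given neighbour. -/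
noncomputable def selProb (j : ℕ) (u : Fin n) : ℝ :=
  if quota d p j ≤ freeDeg (exposedAt ω.1 (past t ω j)) u then
    (quota d p j : ℝ) / freeDeg (exposedAt ω.1 (past t ω j)) u else 1

theorem selProb_nonneg (j : ℕ) (u : Fin n) : 0 ≤ selProb t ω j u := by
  unfold selProb
  split_ifs <;> positivity

theorem selProb_le_one (j : ℕ) (u : Fin n) : selProb t ω j u ≤ 1 := by
  unfold selProb
  split_ifs with h
  · exact div_le_one_of_le₀ (by exact_mod_cast h) (Nat.cast_nonneg _)
  · exact le_rfl

theorem freeDeg_mul_selProb (hd : 0 < d) (hp : 0 < p) (j : ℕ) (u : Fin n) :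
    freeDeg (exposedAt ω.1 (past t ω j)) u * selProb t ω j u =
      (min (quota d p j) (freeDeg (exposedAt ω.1 (past t ω j)) u) : ℕ) := by
  have hq : 0 < quota d p j := by cases j <;> simpa [quota]
  unfold selProb
  split_ifs with h
  · rw [min_eq_left h]
    have : (freeDeg (exposedAt ω.1 (past t ω j)) u : ℝ) ≠ 0 := by
      exact_mod_cast (hq.trans_le h).ne'
    field_simp
  · rw [min_eq_right (not_le.1 h).le, mul_one]

theorem card_nbrs_sdiff_le {f : Pairing n d} {j : ℕ} (hf : f ∈ fib (exposedAt ω.1 (past t ω j)) ω.1)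
    {u : Fin n} (hu : u ∉ past t ω j) {U : Finset (Fin n)} (hU : past t ω j ⊆ U) :
    (nbrs (graph f) u \ U).card ≤ freeDeg (exposedAt ω.1 (past t ω j)) u := by
  refine le_trans (Finset.card_le_card (t := ((exposedAt ω.1 (past t ω j))ᶜ.filter
    fun x => x.1 = u).image fun x => (f.1 x).1) ?_) Finset.card_image_le
  intro w hw
  rw [Finset.mem_sdiff, mem_nbrs] at hw
  obtain ⟨⟨_, a, b, hab⟩, hwU⟩ := hw
  rw [Finset.mem_image]
  refine ⟨(u, a), ?_, by rw [hab]⟩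
  simp only [exposedAt, Finset.mem_filter, Finset.mem_compl, Finset.mem_univ, true_and, and_true,
    not_or]
  refine ⟨hu, fun h => hwU (hU ?_)⟩
  have := mem_fib.1 hf (u, a) (by simp [exposedAt, h])
  rwa [← this, hab] at h

open Classical in
theorem avg_selFib_disjoint_lv_le (hd : 0 < d) (hp : 0 < p) {j : ℕ} {f : Pairing n d}
    (hf : f ∈ fib (exposedAt ω.1 (past t ω j)) ω.1) {N : Finset (Fin n)}
    (hN : Disjoint N (past t ω (j + 1))) :
    avg (selFib (past t ω j) ω.2) (fun c => if Disjoint N (lv t (f, c) (j + 1)) then 1 else 0) ≤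
      adjProd (selProb t ω j) (lv t ω j) N f := by
  have hadj : ∀ u ∈ lv t ω j, ∀ w ∈ N,
      (graph f).Adj u w ↔ ∃ b, (f.1 (w, b)).1 = u := by
    intro u hu w hw
    have huw : u ≠ w := by
      rintro rfl
      exact Finset.disjoint_left.1 hN hw (lv_subset_past (Nat.lt_succ_self j) hu)
    constructor
    · rintro ⟨_, a, b, hab⟩
      exact ⟨b, by rw [(Inv.apply_eq_iff f).1 hab]⟩
    · rintro ⟨b, hb⟩
      exact ⟨huw, (f.1 (w, b)).2, b, by rw [← hb]; exact (f.2 _).1⟩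
  match j with
  | 0 =>
    have h1 : ∀ c : Selection n p, lv t (f, c) 1 = nbrs (graph f) t := fun _ => rfl
    simp only [zero_add, h1]
    rw [avg_const (selFib_nonempty _ _)]
    split_ifs with h
    · unfold adjProd
      rw [Finset.prod_eq_one]
      rintro ⟨u, w⟩ hz
      rw [Finset.mem_product] at hz
      rw [if_neg]
      intro hb
      have h2 := (hadj u hz.1 w hz.2).2 hb
      have h3 : u = t := by simpa [lv] using hz.1
      exact Finset.disjoint_left.1 h hz.2 (mem_nbrs.2 (h3 ▸ h2))
    · exact adjProd_nonneg (fun u _ => selProb_le_one 0 u) N f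
  | i + 1 =>
    have hmem : ∀ c ∈ selFib (past t ω (i + 1)) ω.2, (f, c) ∈ cls t ω (i + 1) := fun c hc =>
      Finset.mem_product.2 ⟨hf, hc⟩
    set A : Fin n → Finset (Fin n) := fun u => nbrs (graph f) u \ past t ω (i + 2) with hA
    have h1 : ∀ c ∈ selFib (past t ω (i + 1)) ω.2,
        (if Disjoint N (lv t (f, c) (i + 1 + 1)) then (1 : ℝ) else 0) =
        if ∀ u ∈ lv t ω (i + 1), Disjoint (c u (A u)).1 N then 1 else 0 := by
      intro c hc
      have h2 : lv t (f, c) (i + 1 + 1) =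
          (lv t ω (i + 1)).biUnion fun u => (c u (A u)).1 := by
        rw [lv_succ_succ, lv_eq_of_mem_cls (hmem c hc), past_succ_eq_of_mem_cls (hmem c hc)]
      refine if_congr ?_ rfl rfl
      rw [h2, Finset.disjoint_biUnion_right]
      exact forall₂_congr fun u _ => disjoint_comm
    rw [avg_congr h1]
    have hnp : ∀ u ∈ lv t ω (i + 1), u ∉ past t ω (i + 1) := fun u hu =>
      Finset.disjoint_right.1 (disjoint_past_lv t ω (i + 1)) hu
    refine (avg_selFib_disjoint_le (disjoint_past_lv t ω (i + 1)) ω.2 A N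
      (x := selProb t ω (i + 1)) (fun u _ => selProb_nonneg _ u) (fun u _ => selProb_le_one _ u)
      ?_).trans (le_of_eq ?_)
    · intro u hu
      have h3 : (A u).card ≤ freeDeg (exposedAt ω.1 (past t ω (i + 1))) u :=
        card_nbrs_sdiff_le hf (hnp u hu) (past_mono (Nat.le_succ _))
      rw [Nat.cast_min]
      apply le_min
      · have h4 := freeDeg_mul_selProb (t := t) (ω := ω) hd hp (i + 1) u
        have h5 : ((min (quota d p (i + 1)) (freeDeg (exposedAt ω.1 (past t ω (i + 1))) u) : ℕ) : ℝ)
            ≤ p := by exact_mod_cast min_le_left _ _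
        have h6 := selProb_nonneg (t := t) (ω := ω) (i + 1) u
        have h7 : ((A u).card : ℝ) ≤ freeDeg (exposedAt ω.1 (past t ω (i + 1))) u := by
          exact_mod_cast h3
        nlinarith
      · have h6 := selProb_le_one (t := t) (ω := ω) (i + 1) u
        have : (0 : ℝ) ≤ (A u).card := Nat.cast_nonneg _
        nlinarith
    · unfold adjProd
      rw [Finset.prod_product]
      apply Finset.prod_congr rfl
      intro u hu
      refine Eq.trans (b := ∏ w ∈ N, if w ∈ A u then 1 - selProb t ω (i + 1) u else 1) ?_
        (Finset.prod_congr rfl fun w hw => ?_)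
      · rw [Finset.prod_ite_mem, Finset.prod_const, Finset.inter_comm]
      · have hiff : w ∈ A u ↔ ∃ b, (f.1 (w, b)).1 = u := by
          rw [← hadj u hu w hw]
          simp only [hA, Finset.mem_sdiff, mem_nbrs]
          exact ⟨fun h => h.1, fun h => ⟨h, Finset.disjoint_left.1 hN hw⟩⟩
        by_cases h : ∃ b, (f.1 (w, b)).1 = u
        · rw [if_pos (hiff.2 h), if_pos h]
        · rw [if_neg (mt hiff.1 h), if_neg h]

end Exploration

section Sizes

variable (d p : ℕ)

/-- The size of level `j` if there are no collisions. -/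
def fullSize : ℕ → ℕ
  | 0 => 1
  | j + 1 => quota d p j * fullSize j

/-- The total size of the levels before level `j` if there are no collisions. -/
def fullPast (j : ℕ) : ℕ := ∑ i ∈ Finset.range j, fullSize d p i

theorem fullSize_succ (j : ℕ) : fullSize d p (j + 1) = p ^ j * d := by
  induction j with
  | zero => simp [fullSize, quota]
  | succ j ih => rw [fullSize, ih, quota, pow_succ]; ring

theorem fullPast_succ (j : ℕ) : fullPast d p (j + 1) = fullPast d p j + fullSize d p j :=
  Finset.sum_range_succ _ _

variable {d p}

theorem fullPast_le (hd : 2 ≤ d) (hp : 2 ≤ p) (j : ℕ) : fullPast d p j ≤ fullSize d p j := by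
  induction j with
  | zero => simp [fullPast, fullSize]
  | succ j ih =>
    rw [fullPast_succ, fullSize]
    have : 2 ≤ quota d p j := by cases j <;> simpa [quota]
    nlinarith

theorem fullPast_succ_le (hd : 2 ≤ d) (hp : 2 ≤ p) (j : ℕ) :
    fullPast d p (j + 1) ≤ 2 * fullSize d p j := by
  have := fullPast_le hd hp j
  rw [fullPast_succ]; omega

theorem fullPast_mono {i j : ℕ} (h : i ≤ j) : fullPast d p i ≤ fullPast d p j :=
  Finset.sum_le_sum_of_subset (Finset.range_subset_range.2 h)

theorem fullSize_mono (hd : 1 ≤ d) (hp : 1 ≤ p) {i j : ℕ} (h : i ≤ j) :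
    fullSize d p i ≤ fullSize d p j := by
  induction j, h using Nat.le_induction with
  | base => exact le_rfl
  | succ j _ ih =>
    rw [fullSize]
    have : 1 ≤ quota d p j := by cases j <;> simpa [quota]
    nlinarith

theorem one_le_fullSize (hd : 1 ≤ d) (hp : 1 ≤ p) (j : ℕ) : 1 ≤ fullSize d p j :=
  fullSize_mono hd hp (Nat.zero_le j)

end Sizes

section Exploration

variable {n d p : ℕ} {t : Fin n} {ω ω' : Pairing n d × Selection n p}

theorem card_nbrs_le (f : Pairing n d) (u : Fin n) : (nbrs (graph f) u).card ≤ d := by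
  calc _ ≤ ((Finset.univ : Finset (Fin d)).image fun a => (f.1 (u, a)).1).card := by
        apply Finset.card_le_card
        intro v hv
        obtain ⟨_, a, b, hab⟩ := mem_nbrs.1 hv
        exact Finset.mem_image.2 ⟨a, Finset.mem_univ _, by rw [hab]⟩
    _ ≤ _ := Finset.card_image_le.trans (by simp)

theorem card_lv_succ_le (j : ℕ) : (lv t ω (j + 1)).card ≤ quota d p j * (lv t ω j).card := by
  match j with
  | 0 =>
    have h : (lv t ω 0).card = 1 := rfl
    rw [h, mul_one]
    exact card_nbrs_le ω.1 t
  | i + 1 =>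
    rw [lv_succ_succ, mul_comm]
    apply Finset.card_biUnion_le_card_mul
    intro u _
    rw [card_choice]
    exact min_le_left _ _

theorem card_lv_le (j : ℕ) : (lv t ω j).card ≤ fullSize d p j := by
  induction j with
  | zero => simp [lv, fullSize]
  | succ j ih => exact (card_lv_succ_le j).trans (Nat.mul_le_mul_left _ ih)

theorem card_past_le (j : ℕ) : (past t ω j).card ≤ fullPast d p j := by
  induction j with
  | zero => simp [past]
  | succ j ih =>
    rw [past_succ, fullPast_succ]
    exact (Finset.card_union_le _ _).trans (add_le_add ih (card_lv_le j))

theorem card_filter_fst_mem (V : Finset (Fin n)) :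
    (Finset.univ.filter fun e : HalfEdge n d => e.1 ∈ V).card = V.card * d := by
  have : (Finset.univ.filter fun e : HalfEdge n d => e.1 ∈ V) = V ×ˢ Finset.univ := by
    ext e; simp
  rw [this, Finset.card_product]; simp

theorem card_exposedAt_le (f : Pairing n d) (U : Finset (Fin n)) :
    (exposedAt f U).card ≤ 2 * (U.card * d) := by
  have h1 : exposedAt f U ⊆ (Finset.univ.filter fun e : HalfEdge n d => e.1 ∈ U) ∪
      (Finset.univ.filter fun e : HalfEdge n d => e.1 ∈ U).image f.1 := by
    intro e he
    simp only [exposedAt, Finset.mem_filter, Finset.mem_univ, true_and] at he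
    rw [Finset.mem_union]
    rcases he with he | he
    · left; simpa
    · right
      exact Finset.mem_image.2 ⟨f.1 e, by simpa using he, (f.2 e).1⟩
  have h2 := (Finset.card_le_card h1).trans (Finset.card_union_le _ _)
  have h3 := Finset.card_image_le (s := Finset.univ.filter fun e : HalfEdge n d => e.1 ∈ U)
    (f := f.1)
  rw [card_filter_fst_mem] at h2 h3
  omega

theorem le_card_compl_exposedAt (j : ℕ) :
    (n : ℝ) * d - 2 * d * fullPast d p j ≤ ((exposedAt ω.1 (past t ω j))ᶜ.card : ℝ) := by
  have h1 : ((exposedAt ω.1 (past t ω j)).card : ℝ) + ((exposedAt ω.1 (past t ω j))ᶜ.card : ℝ) =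
      (n : ℝ) * d := by
    have := Finset.card_add_card_compl (exposedAt ω.1 (past t ω j))
    rw [Fintype.card_prod, Fintype.card_fin, Fintype.card_fin] at this
    exact_mod_cast this
  have h2 : ((exposedAt ω.1 (past t ω j)).card : ℝ) ≤ 2 * (fullPast d p j * d) := by
    have := (card_exposedAt_le ω.1 (past t ω j)).trans
      (Nat.mul_le_mul_left 2 (Nat.mul_le_mul_right d (card_past_le j)))
    exact_mod_cast this
  linarith

theorem card_compl_exposedAt_le (j : ℕ) :
    ((exposedAt ω.1 (past t ω j))ᶜ.card : ℝ) ≤ (n : ℝ) * d := by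
  have := Finset.card_le_univ (exposedAt ω.1 (past t ω j))ᶜ
  rw [Fintype.card_prod, Fintype.card_fin, Fintype.card_fin] at this
  exact_mod_cast this

variable (t ω) in
/-- The number of half-edges at `V` matched to nodes before level `j`. -/
noncomputable def backDeg (V : Finset (Fin n)) (j : ℕ) : ℕ :=
  (Finset.univ.filter fun e : HalfEdge n d => e.1 ∈ V ∧ (ω.1.1 e).1 ∈ past t ω j).card

theorem card_free_add_backDeg {V : Finset (Fin n)} {j : ℕ} (hV : Disjoint V (past t ω j)) :
    ((exposedAt ω.1 (past t ω j))ᶜ.filter fun e => e.1 ∈ V).card + backDeg t ω V j =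
      V.card * d := by
  rw [backDeg, ← Finset.card_union_of_disjoint, ← card_filter_fst_mem (d := d) V]
  · congr 1
    ext e
    simp only [exposedAt, Finset.mem_union, Finset.mem_filter, Finset.mem_compl, Finset.mem_univ,
      true_and, not_or]
    constructor
    · rintro (h | h)
      · exact h.2
      · exact h.1
    · intro h
      have := Finset.disjoint_left.1 hV h
      by_cases h' : (ω.1.1 e).1 ∈ past t ω j
      · exact Or.inr ⟨h, h'⟩
      · exact Or.inl ⟨⟨this, h'⟩, h⟩
  · rw [Finset.disjoint_left]
    intro e he he'
    simp only [exposedAt, Finset.mem_filter, Finset.mem_compl, Finset.mem_univ,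
      true_and, not_or] at he he'
    exact he.1.2 he'.2

theorem backDeg_succ_le {V : Finset (Fin n)} {j : ℕ} (h : ω' ∈ cls t ω j)
    (hV : Disjoint V (past t ω (j + 1))) :
    backDeg t ω' V (j + 1) ≤ backDeg t ω V j +
      (((exposedAt ω.1 (past t ω j))ᶜ.filter fun e => e.1 ∈ lv t ω j).filter fun y =>
        ω'.1.1 y ∈ Finset.univ.filter fun e : HalfEdge n d => e.1 ∈ V).card := by
  have hf : ω'.1 ∈ fib (exposedAt ω.1 (past t ω j)) ω.1 := (Finset.mem_product.1 h).1
  have hD' := (closed_exposedAt ω.1 (past t ω j)).of_mem_fib hf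
  unfold backDeg
  rw [past_succ_eq_of_mem_cls h]
  set Y := (((exposedAt ω.1 (past t ω j))ᶜ.filter fun e => e.1 ∈ lv t ω j).filter fun y =>
        ω'.1.1 y ∈ Finset.univ.filter fun e : HalfEdge n d => e.1 ∈ V) with hY
  calc _ ≤ ((Finset.univ.filter fun e : HalfEdge n d => e.1 ∈ V ∧ (ω.1.1 e).1 ∈ past t ω j) ∪
        Y.image ω'.1.1).card := by
        apply Finset.card_le_card
        intro e he
        simp only [Finset.mem_filter, Finset.mem_univ, true_and] at he
        obtain ⟨heV, he⟩ := he
        have heP := Finset.disjoint_left.1 hV heV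
        have heP' : e.1 ∉ past t ω j := fun h' => heP (past_mono (Nat.le_succ j) h')
        by_cases heD : e ∈ exposedAt ω.1 (past t ω j)
        · rw [Finset.mem_union]
          left
          simp only [exposedAt, Finset.mem_filter, Finset.mem_univ, true_and] at heD ⊢
          exact ⟨heV, heD.resolve_left heP'⟩
        · rw [Finset.mem_union]
          right
          refine Finset.mem_image.2 ⟨ω'.1.1 e, ?_, (ω'.1.2 e).1⟩
          have h1 : ω'.1.1 e ∉ exposedAt ω.1 (past t ω j) := fun h' =>
            heD (hD'.apply_mem_iff.1 h')
          simp only [hY, Finset.mem_filter, Finset.mem_compl, Finset.mem_univ, true_and]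
          refine ⟨⟨h1, ?_⟩, by rw [(ω'.1.2 e).1]; exact heV⟩
          rw [past_succ, Finset.mem_union] at he
          refine he.resolve_left fun h' => h1 ?_
          simp [exposedAt, h']
    _ ≤ _ := (Finset.card_union_le _ _).trans (Nat.add_le_add_left Finset.card_image_le _)

theorem avg_cls_fst (j : ℕ) (g : Pairing n d → ℝ) :
    avg (cls t ω j) (fun ω' => g ω'.1) = avg (fib (exposedAt ω.1 (past t ω j)) ω.1) g := by
  rw [cls, avg_product]
  exact avg_congr fun f _ => avg_const (selFib_nonempty _ _) (g f)

/-- An exponential moment of the number of half-edges at `V` matched to the levels before `j`. -/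
theorem sum_pow_backDeg_le {θ : ℝ} (hθ : 1 ≤ θ) (hd : 0 < d) (V : Finset (Fin n)) (j : ℕ)
    (hj : 4 * fullPast d p j ≤ n) :
    ∑ ω : Pairing n d × Selection n p,
      (if Disjoint V (past t ω j) then θ ^ backDeg t ω V j else 0) ≤
    Real.exp ((θ - 1) * (2 * V.card * d / n) * fullPast d p j) *
      (Fintype.card (Pairing n d × Selection n p) : ℝ) := by
  have hn : 0 < n := t.pos
  induction j with
  | zero =>
    have h1 : ∀ ω : Pairing n d × Selection n p,
        (if Disjoint V (past t ω 0) then θ ^ backDeg t ω V 0 else 0) = 1 := by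
      intro ω
      rw [if_pos (by simp [past])]
      simp [backDeg, past]
    simp_rw [h1]
    simp [fullPast]
  | succ j ih =>
    have hj' : 4 * fullPast d p j ≤ n := le_trans
      (Nat.mul_le_mul_left 4 (fullPast_mono (Nat.le_succ j))) hj
    set B := Real.exp ((θ - 1) * (2 * V.card * d / n) * fullSize d p j) with hB
    have hexp : Real.exp ((θ - 1) * (2 * V.card * d / n) * fullPast d p (j + 1)) =
        B * Real.exp ((θ - 1) * (2 * V.card * d / n) * fullPast d p j) := by
      rw [hB, ← Real.exp_add, fullPast_succ]
      push_cast
      ring_nf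
    rw [hexp, mul_assoc]
    refine le_trans ?_ (mul_le_mul_of_nonneg_left (ih hj') (Real.exp_pos _).le)
    rw [Finset.mul_sum]
    refine sum_le_of_avg_cls t j fun ω => ?_
    by_cases hV : Disjoint V (past t ω (j + 1))
    swap
    · have h1 : ∀ ω' ∈ cls t ω j,
          (if Disjoint V (past t ω' (j + 1)) then θ ^ backDeg t ω' V (j + 1) else 0) = 0 := by
        intro ω' hω'
        rw [past_succ_eq_of_mem_cls hω', if_neg hV]
      rw [avg_congr h1, avg_const ⟨ω, self_mem_cls j⟩]
      have : 0 ≤ θ ^ backDeg t ω V j := pow_nonneg (by linarith) _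
      split_ifs <;> positivity
    · have hVj : Disjoint V (past t ω j) := hV.mono_right (past_mono (Nat.le_succ j))
      rw [if_pos hVj]
      set D := exposedAt ω.1 (past t ω j) with hD
      set Y := Dᶜ.filter fun e => e.1 ∈ lv t ω j with hY
      set V' := Finset.univ.filter fun e : HalfEdge n d => e.1 ∈ V with hV'
      have h1 : ∀ ω' ∈ cls t ω j,
          (if Disjoint V (past t ω' (j + 1)) then θ ^ backDeg t ω' V (j + 1) else 0) ≤
          θ ^ backDeg t ω V j * θ ^ (Y.filter fun y => ω'.1.1 y ∈ V').card := by
        intro ω' hω'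
        rw [past_succ_eq_of_mem_cls hω', if_pos hV, ← pow_add]
        exact pow_le_pow_right₀ hθ (backDeg_succ_le hω' hV)
      refine (avg_mono h1).trans ?_
      rw [avg_const_mul, mul_comm B]
      apply mul_le_mul_of_nonneg_left _ (pow_nonneg (by linarith) _)
      rw [avg_cls_fst j fun f => θ ^ (Y.filter fun y => f.1 y ∈ V').card]
      have hn' : (0 : ℝ) < n := by exact_mod_cast hn
      have hd' : (0 : ℝ) < d := by exact_mod_cast hd
      have hYcard : (Y.card : ℝ) ≤ fullSize d p j * d := by
        have h2 : Y ⊆ Finset.univ.filter fun e : HalfEdge n d => e.1 ∈ lv t ω j :=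
          Finset.filter_subset_filter _ (Finset.subset_univ _)
        have h3 := Finset.card_le_card h2
        rw [card_filter_fst_mem] at h3
        exact_mod_cast h3.trans (Nat.mul_le_mul_right d (card_lv_le j))
      have hm : (n : ℝ) * d / 2 + 2 * Y.card ≤ Dᶜ.card := by
        have h2 := le_card_compl_exposedAt (t := t) (ω := ω) j
        have h3 : 4 * ((fullPast d p j : ℝ) + fullSize d p j) ≤ n := by
          rw [fullPast_succ] at hj
          exact_mod_cast hj
        have h4 := mul_le_mul_of_nonneg_right h3 hd'.le
        rw [← hD] at h2
        linarith
      refine (avg_pow_hits_le hθ (m₀ := (n : ℝ) * d / 2) (by positivity) V' Y.card Y D ω.1 rfl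
        (closed_exposedAt _ _) ?_ ?_ hm).trans ?_
      · rw [hY, Finset.disjoint_left]
        intro e he
        simpa using (Finset.mem_filter.1 he).1
      · rw [Finset.disjoint_left]
        intro e he he'
        simp only [hY, hV', Finset.mem_filter, Finset.mem_univ, true_and] at he he'
        exact Finset.disjoint_left.1 hV he' (lv_subset_past (Nat.lt_succ_self j) he.2)
      · have h2 : (V'.card : ℝ) = V.card * d := by
          rw [hV', card_filter_fst_mem]; push_cast; ring
        rw [h2]
        have h3 : 0 ≤ (θ - 1) * (V.card * d) / (n * d / 2 : ℝ) := by
          have := sub_nonneg.2 hθ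
          positivity
        calc (1 + (θ - 1) * (V.card * d) / (n * d / 2 : ℝ)) ^ Y.card
            ≤ Real.exp ((θ - 1) * (V.card * d) / (n * d / 2 : ℝ)) ^ Y.card := by
              apply pow_le_pow_left₀ (by linarith)
              linarith [Real.add_one_le_exp ((θ - 1) * (V.card * d) / (n * d / 2 : ℝ))]
          _ = Real.exp (Y.card * ((θ - 1) * (V.card * d) / (n * d / 2 : ℝ))) := by
              rw [Real.exp_nat_mul]
          _ ≤ B := by
              rw [hB]
              apply Real.exp_le_exp.2
              calc Y.card * ((θ - 1) * (V.card * d) / (n * d / 2 : ℝ))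
                  ≤ (fullSize d p j * d) * ((θ - 1) * (V.card * d) / (n * d / 2 : ℝ)) :=
                    mul_le_mul_of_nonneg_right hYcard h3
                _ = _ := by field_simp

end Exploration

section Levels

variable {n d p : ℕ} {t : Fin n} {ω ω' : Pairing n d × Selection n p}

variable (t ω) in
/-- The sum over all nodes of level `j` of the selection quota, or of the number of free
half-edges if there are fewer. -/
noncomputable def lvWeight (j : ℕ) : ℝ :=
  weight (selProb t ω j) (lv t ω j) (exposedAt ω.1 (past t ω j))

theorem lvWeight_eq (hd : 0 < d) (hp : 0 < p) (j : ℕ) : lvWeight t ω j =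
    ∑ u ∈ lv t ω j, ((min (quota d p j) (freeDeg (exposedAt ω.1 (past t ω j)) u) : ℕ) : ℝ) := by
  unfold lvWeight weight
  rw [← Finset.sum_fiberwise_of_maps_to (t := lv t ω j) (g := Prod.fst)
    (fun x hx => (Finset.mem_filter.1 hx).2)]
  apply Finset.sum_congr rfl
  intro u hu
  rw [← freeDeg_mul_selProb hd hp j u, Finset.sum_congr rfl (g := fun _ => selProb t ω j u)
    (fun x hx => by rw [(Finset.mem_filter.1 hx).2]), Finset.sum_const, nsmul_eq_mul]
  congr 3
  ext x
  simp only [Finset.mem_filter]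
  exact ⟨fun h => ⟨h.1.1, h.2⟩, fun h => ⟨⟨h.1, h.2 ▸ hu⟩, h.2⟩⟩

theorem lvWeight_nonneg (j : ℕ) : 0 ≤ lvWeight t ω j :=
  weight_nonneg (fun u _ => selProb_nonneg j u) _

theorem lvWeight_le (hd : 0 < d) (hp : 0 < p) (j : ℕ) :
    lvWeight t ω j ≤ quota d p j * (lv t ω j).card := by
  rw [lvWeight_eq hd hp, mul_comm, ← nsmul_eq_mul]
  apply Finset.sum_le_card_nsmul
  intro u _
  exact_mod_cast min_le_left _ _

theorem lvWeight_le_fullSize (hd : 0 < d) (hp : 0 < p) (j : ℕ) :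
    lvWeight t ω j ≤ fullSize d p (j + 1) := by
  refine (lvWeight_le hd hp j).trans ?_
  rw [fullSize]
  exact_mod_cast Nat.mul_le_mul_left _ (card_lv_le j)

theorem lvWeight_congr {j : ℕ} (h : ω' ∈ cls t ω j) : lvWeight t ω' j = lvWeight t ω j := by
  have h1 : exposedAt ω'.1 (past t ω' j) = exposedAt ω.1 (past t ω j) := by
    rw [past_eq_of_mem_cls h]
    have hf : ω'.1 ∈ fib (exposedAt ω.1 (past t ω j)) ω.1 := (Finset.mem_product.1 h).1
    have hD' := (closed_exposedAt ω.1 (past t ω j)).of_mem_fib hf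
    ext e
    have key : ∀ f f' : Pairing n d,
        (∀ e : HalfEdge n d, e.1 ∈ past t ω j → f'.1 e = f.1 e) →
        e ∈ exposedAt f (past t ω j) → e ∈ exposedAt f' (past t ω j) := by
      intro f f' hff he
      have h2 := mem_fib_exposedAt.2 hff
      simp only [exposedAt, Finset.mem_filter, Finset.mem_univ, true_and]
      rw [mem_fib.1 h2 e he]
      simpa [exposedAt] using he
    exact ⟨key _ _ fun e he => ((mem_cls.1 h).1 e he).symm, key _ _ (mem_cls.1 h).1⟩
  unfold lvWeight
  rw [h1, lv_eq_of_mem_cls h]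
  unfold weight selProb
  rw [h1]

theorem quota_le (hpd : p ≤ d) (j : ℕ) : quota d p j ≤ d := by cases j <;> simp [quota, hpd]

theorem freeDeg_le (D : Finset (HalfEdge n d)) (u : Fin n) : freeDeg D u ≤ d := by
  have := card_filter_fst_eq_le Dᶜ u
  rw [Fintype.card_fin] at this
  exact this

theorem consts_lv (hd : 0 < d) (hpd : p ≤ d) (j : ℕ) {K m₀ γ : ℝ} (hK : 0 ≤ K)
    (hm₀ : 0 < m₀) (hm₁ : m₀ ≤ n * d) (hγ : (K + 2 * (d : ℝ) ^ 2) / m₀ ≤ γ) (hγ1 : 3 * γ ≤ 1)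
    (hfull : fullSize d p (j + 1) ≤ n) :
    Consts (Fin n) (Fin d) (selProb t ω j) (lv t ω j) (quota d p j) (fullSize d p (j + 1)) K m₀
      (n * d) γ ((1 - 3 * γ) / (n * d)) := by
  have hγ0 : 0 ≤ γ := le_trans (by positivity) hγ
  have hnd : (0 : ℝ) < n * d := hm₀.trans_le hm₁
  refine ⟨fun u _ => selProb_nonneg j u, fun u _ => selProb_le_one j u, Nat.cast_nonneg _, ?_, hm₀,
    div_nonneg (by linarith) hnd.le, by linarith, ?_, ?_, ?_⟩
  · intro u _
    rw [Fintype.card_fin]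
    unfold selProb
    split_ifs with h
    · rcases Nat.eq_zero_or_pos (freeDeg (exposedAt ω.1 (past t ω j)) u) with h0 | h0
      · have : quota d p j = 0 := by omega
        simp [this, h0]
      · rw [mul_div_assoc', le_div_iff₀ (by exact_mod_cast h0), mul_comm]
        have : (freeDeg (exposedAt ω.1 (past t ω j)) u : ℝ) ≤ d := by
          exact_mod_cast freeDeg_le _ _
        exact mul_le_mul_of_nonneg_right this (Nat.cast_nonneg _)
    · rw [mul_one]
      exact_mod_cast quota_le hpd j
  · rw [Fintype.card_fin]
    refine le_trans ?_ hγ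
    rw [add_div]
    apply add_le_add_left
    rw [div_mul_eq_mul_div]
    apply div_le_div₀ hK _ hm₀ hm₁
    nlinarith
  · rw [div_mul_cancel₀ _ hnd.ne']
  · rw [div_mul_eq_mul_div, div_le_one hnd]
    have h1 : (fullSize d p (j + 1) : ℝ) ≤ n := by exact_mod_cast hfull
    have h2 : (1 : ℝ) ≤ d := by exact_mod_cast hd
    nlinarith [Nat.cast_nonneg (α := ℝ) (fullSize d p (j + 1))]

theorem freeDeg_mul_selProb_le (hd : 0 < d) (hp : 0 < p) (j : ℕ) (u : Fin n) :
    freeDeg (exposedAt ω.1 (past t ω j)) u * selProb t ω j u ≤ quota d p j := by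
  rw [freeDeg_mul_selProb hd hp]
  exact_mod_cast min_le_left _ _

theorem exp_neg_le_one_sub_add_sq {y : ℝ} (h0 : 0 ≤ y) (h1 : y ≤ 1) :
    Real.exp (-y) ≤ 1 - y + y ^ 2 := by
  have := Real.abs_exp_sub_one_sub_id_le (x := -y) (by rwa [abs_neg, abs_of_nonneg h0])
  have h2 := le_abs_self (Real.exp (-y) - 1 - -y)
  nlinarith

open Classical in
theorem avg_not_mem_lv_le (hd : 0 < d) (hp : 0 < p) (hpd : p ≤ d) (j : ℕ)
    (hfull : fullSize d p (j + 1) ≤ n) (hpast : 4 * fullPast d p j + 4 ≤ n) (hdn : 18 * d ≤ n)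
    {w : Fin n} (hw : w ∉ past t ω (j + 1)) :
    avg (cls t ω j) (fun ω' => if Disjoint {w} (lv t ω' (j + 1)) then 1 else 0) ≤
      Real.exp (-((1 - 3 * (6 * d / n)) / (n * d) * lvWeight t ω j *
        freeDeg (exposedAt ω.1 (past t ω j)) w)) := by
  have hn : 0 < n := t.pos
  have hn' : (0 : ℝ) < n := by exact_mod_cast hn
  have hd' : (0 : ℝ) < d := by exact_mod_cast hd
  have hN : Disjoint {w} (past t ω (j + 1)) := by simpa using hw
  rw [cls, avg_product]
  refine (avg_mono fun f hf => avg_selFib_disjoint_lv_le hd hp hf hN).trans ?_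
  have hdn' : (18 : ℝ) * d ≤ n := by exact_mod_cast hdn
  have hc : Consts (Fin n) (Fin d) (selProb t ω j) (lv t ω j) (quota d p j)
      (fullSize d p (j + 1)) d (n * d / 2) (n * d) (6 * d / n)
      ((1 - 3 * (6 * d / n)) / (n * d)) := by
    refine consts_lv hd hpd j hd'.le (by positivity) (by linarith [mul_pos hn' hd']) ?_ ?_ hfull
    · rw [div_le_div_iff₀ (by positivity) hn']
      have : (1 : ℝ) ≤ d := by exact_mod_cast hd
      nlinarith [mul_nonneg (mul_nonneg hn'.le hd'.le) (sub_nonneg.2 this)]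
    · rw [mul_div_assoc', div_le_one hn']; linarith
  have hdisj : Disjoint (lv t ω j) {w} := by
    rw [Finset.disjoint_singleton_right]
    exact fun h => hw (lv_subset_past (Nat.lt_succ_self j) h)
  have := avg_adjProd_le hc hdisj (closed_exposedAt ω.1 (past t ω j))
    (W := (exposedAt ω.1 (past t ω j))ᶜ.filter fun x => x.1 = w)
    (fun e he => by simpa using he) (by exact_mod_cast freeDeg_le _ _) ?_
    (card_compl_exposedAt_le j) (fun u _ => freeDeg_mul_selProb_le hd hp j u)
    (lvWeight_le_fullSize hd hp j)
  · exact this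
  · have h1 := le_card_compl_exposedAt (t := t) (ω := ω) j
    have h2 : (4 : ℝ) * fullPast d p j + 4 ≤ n := by exact_mod_cast hpast
    have h3 := mul_le_mul_of_nonneg_right h2 hd'.le
    have h4 : ((freeDeg (exposedAt ω.1 (past t ω j)) w : ℕ) : ℝ) ≤ d := by
      exact_mod_cast freeDeg_le _ _
    unfold freeDeg at h4
    linarith

theorem sum_freeDeg (j : ℕ) :
    ((exposedAt ω.1 (past t ω j))ᶜ.card : ℝ) ≤
      ∑ w ∈ (past t ω (j + 1))ᶜ, (freeDeg (exposedAt ω.1 (past t ω j)) w : ℝ) +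
        d * fullSize d p j := by
  have h1 : (exposedAt ω.1 (past t ω j))ᶜ ⊆
      ((exposedAt ω.1 (past t ω j))ᶜ.filter fun x => x.1 ∈ (past t ω (j + 1))ᶜ) ∪
        Finset.univ.filter fun x : HalfEdge n d => x.1 ∈ lv t ω j := by
    intro x hx
    simp only [Finset.mem_union, Finset.mem_filter, Finset.mem_univ, true_and]
    by_cases h : x.1 ∈ past t ω (j + 1)
    · right
      rw [past_succ, Finset.mem_union] at h
      refine h.resolve_left fun h' => ?_
      simp [exposedAt, h'] at hx
    · left
      exact ⟨hx, by simpa using h⟩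
  have h2 := (Finset.card_le_card h1).trans (Finset.card_union_le _ _)
  rw [card_filter_fst_mem] at h2
  have h3 : ((exposedAt ω.1 (past t ω j))ᶜ.filter fun x => x.1 ∈ (past t ω (j + 1))ᶜ).card =
      ∑ w ∈ (past t ω (j + 1))ᶜ, freeDeg (exposedAt ω.1 (past t ω j)) w := by
    refine (Finset.card_eq_sum_card_fiberwise (t := (past t ω (j + 1))ᶜ) (f := Prod.fst)
      (fun x hx => (Finset.mem_filter.1 hx).2)).trans (Finset.sum_congr rfl ?_)
    intro w hw
    unfold freeDeg
    congr 1
    ext x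
    simp only [Finset.mem_filter]
    exact ⟨fun h => ⟨h.1.1, h.2⟩, fun h => ⟨⟨h.1, h.2 ▸ hw⟩, h.2⟩⟩
  rw [h3] at h2
  have h4 := Nat.mul_le_mul_right d (card_lv_le (t := t) (ω := ω) j)
  have h5 := h2.trans (Nat.add_le_add_left h4 _)
  rw [mul_comm _ d] at h5
  exact_mod_cast h5

theorem le_avg_card_lv (hd : 2 ≤ d) (hp : 2 ≤ p) (hpd : p ≤ d) (j : ℕ)
    (hfull : 22 * fullSize d p (j + 1) ≤ n) (hpast : 4 * fullPast d p j + 4 ≤ n) :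
    lvWeight t ω j * (1 - 22 * fullSize d p (j + 1) / n) ≤
      avg (cls t ω j) (fun ω' => ((lv t ω' (j + 1)).card : ℝ)) := by
  classical
  have hn : 0 < n := t.pos
  have hn' : (0 : ℝ) < n := by exact_mod_cast hn
  have hd' : (0 : ℝ) < d := by exact_mod_cast (by omega : 0 < d)
  have hd0 : 0 < d := by omega
  have hp0 : 0 < p := by omega
  set D := exposedAt ω.1 (past t ω j) with hDdef
  set Λ := lvWeight t ω j with hΛdef
  have hΛ0 : 0 ≤ Λ := lvWeight_nonneg j
  set F : ℝ := (fullSize d p (j + 1) : ℝ) with hF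
  have hΛF : Λ ≤ F := lvWeight_le_fullSize hd0 hp0 j
  have hdF : (d : ℝ) ≤ F := by
    rw [hF, fullSize_succ]
    exact_mod_cast Nat.le_mul_of_pos_left d (pow_pos hp0 j)
  have hFn : 22 * F ≤ n := by rw [hF]; exact_mod_cast hfull
  have hsF : (fullSize d p j : ℝ) ≤ F := by
    rw [hF]; exact_mod_cast fullSize_mono (by omega) (by omega) (Nat.le_succ j)
  have hpF : (fullPast d p j : ℝ) ≤ F :=
    le_trans (by exact_mod_cast fullPast_le hd hp j) hsF
  have hdn : 18 * d ≤ n := by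
    have : (18 : ℝ) * d ≤ n := by linarith
    exact_mod_cast this
  set β := (1 - 3 * (6 * d / n : ℝ)) / (n * d) with hβ
  set b := 1 - 3 * (6 * d / n : ℝ) with hb
  have hb1 : b ≤ 1 := by
    have : 0 ≤ 3 * (6 * d / n : ℝ) := by positivity
    linarith
  have hb0 : 0 ≤ b := by
    have : 3 * (6 * d / n : ℝ) ≤ 1 := by
      rw [mul_div_assoc', div_le_one hn']; linarith
    linarith
  have hβ0 : 0 ≤ β := by positivity
  have hcard : ∀ ω' ∈ cls t ω j, ((lv t ω' (j + 1)).card : ℝ) =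
      ∑ w ∈ (past t ω (j + 1))ᶜ, (1 - if Disjoint {w} (lv t ω' (j + 1)) then (1 : ℝ) else 0) := by
    intro ω' hω'
    have h1 : lv t ω' (j + 1) ⊆ (past t ω (j + 1))ᶜ := by
      rw [← past_succ_eq_of_mem_cls hω']
      intro w hw
      rw [Finset.mem_compl]
      exact Finset.disjoint_right.1 (disjoint_past_lv t ω' (j + 1)) hw
    have h2 : ∀ w, (1 - if Disjoint {w} (lv t ω' (j + 1)) then (1 : ℝ) else 0) =
        if w ∈ lv t ω' (j + 1) then 1 else 0 := by
      intro w
      by_cases h : w ∈ lv t ω' (j + 1) <;> simp [h]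
    simp_rw [h2]
    rw [← Finset.sum_filter, Finset.sum_const, nsmul_eq_mul, mul_one,
      Finset.filter_mem_eq_inter, Finset.inter_eq_right.2 h1]
  rw [avg_congr hcard]
  have hswap : avg (cls t ω j) (fun ω' => ∑ w ∈ (past t ω (j + 1))ᶜ,
      (1 - if Disjoint {w} (lv t ω' (j + 1)) then (1 : ℝ) else 0)) =
      ∑ w ∈ (past t ω (j + 1))ᶜ,
        (1 - avg (cls t ω j) fun ω' => if Disjoint {w} (lv t ω' (j + 1)) then (1 : ℝ) else 0) := by
    unfold avg
    rw [Finset.sum_comm, Finset.sum_div]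
    apply Finset.sum_congr rfl
    intro w _
    have hne : ((cls t ω j).card : ℝ) ≠ 0 := by
      exact_mod_cast (Finset.card_pos.2 ⟨ω, self_mem_cls j⟩).ne'
    rw [Finset.sum_sub_distrib, sub_div]
    simp [hne]
  rw [hswap]
  have hterm : ∀ w ∈ (past t ω (j + 1))ᶜ,
      β * Λ * freeDeg D w - (β * Λ * d) ^ 2 ≤
        1 - avg (cls t ω j) fun ω' => if Disjoint {w} (lv t ω' (j + 1)) then (1 : ℝ) else 0 := by
    intro w hw
    have h1 := avg_not_mem_lv_le (t := t) (ω := ω) hd0 hp0 hpd j (by omega) hpast hdn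
      (Finset.mem_compl.1 hw)
    have h2 : (freeDeg D w : ℝ) ≤ d := by exact_mod_cast freeDeg_le _ _
    have h3 : 0 ≤ β * Λ := mul_nonneg hβ0 hΛ0
    have h4 : β * Λ * freeDeg D w ≤ β * Λ * d := mul_le_mul_of_nonneg_left h2 h3
    have h5 : β * Λ * d ≤ 1 := by
      have e1 : β * Λ * d = b * Λ / n := by rw [hβ]; field_simp
      rw [e1, div_le_one hn']
      nlinarith
    have h6 : 0 ≤ β * Λ * freeDeg D w := mul_nonneg h3 (Nat.cast_nonneg _)
    have h7 := exp_neg_le_one_sub_add_sq h6 (h4.trans h5)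
    have h8 : (β * Λ * freeDeg D w) ^ 2 ≤ (β * Λ * d) ^ 2 := pow_le_pow_left₀ h6 h4 2
    linarith
  refine le_trans ?_ (Finset.sum_le_sum hterm)
  rw [Finset.sum_sub_distrib, ← Finset.mul_sum, Finset.sum_const, nsmul_eq_mul]
  have h1 := sum_freeDeg (t := t) (ω := ω) j
  have h2 := le_card_compl_exposedAt (t := t) (ω := ω) j
  have h3 : (((past t ω (j + 1))ᶜ.card : ℕ) : ℝ) ≤ n := by
    have := Finset.card_le_univ (past t ω (j + 1))ᶜ
    rw [Fintype.card_fin] at this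
    exact_mod_cast this
  have h4 := mul_le_mul_of_nonneg_right h3 (sq_nonneg (β * Λ * d))
  have h5 : β * Λ * (n * d - 2 * d * fullPast d p j - d * fullSize d p j) ≤
      β * Λ * ∑ w ∈ (past t ω (j + 1))ᶜ, (freeDeg D w : ℝ) :=
    mul_le_mul_of_nonneg_left (by linarith) (mul_nonneg hβ0 hΛ0)
  have e1 : β * Λ * (n * d - 2 * d * fullPast d p j - d * fullSize d p j) =
      Λ * (b * (1 - (2 * fullPast d p j + fullSize d p j) / n)) := by
    rw [hβ]; field_simp
    ring
  have e2 : n * (β * Λ * d) ^ 2 = Λ * (b ^ 2 * Λ / n) := by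
    rw [hβ]; field_simp
  have h6 : b ^ 2 * Λ / n ≤ F / n := by
    gcongr
    exact (mul_le_of_le_one_left hΛ0 (pow_le_one₀ hb0 hb1)).trans hΛF
  have h7 : 1 - 22 * F / n ≤
      b * (1 - (2 * fullPast d p j + fullSize d p j) / n) - b ^ 2 * Λ / n := by
    have h8 : b * ((2 * fullPast d p j + fullSize d p j) / n) ≤ 3 * F / n := by
      calc _ ≤ 1 * ((2 * fullPast d p j + fullSize d p j : ℝ) / n) :=
            mul_le_mul_of_nonneg_right hb1 (by positivity)
        _ ≤ _ := by rw [one_mul]; gcongr; linarith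
    have h9 : 3 * (6 * d / n : ℝ) ≤ 18 * F / n := by
      rw [mul_div_assoc', ← mul_assoc]
      gcongr
      norm_num
    have e3 : 22 * F / n = 18 * F / n + 3 * F / n + F / n := by ring
    rw [e3]
    linarith
  have h10 := mul_le_mul_of_nonneg_left h7 hΛ0
  linarith

end Levels

section Means

variable {n d p : ℕ} {t : Fin n}

theorem exp_eight_le : Real.exp 8 ≤ 3000 := by
  have h1 : Real.exp 8 = Real.exp 1 ^ 8 := by
    rw [← Real.exp_nat_mul]; norm_num
  rw [h1]
  have h2 := Real.exp_one_lt_d9.le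
  calc Real.exp 1 ^ 8 ≤ (2.7182818286 : ℝ) ^ 8 := pow_le_pow_left₀ (Real.exp_pos 1).le h2 8
    _ ≤ 3000 := by norm_num

theorem freeDeg_add_backDeg {ω : Pairing n d × Selection n p} {u : Fin n} {j : ℕ}
    (h : Disjoint {u} (past t ω j)) :
    freeDeg (exposedAt ω.1 (past t ω j)) u + backDeg t ω {u} j = d := by
  have h1 := card_free_add_backDeg h
  rw [Finset.card_singleton, one_mul] at h1
  refine Eq.trans ?_ h1
  rw [freeDeg]
  congr 2
  ext x
  simp

theorem sum_card_scarce_le (hd : 0 < d) (hpd : 4 * p ≤ d) (j : ℕ)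
    (hj : 6000 * fullPast d p j ≤ n) :
    ∑ ω : Pairing n d × Selection n p, (((lv t ω j).filter fun u =>
        freeDeg (exposedAt ω.1 (past t ω j)) u < quota d p j).card : ℝ) ≤
      n * Real.exp (-(5 * d)) * Fintype.card (Pairing n d × Selection n p) := by
  have hn : 0 < n := t.pos
  have hn' : (0 : ℝ) < n := by exact_mod_cast hn
  have hpt : ∀ ω : Pairing n d × Selection n p, (((lv t ω j).filter fun u =>
      freeDeg (exposedAt ω.1 (past t ω j)) u < quota d p j).card : ℝ) ≤
      ∑ u : Fin n, Real.exp (-(6 * d)) * (if Disjoint {u} (past t ω j) then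
        Real.exp 8 ^ backDeg t ω {u} j else 0) := by
    intro ω
    rw [Finset.card_eq_sum_ones, Nat.cast_sum]
    refine (Finset.sum_le_sum (g := fun u => Real.exp (-(6 * d)) *
      (if Disjoint {u} (past t ω j) then Real.exp 8 ^ backDeg t ω {u} j else 0)) ?_).trans
      (Finset.sum_le_sum_of_subset_of_nonneg (Finset.subset_univ _) fun u _ _ => ?_)
    · intro u hu
      rw [Finset.mem_filter] at hu
      have hdis : Disjoint {u} (past t ω j) := by
        rw [Finset.disjoint_singleton_left]
        exact Finset.disjoint_right.1 (disjoint_past_lv t ω j) hu.1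
      have h1 := freeDeg_add_backDeg hdis
      have h2 := hu.2
      have h3 : 6 * d ≤ 8 * backDeg t ω {u} j := by
        cases j with
        | zero =>
          have : backDeg t ω {u} 0 = 0 := by simp [backDeg, past]
          simp only [quota] at h2
          omega
        | succ j =>
          simp only [quota] at h2
          omega
      rw [if_pos hdis, ← Real.exp_nat_mul, ← Real.exp_add, Nat.cast_one]
      apply Real.one_le_exp
      have h4 : (6 : ℝ) * d ≤ 8 * backDeg t ω {u} j := by exact_mod_cast h3
      linarith
    · split_ifs <;> positivity
  refine (Finset.sum_le_sum fun ω _ => hpt ω).trans ?_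
  rw [Finset.sum_comm]
  have hu : ∀ u : Fin n, ∑ ω : Pairing n d × Selection n p, Real.exp (-(6 * d)) *
      (if Disjoint {u} (past t ω j) then Real.exp 8 ^ backDeg t ω {u} j else 0) ≤
      Real.exp (-(5 * d)) * Fintype.card (Pairing n d × Selection n p) := by
    intro u
    rw [← Finset.mul_sum]
    have h1 := sum_pow_backDeg_le (t := t) (d := d) (p := p) (Real.one_le_exp (by norm_num : (0:ℝ) ≤ 8))
      hd {u} j (by omega)
    rw [Finset.card_singleton, Nat.cast_one, mul_one] at h1
    refine (mul_le_mul_of_nonneg_left h1 (Real.exp_pos _).le).trans ?_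
    rw [← mul_assoc, ← Real.exp_add]
    apply mul_le_mul_of_nonneg_right _ (Nat.cast_nonneg _)
    apply Real.exp_le_exp.2
    have h2 : (6000 : ℝ) * fullPast d p j ≤ n := by exact_mod_cast hj
    have h3 : (Real.exp 8 - 1) * (2 * d / n) * fullPast d p j ≤ 3000 * (2 * d / n) * fullPast d p j := by
      gcongr
      linarith [exp_eight_le]
    have h4 : 3000 * (2 * d / n : ℝ) * fullPast d p j = d * (6000 * fullPast d p j / n) := by
      field_simp; ring
    have h5 : (6000 * fullPast d p j / n : ℝ) ≤ 1 := by rwa [div_le_one hn']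
    have h6 := mul_le_mul_of_nonneg_left h5 (Nat.cast_nonneg (α := ℝ) d)
    linarith
  refine (Finset.sum_le_sum fun u _ => hu u).trans ?_
  rw [Finset.sum_const, nsmul_eq_mul, Finset.card_univ, Fintype.card_fin, mul_assoc]

theorem le_sum_lvWeight (hd : 0 < d) (hp : 0 < p) (hpd : 4 * p ≤ d) (j : ℕ)
    (hj : 6000 * fullPast d p j ≤ n) :
    quota d p j * (∑ ω : Pairing n d × Selection n p, ((lv t ω j).card : ℝ) -
      n * Real.exp (-(5 * d)) * Fintype.card (Pairing n d × Selection n p)) ≤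
      ∑ ω : Pairing n d × Selection n p, lvWeight t ω j := by
  have h1 := sum_card_scarce_le (t := t) hd hpd j hj
  have h2 : ∀ ω : Pairing n d × Selection n p, quota d p j * (((lv t ω j).card : ℝ) -
      (((lv t ω j).filter fun u =>
        freeDeg (exposedAt ω.1 (past t ω j)) u < quota d p j).card : ℝ)) ≤ lvWeight t ω j := by
    intro ω
    rw [lvWeight_eq hd hp, Finset.card_eq_sum_ones, Finset.card_eq_sum_ones, Finset.sum_filter,
      Nat.cast_sum, Nat.cast_sum, ← Finset.sum_sub_distrib, Finset.mul_sum]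
    apply Finset.sum_le_sum
    intro u _
    split_ifs with h
    · simp
    · rw [min_eq_left (not_lt.1 h)]; simp
  refine le_trans ?_ (Finset.sum_le_sum fun ω _ => h2 ω)
  rw [← Finset.mul_sum, Finset.sum_sub_distrib]
  exact mul_le_mul_of_nonneg_left (by linarith) (Nat.cast_nonneg _)

theorem two_mul_fullSize_le (hd : 2 ≤ d) (hp : 2 ≤ p) (j : ℕ) :
    2 * fullSize d p j ≤ fullSize d p (j + 1) := by
  have : 2 ≤ quota d p j := by cases j <;> simpa [quota]
  exact Nat.mul_le_mul_right _ this

theorem lvWeight_mean_of_card_mean (hd : 2 ≤ d) (hp : 2 ≤ p) (hpd : 4 * p ≤ d) (j : ℕ)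
    (hj : 6000 * fullPast d p j ≤ n) {x : ℝ}
    (h : fullSize d p j * (1 - x) * Fintype.card (Pairing n d × Selection n p) ≤
      ∑ ω : Pairing n d × Selection n p, ((lv t ω j).card : ℝ)) :
    fullSize d p (j + 1) * (1 - (x + n * Real.exp (-(5 * d)))) *
        Fintype.card (Pairing n d × Selection n p) ≤
      ∑ ω : Pairing n d × Selection n p, lvWeight t ω j := by
  refine le_trans ?_ (le_sum_lvWeight (by omega) (by omega) hpd j hj)
  have h1 : (1 : ℝ) ≤ fullSize d p j := by
    exact_mod_cast one_le_fullSize (by omega) (by omega) j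
  set M : ℝ := (Fintype.card (Pairing n d × Selection n p) : ℝ)
  have h2 : (n : ℝ) * Real.exp (-(5 * d)) * M ≤ fullSize d p j * (n * Real.exp (-(5 * d)) * M) :=
    le_mul_of_one_le_left (by positivity) h1
  have h3 := mul_le_mul_of_nonneg_left (sub_le_sub h h2) (Nat.cast_nonneg (α := ℝ) (quota d p j))
  refine le_trans (le_of_eq ?_) h3
  rw [fullSize]; push_cast; ring

/-- The expected size of level `j` is close to its maximum. -/
theorem le_sum_card_lv (hd : 2 ≤ d) (hp : 2 ≤ p) (hpd : 4 * p ≤ d) (j : ℕ)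
    (hj : 6000 * fullSize d p j ≤ n) :
    fullSize d p j * (1 - (44 * fullSize d p j / n + j * (n * Real.exp (-(5 * d))))) *
        Fintype.card (Pairing n d × Selection n p) ≤
      ∑ ω : Pairing n d × Selection n p, ((lv t ω j).card : ℝ) := by
  have hn' : (0 : ℝ) < n := by exact_mod_cast t.pos
  induction j with
  | zero =>
    simp only [fullSize, lv, Finset.card_singleton, Finset.sum_const, Finset.card_univ,
      nsmul_eq_mul, Nat.cast_one, Nat.cast_zero, zero_mul, add_zero, mul_one, one_mul]
    have : (0 : ℝ) ≤ 44 / n := by positivity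
    exact mul_le_of_le_one_left (Nat.cast_nonneg _) (by linarith)
  | succ j ih =>
    have h2 := two_mul_fullSize_le hd hp j
    have hP := fullPast_le hd hp j
    have h1 : 1 ≤ fullSize d p j := one_le_fullSize (by omega) (by omega) j
    have h3 := lvWeight_mean_of_card_mean hd hp hpd j (by omega) (ih (by omega))
    have h4 : ∑ ω : Pairing n d × Selection n p,
        lvWeight t ω j * (1 - 22 * fullSize d p (j + 1) / n) ≤
        ∑ ω : Pairing n d × Selection n p, ((lv t ω (j + 1)).card : ℝ) := by
      have := sum_le_of_avg_cls (d := d) (p := p) t j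
        (g := fun ω => -((lv t ω (j + 1)).card : ℝ))
        (b := fun ω => -(lvWeight t ω j * (1 - 22 * fullSize d p (j + 1) / n))) (fun ω => by
          have h5 := le_avg_card_lv (t := t) (ω := ω) hd hp (by omega) j (by omega) (by omega)
          have h6 : avg (cls t ω j) (fun ω' => -((lv t ω' (j + 1)).card : ℝ)) =
              -avg (cls t ω j) (fun ω' => ((lv t ω' (j + 1)).card : ℝ)) := by
            unfold avg; rw [Finset.sum_neg_distrib, neg_div]
          rw [h6]
          exact neg_le_neg h5)
      rw [Finset.sum_neg_distrib, Finset.sum_neg_distrib] at this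
      linarith
    refine le_trans ?_ h4
    rw [← Finset.sum_mul]
    set M : ℝ := (Fintype.card (Pairing n d × Selection n p) : ℝ)
    set δ := (n : ℝ) * Real.exp (-(5 * d)) with hδ
    have hδ0 : 0 ≤ δ := by positivity
    have hb : (22 * fullSize d p (j + 1) / n : ℝ) ≤ 1 := by
      rw [div_le_one hn']; exact_mod_cast (by omega : 22 * fullSize d p (j + 1) ≤ n)
    refine le_trans ?_ (mul_le_mul_of_nonneg_right h3 (sub_nonneg.2 hb))
    have h7 : (44 * fullSize d p j / n : ℝ) ≤ 22 * fullSize d p (j + 1) / n := by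
      apply div_le_div_of_nonneg_right _ hn'.le
      exact_mod_cast (by omega : 44 * fullSize d p j ≤ 22 * fullSize d p (j + 1))
    have h8 : (44 * fullSize d p (j + 1) / n : ℝ) =
      22 * fullSize d p (j + 1) / n + 22 * fullSize d p (j + 1) / n := by ring
    rw [h8]
    set b := (22 * fullSize d p (j + 1) / n : ℝ)
    set a := (44 * fullSize d p j / n : ℝ)
    have hb0 : 0 ≤ b := by positivity
    have ha0 : 0 ≤ a := by positivity
    have h9 : 1 - (b + b + (j + 1 : ℕ) * δ) ≤ (1 - (a + j * δ + δ)) * (1 - b) := by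
      push_cast
      have : 0 ≤ (a + j * δ + δ) * b := by positivity
      linarith
    have h10 := mul_le_mul_of_nonneg_left h9
      (by positivity : 0 ≤ (fullSize d p (j + 1) : ℝ) * M)
    linarith

/-- The expected weight of level `j` is close to its maximum. -/
theorem le_sum_lvWeight_mean (hd : 2 ≤ d) (hp : 2 ≤ p) (hpd : 4 * p ≤ d) (j : ℕ)
    (hj : 6000 * fullSize d p j ≤ n) :
    fullSize d p (j + 1) *
        (1 - (44 * fullSize d p j / n + (j + 1) * (n * Real.exp (-(5 * d))))) *
        Fintype.card (Pairing n d × Selection n p) ≤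
      ∑ ω : Pairing n d × Selection n p, lvWeight t ω j := by
  have hP := fullPast_le hd hp j
  have := lvWeight_mean_of_card_mean hd hp hpd j (by omega) (le_sum_card_lv (t := t) hd hp hpd j hj)
  refine le_trans (le_of_eq ?_) this
  ring

end Means

section Avoid

variable {n d p : ℕ} {t : Fin n} {ω : Pairing n d × Selection n p}

variable (t ω) in
/-- The nodes of `V` are not in a level before level `j` and have no neighbours in level `j`. -/
def Avoids (V : Finset (Fin n)) (j : ℕ) : Prop :=
  Disjoint V (past t ω j) ∧ ∀ v ∈ V, Disjoint (nbrs (graph ω.1) v) (lv t ω j)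

open Classical in
theorem avg_cls_avoids_le (hd : 0 < d) (hp : 0 < p) (hpd : p ≤ d) (j : ℕ) (V : Finset (Fin n))
    (hV : Disjoint V (past t ω (j + 1))) {γ ξ e : ℝ} (he : (fullSize d p (j + 1) : ℝ) = e * n)
    (hγ : γ = 2 * (V.card + 2) * d / n) (hγ1 : 3 * γ ≤ 1) (heγ : 2 * e + γ ≤ 1)
    (hm : 4 * (fullPast d p j + V.card * d) ≤ (n : ℝ))
    (hξ : 4 / n * (e * (2 * fullPast d p j + 2 * V.card * d) +
      (2 * e + γ) * (V.card * d + V.card + fullPast d p (j + 1))) ≤ ξ) :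
    avg (cls t ω j) (fun ω' => if Avoids t ω' V (j + 1) then 1 else 0) ≤
      Real.exp (-((1 - 3 * γ) / (n * d) * lvWeight t ω j *
        ((d - 1) * (V.card * d - backDeg t ω V j))) + ξ * (V.card * d - backDeg t ω V j)) := by
  have hn : 0 < n := t.pos
  have hn' : (0 : ℝ) < n := by exact_mod_cast hn
  have hd' : (0 : ℝ) < d := by exact_mod_cast hd
  have hd1 : (1 : ℝ) ≤ d := by exact_mod_cast hd
  have hγ0 : 0 ≤ γ := by rw [hγ]; positivity
  have he0 : 0 ≤ e := by
    have : 0 ≤ e * n := he ▸ Nat.cast_nonneg _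
    exact nonneg_of_mul_nonneg_left this hn'
  set D := exposedAt ω.1 (past t ω j) with hD
  set K := Dᶜ.filter fun x => x.1 ∈ V with hKdef
  set U := past t ω (j + 1) with hU
  set m₀ : ℝ := n * d - 2 * d * fullPast d p j - 2 * (V.card * d ^ 2) with hm₀def
  have hm₀ : n * d / 2 ≤ m₀ := by
    have := mul_le_mul_of_nonneg_right hm hd'.le
    rw [hm₀def]; linarith [sq (d : ℝ)]
  have hnd : (0 : ℝ) < n * d := mul_pos hn' hd'
  have hm₀pos : 0 < m₀ := by linarith
  have hVj : Disjoint V (past t ω j) := hV.mono_right (past_mono (Nat.le_succ j))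
  have hk := card_free_add_backDeg hVj
  have hkR : (K.card : ℝ) = V.card * d - backDeg t ω V j := by
    have : ((K.card + backDeg t ω V j : ℕ) : ℝ) = (V.card * d : ℕ) := by exact_mod_cast hk
    push_cast at this; linarith
  rw [← hkR]
  have hfull : fullSize d p (j + 1) ≤ n := by
    have : (fullSize d p (j + 1) : ℝ) ≤ n := by
      rw [he]; exact mul_le_of_le_one_left hn'.le (by linarith)
    exact_mod_cast this
  have hVd : (K.card : ℝ) ≤ V.card * d := by
    rw [hkR]; linarith [Nat.cast_nonneg (α := ℝ) (backDeg t ω V j)]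
  have hc : Consts (Fin n) (Fin d) (selProb t ω j) (lv t ω j) (quota d p j)
      (fullSize d p (j + 1)) (V.card * d ^ 2) m₀ (n * d) γ ((1 - 3 * γ) / (n * d)) := by
    refine consts_lv hd hpd j (by positivity) hm₀pos ?_ ?_ hγ1 hfull
    · rw [hm₀def]
      have h1 : (0 : ℝ) ≤ 2 * d * fullPast d p j := by positivity
      have h2 : (0 : ℝ) ≤ 2 * (V.card * d ^ 2) := by positivity
      linarith
    · rw [div_le_iff₀ hm₀pos]
      calc (V.card * d ^ 2 + 2 * d ^ 2 : ℝ) = γ * (n * d / 2) := by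
            rw [hγ]; field_simp
        _ ≤ _ := mul_le_mul_of_nonneg_left hm₀ hγ0
  rw [cls, avg_product]
  have hfibU : ∀ f ∈ fib D ω.1, ∀ c ∈ selFib (past t ω j) ω.2, (f, c) ∈ cls t ω j :=
    fun f hf c hc => Finset.mem_product.2 ⟨hf, hc⟩
  have hstep : ∀ f ∈ fib D ω.1, avg (selFib (past t ω j) ω.2)
      (fun c => if Avoids t (f, c) V (j + 1) then (1 : ℝ) else 0) ≤
      adjProd (selProb t ω j) (lv t ω j) (found U V ∅ K f) f := by
    intro f hf
    refine (avg_mono (g' := fun c => if Disjoint (found U V ∅ K f) (lv t (f, c) (j + 1)) then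
      (1 : ℝ) else 0) fun c _ => ?_).trans (avg_selFib_disjoint_lv_le hd hp hf ?_)
    · by_cases h : Avoids t (f, c) V (j + 1)
      · rw [if_pos h, if_pos]
        rw [Finset.disjoint_left]
        intro w hw
        simp only [found, Finset.empty_union, Finset.mem_filter, Finset.mem_univ, true_and,
          Finset.mem_union, not_or] at hw
        obtain ⟨⟨_, hwV⟩, x, hx, rfl⟩ := hw
        have hxV : x.1 ∈ V := (Finset.mem_filter.1 hx).2
        refine Finset.disjoint_left.1 (h.2 x.1 hxV) (mem_nbrs.2 ⟨fun h' => hwV (h' ▸ hxV), ?_⟩)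
        exact ⟨x.2, (f.1 x).2, rfl⟩
      · rw [if_neg h]; split_ifs <;> norm_num
    · rw [Finset.disjoint_left]
      intro w hw
      simp only [found, Finset.empty_union, Finset.mem_filter, Finset.mem_univ, true_and,
          Finset.mem_union, not_or] at hw
      exact hw.1.1
  refine (avg_mono hstep).trans ?_
  have hβL : (1 - 3 * γ) / (n * d) * fullSize d p (j + 1) * d ≤ e := by
    rw [he]
    have : (1 - 3 * γ) / (n * d) * (e * n) * d = (1 - 3 * γ) * e := by field_simp
    rw [this]
    exact mul_le_of_le_one_left he0 (by linarith)
  have hlvU : lv t ω j ⊆ U := lv_subset_past (Nat.lt_succ_self j)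
  have hξ0 : 0 ≤ ξ := le_trans (by positivity) hξ
  have hcardU : ((past t ω (j + 1)).card : ℝ) ≤ fullPast d p (j + 1) := by
    exact_mod_cast card_past_le (j + 1)
  have hmain := avg_adjProd_found_le hc hlvU hV.symm hξ0 ?_ ?_ K.card K ∅ D ω.1 rfl
    (closed_exposedAt ω.1 (past t ω j))
    (fun x hx => ⟨by simpa using (Finset.mem_filter.1 hx).1, (Finset.mem_filter.1 hx).2⟩)
    (Finset.disjoint_empty_left _) ?_ ?_ (card_compl_exposedAt_le j)
    (fun u _ => freeDeg_mul_selProb_le hd hp j u) (lvWeight_le_fullSize hd hp j)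
  · refine hmain.trans (le_of_eq ?_)
    simp only [Finset.notMem_empty, Finset.filter_false, Finset.card_empty, Nat.cast_zero,
      zero_add, Fintype.card_fin]
    rfl
  · rw [Fintype.card_fin]; linarith
  · rw [Fintype.card_fin, Fintype.card_prod, Fintype.card_fin, Fintype.card_fin]
    push_cast
    have e1 : (n : ℝ) * d - m₀ = 2 * d * fullPast d p j + 2 * (V.card * d ^ 2) := by
      rw [hm₀def]; ring
    rw [e1]
    have hγe : 0 ≤ 2 * e + γ := by linarith
    calc _ ≤ 2 * e * (2 * d * fullPast d p j + 2 * (V.card * d ^ 2)) +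
          2 * (2 * e + γ) * (V.card * d ^ 2 + d * (V.card + fullPast d p (j + 1))) := by
          have h1 : 2 * ((1 - 3 * γ) / (n * d) * fullSize d p (j + 1)) * d ≤ 2 * e := by linarith
          gcongr
      _ = (4 / n * (e * (2 * fullPast d p j + 2 * V.card * d) +
            (2 * e + γ) * (V.card * d + V.card + fullPast d p (j + 1)))) * (n * d / 2) := by
          field_simp; ring
      _ ≤ ξ * m₀ := mul_le_mul hξ hm₀ (by positivity) hξ0
  · simp only [Finset.notMem_empty, Finset.filter_false, Finset.card_empty, Nat.cast_zero,
      zero_add, Fintype.card_fin]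
    nlinarith
  · simp only [Finset.notMem_empty, Finset.filter_false, Finset.card_empty, Nat.cast_zero,
      zero_add, Fintype.card_fin]
    have h1 := le_card_compl_exposedAt (t := t) (ω := ω) j
    have h2 := mul_le_mul_of_nonneg_left hVd hd'.le
    rw [hm₀def]
    have : (d : ℝ) * (V.card * d) = V.card * d ^ 2 := by ring
    linarith

open Classical in
theorem sum_avoids_le (hd : 0 < d) (hp : 0 < p) (hpd : p ≤ d) (j : ℕ) (V : Finset (Fin n))
    {γ ξ e Λ : ℝ} (he : (fullSize d p (j + 1) : ℝ) = e * n)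
    (hγ : γ = 2 * (V.card + 2) * d / n) (hγ1 : 3 * γ ≤ 1) (heγ : 2 * e + γ ≤ 1)
    (hm : 4 * (fullPast d p j + V.card * d) ≤ (n : ℝ))
    (hξ : 4 / n * (e * (2 * fullPast d p j + 2 * V.card * d) +
      (2 * e + γ) * (V.card * d + V.card + fullPast d p (j + 1))) ≤ ξ) :
    ∑ ω : Pairing n d × Selection n p,
      (if Avoids t ω V (j + 1) ∧ Λ ≤ lvWeight t ω j then (1 : ℝ) else 0) ≤
    Real.exp (-((1 - 3 * γ) / n * Λ * (d - 1) * V.card) + ξ * (V.card * d) +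
      2 * e * (2 * V.card * d / n) * fullPast d p j) *
      Fintype.card (Pairing n d × Selection n p) := by
  have hn : 0 < n := t.pos
  have hn' : (0 : ℝ) < n := by exact_mod_cast hn
  have hd' : (0 : ℝ) < d := by exact_mod_cast hd
  have hd1 : (1 : ℝ) ≤ d := by exact_mod_cast hd
  have hγ0 : 0 ≤ γ := by rw [hγ]; positivity
  have he0 : 0 ≤ e := by
    have : 0 ≤ e * n := he ▸ Nat.cast_nonneg _
    exact nonneg_of_mul_nonneg_left this hn'
  have hξ0 : 0 ≤ ξ := le_trans (by positivity) hξ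
  set B := Real.exp (-((1 - 3 * γ) / n * Λ * (d - 1) * V.card) + ξ * (V.card * d)) with hB
  have hj4 : 4 * fullPast d p j ≤ n := by
    have : (4 : ℝ) * fullPast d p j ≤ n := by
      have : (0 : ℝ) ≤ V.card * d := by positivity
      linarith
    exact_mod_cast this
  have hstep : ∀ ω : Pairing n d × Selection n p, avg (cls t ω j) (fun ω' =>
      if Avoids t ω' V (j + 1) ∧ Λ ≤ lvWeight t ω' j then (1 : ℝ) else 0) ≤
      B * (if Disjoint V (past t ω j) then Real.exp e ^ backDeg t ω V j else 0) := by
    intro ω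
    by_cases h : Disjoint V (past t ω (j + 1)) ∧ Λ ≤ lvWeight t ω j
    · rw [if_pos (h.1.mono_right (past_mono (Nat.le_succ j)))]
      refine (avg_mono (g' := fun ω' => if Avoids t ω' V (j + 1) then (1 : ℝ) else 0)
        fun ω' _ => ?_).trans ((avg_cls_avoids_le hd hp hpd j V h.1 he hγ hγ1 heγ hm hξ).trans ?_)
      · by_cases h1 : Avoids t ω' V (j + 1)
        · rw [if_pos h1]; split_ifs <;> norm_num
        · rw [if_neg h1, if_neg fun h2 => h1 h2.1]
      · rw [hB, ← Real.exp_nat_mul, ← Real.exp_add]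
        apply Real.exp_le_exp.2
        set κ : ℝ := (backDeg t ω V j : ℝ) with hκ
        have hκ0 : 0 ≤ κ := Nat.cast_nonneg _
        set b := (1 - 3 * γ) / (n * d) with hb
        have hb0 : 0 ≤ b := div_nonneg (by linarith) (by positivity)
        have hΛF : lvWeight t ω j ≤ e * n := he ▸ lvWeight_le_fullSize hd hp j
        have h1 : b * lvWeight t ω j * (d - 1) * κ ≤ e * κ := by
          apply mul_le_mul_of_nonneg_right _ hκ0
          calc b * lvWeight t ω j * (d - 1) ≤ b * (e * n) * d := by
                have : (d : ℝ) - 1 ≤ d := by linarith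
                have : 0 ≤ (d : ℝ) - 1 := by linarith
                gcongr
            _ = (1 - 3 * γ) * e := by rw [hb]; field_simp
            _ ≤ e := mul_le_of_le_one_left he0 (by linarith)
        have h2 : b * Λ * ((d - 1) * (V.card * d)) ≤
            b * lvWeight t ω j * ((d - 1) * (V.card * d)) := by
          have : 0 ≤ (d : ℝ) - 1 := by linarith
          gcongr
          exact h.2
        have h3 : (1 - 3 * γ) / n * Λ * (d - 1) * V.card = b * Λ * ((d - 1) * (V.card * d)) := by
          rw [hb]; field_simp
        have h4 : 0 ≤ ξ * κ := mul_nonneg hξ0 hκ0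
        rw [h3]
        linarith
    · have h0 : avg (cls t ω j) (fun ω' =>
          if Avoids t ω' V (j + 1) ∧ Λ ≤ lvWeight t ω' j then (1 : ℝ) else 0) = 0 := by
        rw [avg_congr (g' := fun _ => 0) fun ω' hω' => if_neg ?_]
        · simp [avg]
        · rintro ⟨h1, h2⟩
          rw [lvWeight_congr hω'] at h2
          have h3 := h1.1
          rw [past_succ_eq_of_mem_cls hω'] at h3
          exact h ⟨h3, h2⟩
      rw [h0]
      have : 0 < B := Real.exp_pos _
      split_ifs <;> positivity
  refine (sum_le_of_avg_cls t j hstep).trans ?_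
  rw [← Finset.mul_sum]
  have h1 := sum_pow_backDeg_le (t := t) (d := d) (p := p) (Real.one_le_exp he0) hd V j hj4
  refine (mul_le_mul_of_nonneg_left h1 (Real.exp_pos _).le).trans ?_
  rw [← mul_assoc, ← Real.exp_add]
  apply mul_le_mul_of_nonneg_right _ (Nat.cast_nonneg _)
  apply Real.exp_le_exp.2
  have h2 : Real.exp e - 1 ≤ 2 * e := by
    have := exp_le_one_add_two_mul he0 (by linarith)
    linarith
  have h3 := mul_le_mul_of_nonneg_right h2
    (by positivity : (0 : ℝ) ≤ 2 * V.card * d / n * fullPast d p j)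
  linarith

set_option maxHeartbeats 1000000 in
open Classical in
/-- The probability that a given set of nodes avoids the levels up to level `j + 1`. -/
theorem sum_avoids_le_exp (hd : 2 ≤ d) (hp : 2 ≤ p) (hpd : p ≤ d) {j : ℕ} (hj : 1 ≤ j)
    (V : Finset (Fin n)) {δ : ℝ} (hδ0 : 0 ≤ δ) (hδ1 : δ ≤ 1)
    (hsmall : 12 * (V.card + 2) * fullSize d p (j + 1) ≤ n) :
    ∑ ω : Pairing n d × Selection n p, (if Avoids t ω V (j + 1) ∧
      (1 - δ) * fullSize d p (j + 1) ≤ lvWeight t ω j then (1 : ℝ) else 0) ≤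
    Real.exp (V.card * (-(fullSize d p (j + 1) * d / n) + fullSize d p (j + 1) * d / n * δ +
      fullSize d p (j + 1) / n +
      60 * (V.card + 1) ^ 2 * (fullSize d p (j + 1) * d / n * (fullSize d p j / n)))) *
      Fintype.card (Pairing n d × Selection n p) := by
  have hn : 0 < n := t.pos
  have hn' : (0 : ℝ) < n := by exact_mod_cast hn
  have hd' : (0 : ℝ) < d := by exact_mod_cast (by omega : 0 < d)
  have hd1 : (1 : ℝ) ≤ d := by exact_mod_cast (by omega : 1 ≤ d)
  have h2 := two_mul_fullSize_le hd hp j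
  have hP := fullPast_le hd hp j
  have hP' := fullPast_succ_le hd hp j
  have hdQ : d ≤ fullSize d p j := by
    obtain ⟨i, rfl⟩ : ∃ i, j = i + 1 := ⟨j - 1, by omega⟩
    rw [fullSize_succ]
    exact Nat.le_mul_of_pos_left d (pow_pos (by omega) i)
  set F : ℝ := (fullSize d p (j + 1) : ℝ) with hF
  set Q : ℝ := (fullSize d p j : ℝ) with hQ
  set r : ℝ := (V.card : ℝ) with hr
  have hr0 : 0 ≤ r := Nat.cast_nonneg _
  have h2' : 2 * Q ≤ F := by rw [hQ, hF]; exact_mod_cast h2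
  have hP1 : (fullPast d p j : ℝ) ≤ Q := by rw [hQ]; exact_mod_cast hP
  have hP2 : (fullPast d p (j + 1) : ℝ) ≤ 2 * Q := by rw [hQ]; exact_mod_cast hP'
  have hdQ' : (d : ℝ) ≤ Q := by rw [hQ]; exact_mod_cast hdQ
  have hs : 12 * (r + 2) * F ≤ n := by rw [hr, hF]; exact_mod_cast hsmall
  have hF0 : 0 ≤ F := Nat.cast_nonneg _
  have hQ0 : 0 ≤ Q := Nat.cast_nonneg _
  set e := F / n with he
  have he0 : 0 ≤ e := by positivity
  set q := Q / n with hq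
  have hq0 : 0 ≤ q := by positivity
  set x := (d : ℝ) / n with hx
  have hx0 : 0 ≤ x := by positivity
  have hxq : x ≤ q := by rw [hx, hq]; gcongr
  have hqe : 2 * q ≤ e := by rw [hq, he, mul_div_assoc']; gcongr
  have hse : 12 * (r + 2) * e ≤ 1 := by
    rw [he, mul_div_assoc', div_le_one hn']; exact hs
  set γ := 2 * (r + 2) * d / n with hγ
  have hγx : γ = 2 * (r + 2) * x := by rw [hγ, hx]; ring
  have hγe : γ ≤ (r + 2) * e := by rw [hγx]; nlinarith
  have hγ0 : 0 ≤ γ := by rw [hγx]; positivity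
  have hre : 0 ≤ r * e := mul_nonneg hr0 he0
  set ξ := 8 * (r + 1) * (r + 5) * (e * q) with hξ
  have hmain := sum_avoids_le (t := t) (d := d) (p := p) (Λ := (1 - δ) * F) (ξ := ξ) (e := e)
    (by omega) (by omega) hpd j V (by rw [he, div_mul_cancel₀ _ hn'.ne']) hγ (by linarith)
    (by linarith) ?_ ?_
  · refine hmain.trans ?_
    apply mul_le_mul_of_nonneg_right _ (Nat.cast_nonneg _)
    apply Real.exp_le_exp.2
    have e1 : (1 - 3 * γ) / n * ((1 - δ) * F) * (d - 1) * V.card =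
        r * ((1 - 3 * γ) * (1 - δ) * (e * d - e)) := by rw [he, hr]; field_simp
    have e2 : ξ * (V.card * d) = r * (8 * (r + 1) * (r + 5) * (e * d * q)) := by
      rw [hξ, hr]; ring
    have e3 : 2 * e * (2 * V.card * d / n) * fullPast d p j =
        r * (4 * (e * d) * (fullPast d p j / n)) := by rw [hr]; field_simp; ring
    rw [e1, e2, e3, ← mul_neg, ← mul_add, ← mul_add]
    apply mul_le_mul_of_nonneg_left _ hr0
    have e4 : F * d / n = e * d := by rw [he]; ring
    rw [e4]
    have hPq : (fullPast d p j / n : ℝ) ≤ q := by rw [hq]; gcongr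
    have hed : 0 ≤ e * d := by positivity
    have h5 : 4 * (e * d) * (fullPast d p j / n) ≤ 4 * (e * d * q) := by
      have := mul_le_mul_of_nonneg_left hPq hed
      linarith
    have h6 : 3 * γ * (e * d) ≤ 6 * (r + 2) * (e * d * q) := by
      rw [hγx]
      have := mul_le_mul_of_nonneg_left hxq (by positivity : 0 ≤ 6 * (r + 2) * (e * d))
      linarith
    have h7 : 1 - 3 * γ - δ ≤ (1 - 3 * γ) * (1 - δ) := by
      have : 0 ≤ 3 * γ * δ := by positivity
      linarith
    have h8 : (1 - 3 * γ) * (1 - δ) ≤ 1 := by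
      apply mul_le_one₀ (by linarith) (by linarith) (by linarith)
    have h9 := mul_le_mul_of_nonneg_right h7 hed
    have h10 := mul_le_mul_of_nonneg_right h8 he0
    have h11 : 6 * (r + 2) + 8 * (r + 1) * (r + 5) + 4 ≤ 60 * (r + 1) ^ 2 := by nlinarith
    have h12 := mul_le_mul_of_nonneg_right h11 (by positivity : 0 ≤ e * d * q)
    linarith
  · have : 0 ≤ r * Q := by positivity
    nlinarith
  · have hb1 : 2 * (fullPast d p j : ℝ) + 2 * V.card * d ≤ 2 * (r + 1) * Q := by
      have := mul_le_mul_of_nonneg_left hdQ' hr0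
      linarith
    have hb2 : (V.card * d + V.card + fullPast d p (j + 1) : ℝ) ≤ 2 * (r + 1) * Q := by
      have := mul_le_mul_of_nonneg_left hdQ' hr0
      have := mul_le_mul_of_nonneg_left (hd1.trans hdQ') hr0
      linarith
    have hγe' : 0 ≤ 2 * e + γ := by linarith
    have h1 := mul_le_mul_of_nonneg_left hb1 he0
    have h3 := mul_le_mul_of_nonneg_left hb2 hγe'
    have h4 : (3 * e + γ) * (2 * (r + 1) * Q) ≤ ((r + 5) * e) * (2 * (r + 1) * Q) :=
      mul_le_mul_of_nonneg_right (by linarith) (by positivity)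
    calc _ ≤ 4 / n * (((r + 5) * e) * (2 * (r + 1) * Q)) := by
          apply mul_le_mul_of_nonneg_left _ (by positivity)
          refine (add_le_add h1 h3).trans (le_trans (le_of_eq ?_) h4)
          ring
      _ = ξ := by rw [hξ, hq]; ring

end Avoid

section Outer

variable {n d p : ℕ} {t : Fin n} {ω ω' : Pairing n d × Selection n p}

theorem mem_nbrs_comm (f : Pairing n d) {u v : Fin n} :
    u ∈ nbrs (graph f) v ↔ v ∈ nbrs (graph f) u := by
  rw [mem_nbrs, mem_nbrs, SimpleGraph.adj_comm]

variable (t ω) in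
open Classical in
/-- The nodes that are in no level up to level `j` and have no neighbours in level `j`. -/
noncomputable def outer (j : ℕ) : Finset (Fin n) :=
  Finset.univ.filter fun v => v ∉ past t ω (j + 1) ∧ Disjoint (nbrs (graph ω.1) v) (lv t ω j)

theorem mem_outer {j : ℕ} {v : Fin n} : v ∈ outer t ω j ↔
    v ∉ past t ω (j + 1) ∧ Disjoint (nbrs (graph ω.1) v) (lv t ω j) := by
  simp [outer]

theorem outer_eq_of_mem_cls {j : ℕ} (h : ω' ∈ cls t ω (j + 1)) : outer t ω' j = outer t ω j := by
  have hlv : lv t ω' j = lv t ω j := by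
    have hsub := past_mono (t := t) (ω := ω) (Nat.le_succ j)
    exact (past_lv_congr (fun e he => (mem_cls.1 h).1 e (hsub he))
      (fun u hu => (mem_cls.1 h).2 u (hsub hu))).2
  ext v
  rw [mem_outer, mem_outer, past_eq_of_mem_cls h, hlv]
  refine and_congr_right fun _ => ?_
  have key : ∀ u ∈ lv t ω j, (u ∈ nbrs (graph ω'.1) v ↔ u ∈ nbrs (graph ω.1) v) := by
    intro u hu
    rw [mem_nbrs_comm, mem_nbrs_comm ω.1, nbrs_congr fun a =>
      (mem_cls.1 h).1 (u, a) (lv_subset_past (Nat.lt_succ_self j) hu)]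
  rw [Finset.disjoint_right, Finset.disjoint_right]
  exact forall₂_congr fun u hu => not_congr (key u hu)

theorem backDeg_succ_of_disjoint {j : ℕ} {v : Fin n} (hv : v ∉ past t ω (j + 1))
    (h : Disjoint (nbrs (graph ω.1) v) (lv t ω j)) :
    backDeg t ω {v} (j + 1) = backDeg t ω {v} j := by
  unfold backDeg
  congr 1
  ext e
  simp only [Finset.mem_filter, Finset.mem_univ, true_and, Finset.mem_singleton]
  refine and_congr_right ?_
  rintro rfl
  rw [past_succ, Finset.mem_union, or_iff_left]
  intro he
  refine Finset.disjoint_left.1 h (mem_nbrs.2 ⟨fun h' => hv ?_, e.2, (ω.1.1 e).2, rfl⟩) he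
  rw [h', past_succ]
  exact Finset.mem_union_right _ he

variable (t ω) in
/-- The node `v` is in `outer t ω j`, and so are all its neighbours after level `j`. -/
def Deep (v : Fin n) (j : ℕ) : Prop :=
  v ∈ outer t ω j ∧ ∀ w ∈ nbrs (graph ω.1) v, w ∉ past t ω (j + 1) → w ∈ outer t ω j

open Classical in
theorem avg_cls_deep_le (j : ℕ) (v : Fin n) {X : ℝ} (hX : 0 < X)
    (hs : ((outer t ω j).card : ℝ) * X + 1 ≤ X ^ 2 * (n - 2 * fullPast d p (j + 1) - 2))
    (hv : v ∈ outer t ω j) :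
    avg (cls t ω (j + 1)) (fun ω' => if Deep t ω' v j then (1 : ℝ) else 0) ≤
      X ^ (d - backDeg t ω {v} j) := by
  have hv' := mem_outer.1 hv
  have hdis : Disjoint {v} (past t ω (j + 1)) := by simpa using hv'.1
  set D := exposedAt ω.1 (past t ω (j + 1)) with hD
  set K := Dᶜ.filter fun x => x.1 = v with hK
  set O := Finset.univ.filter fun x : HalfEdge n d => x.1 ∈ outer t ω j with hO
  have hk : K.card + backDeg t ω {v} j = d := by
    rw [← backDeg_succ_of_disjoint hv'.1 hv'.2]
    exact freeDeg_add_backDeg hdis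
  have hk' : K.card = d - backDeg t ω {v} j := by omega
  rw [← hk']
  have hOc : (O.card : ℝ) = (outer t ω j).card * d := by
    rw [hO, card_filter_fst_mem]; push_cast; rfl
  have hkd : (K.card : ℝ) ≤ d := by exact_mod_cast (by omega : K.card ≤ d)
  have hmain := avg_all_mem_le (X := X) (m₀ := n * d - 2 * d * fullPast d p (j + 1) - 2 * d)
    (kmax := d) hX O (by
      rw [hOc]
      have := mul_le_mul_of_nonneg_right hs (Nat.cast_nonneg (α := ℝ) d)
      linarith) K.card K D ω.1 rfl (closed_exposedAt _ _)
    (Finset.disjoint_left.2 fun x hx => by simpa using (Finset.mem_filter.1 hx).1) hkd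
    (by
      have := le_card_compl_exposedAt (t := t) (ω := ω) (j + 1)
      linarith)
  rw [← avg_cls_fst] at hmain
  refine (avg_mono fun ω' hω' => ?_).trans hmain
  by_cases h : Deep t ω' v j
  · rw [if_pos h, if_pos]
    intro y hy
    rw [hK, Finset.mem_filter, Finset.mem_compl] at hy
    obtain ⟨hyD, rfl⟩ := hy
    rw [hO, Finset.mem_filter]
    refine ⟨Finset.mem_univ _, ?_⟩
    by_cases hyy : (ω'.1.1 y).1 = y.1
    · rw [hyy]; exact hv
    rw [← outer_eq_of_mem_cls hω']
    refine h.2 _ (mem_nbrs.2 ⟨Ne.symm hyy, y.2, (ω'.1.1 y).2, rfl⟩) fun hpast => hyD ?_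
    rw [past_eq_of_mem_cls hω'] at hpast
    have hf : ω'.1 ∈ fib D ω.1 := (Finset.mem_product.1 hω').1
    have hD' := (closed_exposedAt ω.1 (past t ω (j + 1))).of_mem_fib hf
    refine hD'.apply_mem_iff.1 ?_
    simp [exposedAt, hpast]
  · rw [if_neg h]; split_ifs <;> norm_num

open Classical in
/-- The probability that a given node is too deep. -/
theorem sum_deep_le (hd : 0 < d) (j : ℕ) (v : Fin n) {X s : ℝ} (hX : 0 < X) (hX1 : X ≤ 1)
    (hs : s * X + 1 ≤ X ^ 2 * (n - 2 * fullPast d p (j + 1) - 2))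
    (hj : 4 * fullPast d p j ≤ n) :
    ∑ ω : Pairing n d × Selection n p,
      (if Deep t ω v j ∧ ((outer t ω j).card : ℝ) ≤ s then (1 : ℝ) else 0) ≤
    X ^ d * Real.exp ((X⁻¹ - 1) * (2 * d / n) * fullPast d p j) *
      Fintype.card (Pairing n d × Selection n p) := by
  have hstep : ∀ ω : Pairing n d × Selection n p, avg (cls t ω (j + 1)) (fun ω' =>
      if Deep t ω' v j ∧ ((outer t ω' j).card : ℝ) ≤ s then (1 : ℝ) else 0) ≤
      X ^ d * (if Disjoint {v} (past t ω j) then X⁻¹ ^ backDeg t ω {v} j else 0) := by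
    intro ω
    by_cases h : v ∈ outer t ω j ∧ ((outer t ω j).card : ℝ) ≤ s
    · have hv' := mem_outer.1 h.1
      have hvj : v ∉ past t ω j := fun h' => hv'.1 (past_mono (Nat.le_succ j) h')
      have hdis : Disjoint {v} (past t ω j) := by simpa using hvj
      rw [if_pos hdis]
      have hs' : ((outer t ω j).card : ℝ) * X + 1 ≤ X ^ 2 * (n - 2 * fullPast d p (j + 1) - 2) :=
        le_trans (by linarith [mul_le_mul_of_nonneg_right h.2 hX.le]) hs
      refine (avg_mono fun ω' _ => ?_).trans ((avg_cls_deep_le j v hX hs' h.1).trans (le_of_eq ?_))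
      · by_cases h1 : Deep t ω' v j
        · rw [if_pos h1]; split_ifs <;> norm_num
        · rw [if_neg h1, if_neg fun h2 => h1 h2.1]
      · have hk := freeDeg_add_backDeg hdis
        rw [inv_pow, pow_sub₀ _ hX.ne' (by omega)]
    · have h0 : avg (cls t ω (j + 1)) (fun ω' =>
          if Deep t ω' v j ∧ ((outer t ω' j).card : ℝ) ≤ s then (1 : ℝ) else 0) = 0 := by
        rw [avg_congr (g' := fun _ => 0) fun ω' hω' => if_neg ?_]
        · simp [avg]
        · rintro ⟨h1, h2⟩
          have h3 := h1.1
          rw [outer_eq_of_mem_cls hω'] at h2 h3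
          exact h ⟨h3, h2⟩
      rw [h0]
      split_ifs <;> positivity
  refine (sum_le_of_avg_cls t (j + 1) hstep).trans ?_
  rw [← Finset.mul_sum, mul_assoc]
  apply mul_le_mul_of_nonneg_left _ (by positivity)
  have := sum_pow_backDeg_le (t := t) (d := d) (p := p) ((one_le_inv₀ hX).2 hX1) hd {v} j hj
  rwa [Finset.card_singleton, Nat.cast_one, mul_one] at this

end Outer

section Routes

variable {V : Type} {next : V → Finset V} {t : V}

/-- All routes from `u` to `t` have length `m`, and there is one. -/
def ExactHops (next : V → Finset V) (t u : V) (m : ℕ) : Prop :=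
  {m' | Route next t u m'} = {m}

theorem ExactHops.eq {u : V} {m m' : ℕ} (h : ExactHops next t u m) (h' : ExactHops next t u m') :
    m = m' := Set.singleton_eq_singleton_iff.1 (h.symm.trans h')

theorem exactHops_self (h : next t = ∅) : ExactHops next t t 0 := by
  ext m
  simp only [Set.mem_singleton_iff]
  constructor
  · intro hr
    rcases hr with _ | ⟨hv, _⟩
    · rfl
    · simp [h] at hv
  · rintro rfl
    exact Route.arrived

theorem ExactHops.step {u : V} {m : ℕ} (hu : u ≠ t) (hne : (next u).Nonempty)
    (h : ∀ v ∈ next u, ExactHops next t v m) : ExactHops next t u (m + 1) := by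
  have hR : ∀ v ∈ next u, ∀ m', Route next t v m' ↔ m' = m := fun v hv m' =>
    Set.ext_iff.1 (h v hv) m'
  ext m'
  simp only [Set.mem_singleton_iff]
  constructor
  · intro hr
    rcases hr with _ | ⟨hv, hr⟩
    · exact absurd rfl hu
    · rw [(hR _ hv _).1 hr]
  · rintro rfl
    obtain ⟨v, hv⟩ := hne
    exact Route.hop hv ((hR v hv m).2 rfl)

theorem ExactHops.eq_target {u : V} (h : ExactHops next t u 0) : u = t := by
  have : Route next t u 0 := by
    change 0 ∈ {m' | Route next t u m'}
    rw [h]; rfl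
  rcases this with _ | _
  rfl

end Routes

section Outcomes

variable {n d p h : ℕ} (ω : Outcome n d p h) (t : Fin n)

/-- The graph and the selection of waypoints. -/
abbrev Outcome.base : Pairing n d × Selection n p := (ω.1, ω.2.1)

theorem mem_innerRing_iff {l : ℕ} {v : Fin n} : v ∈ innerRing (graph ω.1) ω.2.1 t l ↔
    v ∉ past t ω.base (l + 2) ∧ v ∉ outer t ω.base (l + 1) := by
  rw [mem_outer, innerRing]
  change (v ∉ past t ω.base (l + 2) ∧ ∃ u ∈ lv t ω.base (l + 1), (graph ω.1).Adj u v) ↔ _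
  simp only [not_and, Finset.not_disjoint_iff]
  refine and_congr_right fun hv => ?_
  constructor
  · rintro ⟨u, hu, huv⟩ _
    exact ⟨u, mem_nbrs.2 huv.symm, hu⟩
  · intro hx
    obtain ⟨u, hu, hu'⟩ := hx hv
    exact ⟨u, hu', (mem_nbrs.1 hu).symm⟩

theorem mem_outerRing_iff {l : ℕ} {v : Fin n} : v ∈ outerRing (graph ω.1) ω.2.1 t l ↔
    v ∈ outer t ω.base (l + 1) := by
  rw [outerRing]
  change (v ∉ past t ω.base (l + 2) ∧ v ∉ innerRing (graph ω.1) ω.2.1 t l) ↔ _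
  rw [mem_innerRing_iff]
  constructor
  · rintro ⟨h1, h2⟩
    by_contra h3
    exact h2 ⟨h1, h3⟩
  · intro h
    exact ⟨(mem_outer.1 h).1, fun h' => h'.2 h⟩

variable {t} in
theorem not_mem_lv_of_mem {ω' : Pairing n d × Selection n p} {i j : ℕ} {u : Fin n} (hij : i ≠ j)
    (hi : u ∈ lv t ω' i) : u ∉ lv t ω' j := by
  intro hj
  rcases lt_or_gt_of_ne hij with hlt | hlt
  · exact Finset.disjoint_left.1 (disjoint_past_lv t ω' j) (lv_subset_past hlt hi) hj
  · exact Finset.disjoint_left.1 (disjoint_past_lv t ω' i) (lv_subset_past hlt hj) hi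

variable {ω t}

theorem mem_eligible {l : ℕ} {u v : Fin n} : v ∈ eligible (graph ω.1) ω.2.1 t l u ↔
    (graph ω.1).Adj u v ∧
    ((∃ j ≤ l, u ∈ lv t ω.base (j + 1) ∧ v ∈ lv t ω.base j) ∨
     (u ∈ innerRing (graph ω.1) ω.2.1 t l ∧ v ∈ lv t ω.base (l + 1)) ∨
     (u ∈ outerRing (graph ω.1) ω.2.1 t l ∧ distInner (graph ω.1) ω.2.1 t l v ≠ ⊤ ∧
        ∀ w, (graph ω.1).Adj u w →
          distInner (graph ω.1) ω.2.1 t l v ≤ distInner (graph ω.1) ω.2.1 t l w)) := by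
  simp only [eligible, Finset.mem_filter, Finset.mem_univ, true_and]
  refine and_congr_right fun _ => ?_
  rw [← or_assoc]
  refine or_congr_left ?_
  constructor
  · rintro (⟨hu, rfl⟩ | ⟨j, hj, hu, hv⟩)
    · exact ⟨0, Nat.zero_le _, hu, Finset.mem_singleton_self _⟩
    · exact ⟨j + 1, hj, hu, hv⟩
  · rintro ⟨_ | j, hj, hu, hv⟩
    · exact Or.inl ⟨hu, Finset.mem_singleton.1 hv⟩
    · exact Or.inr ⟨j, hj, hu, hv⟩

theorem exists_adj_lv {j : ℕ} {u : Fin n} (hu : u ∈ lv t ω.base (j + 1)) :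
    ∃ v ∈ lv t ω.base j, (graph ω.1).Adj u v := by
  cases j with
  | zero => exact ⟨t, Finset.mem_singleton_self _, (mem_nbrs.1 hu).symm⟩
  | succ j =>
    rw [lv_succ_succ, Finset.mem_biUnion] at hu
    obtain ⟨w, hw, huw⟩ := hu
    have := choice_subset _ _ _ huw
    exact ⟨w, hw, (mem_nbrs.1 (Finset.mem_sdiff.1 this).1).symm⟩

theorem nextHops_subset (u : Fin n) :
    nextHops ω t u ⊆ eligible (graph ω.1) ω.2.1 t (numLevels n d p) u :=
  choice_subset _ _ _

theorem nextHops_nonempty (hh : 1 ≤ h) {u : Fin n}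
    (hu : (eligible (graph ω.1) ω.2.1 t (numLevels n d p) u).Nonempty) :
    (nextHops ω t u).Nonempty := by
  rw [← Finset.card_pos, nextHops, card_choice]
  exact lt_min hh hu.card_pos

theorem not_mem_rings {l j : ℕ} {u : Fin n} (hj : j ≤ l + 1) (hu : u ∈ lv t ω.base j) :
    u ∉ innerRing (graph ω.1) ω.2.1 t l ∧ u ∉ outerRing (graph ω.1) ω.2.1 t l := by
  have : u ∈ past t ω.base (l + 2) := lv_subset_past (by omega) hu
  rw [mem_innerRing_iff, mem_outerRing_iff, mem_outer]
  exact ⟨fun h' => h'.1 this, fun h' => h'.1 this⟩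

theorem exactHops_lv (hh : 1 ≤ h) {j : ℕ} (hj : j ≤ numLevels n d p + 1) {u : Fin n}
    (hu : u ∈ lv t ω.base j) : ExactHops (nextHops ω t) t u j := by
  induction j generalizing u with
  | zero =>
    obtain rfl := Finset.mem_singleton.1 hu
    apply exactHops_self
    rw [← Finset.subset_empty]
    refine (nextHops_subset u).trans fun v hv => ?_
    exfalso
    rw [mem_eligible] at hv
    obtain ⟨_, ⟨i, _, hi, _⟩ | hi | hi⟩ := hv
    · exact not_mem_lv_of_mem (Nat.succ_ne_zero i).symm hu hi
    · exact (not_mem_rings (Nat.zero_le _) hu).1 hi.1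
    · exact (not_mem_rings (Nat.zero_le _) hu).2 hi.1
  | succ j ih =>
    refine ExactHops.step ?_ (nextHops_nonempty hh ?_) fun v hv => ih (by omega) ?_
    · rintro rfl
      exact not_mem_lv_of_mem (Nat.succ_ne_zero j) hu (Finset.mem_singleton_self u)
    · obtain ⟨v, hv, hadj⟩ := exists_adj_lv hu
      exact ⟨v, mem_eligible.2 ⟨hadj, Or.inl ⟨j, by omega, hu, hv⟩⟩⟩
    · have := mem_eligible.1 (nextHops_subset u hv)
      obtain ⟨_, ⟨i, _, hi, hvi⟩ | hi | hi⟩ := this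
      · have : i + 1 = j + 1 := by
          by_contra hne
          exact not_mem_lv_of_mem hne hi hu
        obtain rfl : i = j := by omega
        exact hvi
      · exact absurd hi.1 (not_mem_rings hj hu).1
      · exact absurd hi.1 (not_mem_rings hj hu).2

theorem exactHops_innerRing (hh : 1 ≤ h) {u : Fin n}
    (hu : u ∈ innerRing (graph ω.1) ω.2.1 t (numLevels n d p)) :
    ExactHops (nextHops ω t) t u (numLevels n d p + 2) := by
  refine ExactHops.step ?_ (nextHops_nonempty hh ?_) fun v hv => exactHops_lv hh le_rfl ?_
  · rintro rfl
    exact (not_mem_rings (ω := ω) (Nat.zero_le _) (Finset.mem_singleton_self u)).1 hu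
  · obtain ⟨v, hv, hadj⟩ := hu.2
    exact ⟨v, mem_eligible.2 ⟨hadj.symm, Or.inr (Or.inl ⟨hu, hv⟩)⟩⟩
  · have := mem_eligible.1 (nextHops_subset u hv)
    obtain ⟨_, ⟨i, hil, hi, _⟩ | hi | hi⟩ := this
    · exact absurd hu (not_mem_rings (by omega) hi).1
    · exact hi.2
    · exact absurd hu hi.1.2

theorem distInner_of_mem {l : ℕ} {w : Fin n} (hw : w ∈ innerRing (graph ω.1) ω.2.1 t l) :
    distInner (graph ω.1) ω.2.1 t l w = 0 := by
  apply nonpos_iff_eq_zero.1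
  refine (iInf₂_le w hw).trans ?_
  simp

theorem mem_innerRing_of_distInner {l : ℕ} {v : Fin n}
    (hv : distInner (graph ω.1) ω.2.1 t l v = 0) : v ∈ innerRing (graph ω.1) ω.2.1 t l := by
  have h1 : distInner (graph ω.1) ω.2.1 t l v < 1 := by rw [hv]; exact zero_lt_one
  simp only [distInner, iInf_lt_iff] at h1
  obtain ⟨w, hw, h2⟩ := h1
  have h3 : (graph ω.1).edist v w = 0 := by simpa [Order.lt_one_iff] using h2
  rw [SimpleGraph.edist_eq_zero_iff] at h3
  rwa [h3]

theorem exactHops_outerRing (hh : 1 ≤ h) {u w : Fin n}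
    (hu : u ∈ outerRing (graph ω.1) ω.2.1 t (numLevels n d p))
    (hw : w ∈ innerRing (graph ω.1) ω.2.1 t (numLevels n d p)) (huw : (graph ω.1).Adj u w) :
    ExactHops (nextHops ω t) t u (numLevels n d p + 3) := by
  have hdw := distInner_of_mem hw
  refine ExactHops.step ?_ (nextHops_nonempty hh ?_) fun v hv => exactHops_innerRing hh ?_
  · rintro rfl
    exact (not_mem_rings (Nat.zero_le _) (Finset.mem_singleton_self u)).2 hu
  · refine ⟨w, mem_eligible.2 ⟨huw, Or.inr (Or.inr ⟨hu, ?_, fun x _ => ?_⟩)⟩⟩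
    · rw [hdw]; exact ENat.zero_ne_top
    · rw [hdw]; exact zero_le
  · have := mem_eligible.1 (nextHops_subset u hv)
    obtain ⟨_, ⟨i, hil, hi, _⟩ | hi | hi⟩ := this
    · exact absurd hu (not_mem_rings (by omega) hi).2
    · exact absurd hi.1 hu.2
    · apply mem_innerRing_of_distInner
      have := hi.2.2 w huw
      rw [hdw] at this
      exact nonpos_iff_eq_zero.1 this

theorem hasLength_succ_iff {e : HalfEdge n d} {i : ℕ} : HasLength ω t e (i + 1) ↔
    ExactHops (nextHops ω t) t (ω.1.1 e).1 i := by
  rw [HasLength, pathLengths, ExactHops]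
  constructor
  · intro h
    ext m
    have := Set.ext_iff.1 h (m + 1)
    simpa using this
  · intro h
    ext m
    constructor
    · rintro ⟨m', hm', rfl⟩
      have : m' ∈ ({i} : Set ℕ) := h ▸ hm'
      rw [Set.mem_singleton_iff.1 this]; rfl
    · intro hm
      obtain rfl := Set.mem_singleton_iff.1 hm
      refine ⟨i, ?_, rfl⟩
      have : i ∈ {m' | Route (nextHops ω t) t (ω.1.1 e).1 m'} := by rw [h]; rfl
      exact this

theorem ncard_partner_mem (f : Pairing n d) (S : Finset (Fin n)) :
    {e : HalfEdge n d | (f.1 e).1 ∈ S}.ncard = S.card * d := by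
  have h1 : {e : HalfEdge n d | (f.1 e).1 ∈ S} =
      f.1 ⁻¹' ((Finset.univ.filter fun e : HalfEdge n d => e.1 ∈ S : Finset _) : Set _) := by
    ext e; simp
  rw [h1, Set.ncard_preimage_of_injective_subset_range f.1.injective (by simp),
    Set.ncard_coe_finset, card_filter_fst_mem]

theorem pathCount_one (hh : 1 ≤ h) : pathCount ω t 1 = d := by
  have : {e : HalfEdge n d | HasLength ω t e 1} =
      {e : HalfEdge n d | (ω.1.1 e).1 ∈ ({t} : Finset (Fin n))} := by
    ext e
    change HasLength ω t e (0 + 1) ↔ _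
    rw [hasLength_succ_iff]
    exact ⟨fun h' => Finset.mem_singleton.2 h'.eq_target,
      fun h' => exactHops_lv hh (Nat.zero_le _) h'⟩
  rw [pathCount, this, ncard_partner_mem, Finset.card_singleton, one_mul]

theorem mem_lv_or_rings (l : ℕ) (u : Fin n) : (∃ j ≤ l + 1, u ∈ lv t ω.base j) ∨
    u ∈ innerRing (graph ω.1) ω.2.1 t l ∨ u ∈ outerRing (graph ω.1) ω.2.1 t l := by
  have key : ∀ m, u ∈ past t ω.base m → ∃ j < m, u ∈ lv t ω.base j := by
    intro m
    induction m with
    | zero => intro h'; simp [past] at h'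
    | succ m ih =>
      intro h'
      rw [past_succ, Finset.mem_union] at h'
      rcases h' with h' | h'
      · obtain ⟨j, hj, hu⟩ := ih h'
        exact ⟨j, by omega, hu⟩
      · exact ⟨m, by omega, h'⟩
  by_cases h1 : u ∈ past t ω.base (l + 2)
  · obtain ⟨j, hj, hu⟩ := key _ h1
    exact Or.inl ⟨j, by omega, hu⟩
  · right
    rw [mem_innerRing_iff, mem_outerRing_iff]
    by_cases h2 : u ∈ outer t ω.base (l + 1)
    · exact Or.inr h2
    · exact Or.inl ⟨h1, h2⟩

theorem pathCount_outer_le (hh : 1 ≤ h) : pathCount ω t (numLevels n d p + 4) ≤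
    (outer t ω.base (numLevels n d p + 1)).card * d := by
  rw [← ncard_partner_mem ω.1]
  apply Set.ncard_le_ncard _ (Set.toFinite _)
  intro e he
  have h1 := hasLength_succ_iff.1 he
  rcases mem_lv_or_rings (ω := ω) (t := t) (numLevels n d p) (ω.1.1 e).1 with ⟨j, hj, hu⟩ | hu | hu
  · have := h1.eq (exactHops_lv hh hj hu); omega
  · have := h1.eq (exactHops_innerRing hh hu); omega
  · exact (mem_outerRing_iff ω t).1 hu

theorem exists_innerRing_nbr (hdeep : ∀ v, ¬ Deep t ω.base v (numLevels n d p + 1)) {u : Fin n}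
    (hu : u ∈ outerRing (graph ω.1) ω.2.1 t (numLevels n d p)) :
    ∃ w ∈ innerRing (graph ω.1) ω.2.1 t (numLevels n d p), (graph ω.1).Adj u w := by
  have h1 := hdeep u
  rw [Deep, ← mem_outerRing_iff, not_and] at h1
  have h2 := h1 hu
  push Not at h2
  obtain ⟨w, hw, hw1, hw2⟩ := h2
  exact ⟨w, (mem_innerRing_iff ω t).2 ⟨hw1, hw2⟩, mem_nbrs.1 hw⟩

theorem pathCount_lv (hh : 1 ≤ h) (hdeep : ∀ v, ¬ Deep t ω.base v (numLevels n d p + 1)) {j : ℕ}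
    (hj : j ≤ numLevels n d p + 1) :
    pathCount ω t (j + 1) = (lv t ω.base j).card * d := by
  rw [← ncard_partner_mem ω.1, pathCount]
  congr 1
  ext e
  refine hasLength_succ_iff.trans ⟨fun h1 => ?_, fun h1 => exactHops_lv hh hj h1⟩
  rcases mem_lv_or_rings (ω := ω) (t := t) (numLevels n d p) (ω.1.1 e).1 with ⟨i, hi, hu⟩ | hu | hu
  · have := h1.eq (exactHops_lv hh hi hu)
    rw [this]; exact hu
  · have := h1.eq (exactHops_innerRing hh hu); omega
  · obtain ⟨w, hw, hadj⟩ := exists_innerRing_nbr hdeep hu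
    have := h1.eq (exactHops_outerRing hh hu hw hadj); omega

theorem hasLength_inner (hh : 1 ≤ h) (hdeep : ∀ v, ¬ Deep t ω.base v (numLevels n d p + 1))
    (e : HalfEdge n d) (h1 : ∀ i, 1 ≤ i → i ≤ numLevels n d p + 2 → ¬ HasLength ω t e i)
    (h2 : ¬ HasLength ω t e (numLevels n d p + 4)) : HasLength ω t e (numLevels n d p + 3) := by
  rcases mem_lv_or_rings (ω := ω) (t := t) (numLevels n d p) (ω.1.1 e).1 with ⟨i, hi, hu⟩ | hu | hu
  · exact absurd (hasLength_succ_iff.2 (exactHops_lv hh hi hu)) (h1 _ (by omega) (by omega))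
  · exact hasLength_succ_iff.2 (exactHops_innerRing hh hu)
  · obtain ⟨w, hw, hadj⟩ := exists_innerRing_nbr hdeep hu
    exact absurd (hasLength_succ_iff.2 (exactHops_outerRing hh hu hw hadj)) h2

end Outcomes

section Prob

variable {Ω : Type}

theorem prob_nonneg (E : Set Ω) : 0 ≤ prob E := by unfold prob; positivity

theorem prob_mono [Finite Ω] {E E' : Set Ω} (h : E ⊆ E') : prob E ≤ prob E' := by
  unfold prob
  gcongr
  exact Set.toFinite _

theorem prob_union_le [Finite Ω] (E E' : Set Ω) : prob (E ∪ E') ≤ prob E + prob E' := by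
  unfold prob
  rw [← add_div]
  gcongr
  exact_mod_cast Set.ncard_union_le E E'

theorem prob_add_prob_compl [Finite Ω] [Nonempty Ω] (E : Set Ω) : prob E + prob Eᶜ = 1 := by
  have h : (Nat.card Ω : ℝ) ≠ 0 := by exact_mod_cast Nat.card_pos.ne'
  unfold prob
  rw [← add_div, div_eq_one_iff_eq h]
  exact_mod_cast Set.ncard_add_ncard_compl E

theorem prob_le_one [Finite Ω] [Nonempty Ω] (E : Set Ω) : prob E ≤ 1 := by
  have := prob_add_prob_compl E
  have := prob_nonneg Eᶜ
  linarith

theorem prob_le_of_sum_le [Fintype Ω] [Nonempty Ω] {E : Set Ω} [DecidablePred (· ∈ E)] {b : ℝ}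
    (h : ∑ ω, (if ω ∈ E then (1 : ℝ) else 0) ≤ b * Fintype.card Ω) : prob E ≤ b := by
  have h0 : (0 : ℝ) < Fintype.card Ω := by exact_mod_cast Fintype.card_pos
  rw [prob, Nat.card_eq_fintype_card, div_le_iff₀ h0]
  refine le_trans (le_of_eq ?_) h
  rw [← Finset.sum_filter, Finset.sum_const, nsmul_eq_mul, mul_one, ← Set.ncard_coe_finset]
  congr 2
  ext; simp

/-- A variable whose mean is close to its maximum is close to the maximum with high probability. -/
theorem prob_lt_le [Fintype Ω] [Nonempty Ω] {g : Ω → ℝ} {F x η : ℝ} (hF : 0 < F) (hη : 0 < η)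
    (hg : ∀ ω, g ω ≤ F) (hmean : F * (1 - x) * Fintype.card Ω ≤ ∑ ω, g ω) :
    prob {ω | g ω < (1 - η) * F} ≤ x / η := by
  classical
  apply prob_le_of_sum_le
  have h1 : ∀ ω, (if ω ∈ {ω | g ω < (1 - η) * F} then (1 : ℝ) else 0) ≤
      (F - g ω) / (η * F) := by
    intro ω
    have h0 : 0 < η * F := mul_pos hη hF
    split_ifs with h
    · rw [le_div_iff₀ h0]
      have : g ω < (1 - η) * F := h
      linarith
    · exact div_nonneg (sub_nonneg.2 (hg ω)) h0.le
  refine (Finset.sum_le_sum fun ω _ => h1 ω).trans ?_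
  rw [← Finset.sum_div, div_le_iff₀ (mul_pos hη hF), Finset.sum_sub_distrib, Finset.sum_const,
    nsmul_eq_mul, Finset.card_univ]
  have : x / η * Fintype.card Ω * (η * F) = x * Fintype.card Ω * F := by
    field_simp
  rw [this]
  linarith

/-- A tail bound from the probabilities that a random set contains given sets. -/
theorem prob_card_le {ν : Type} [Fintype ν] [Fintype Ω] [Nonempty Ω] (S : Ω → Finset ν)
    (good : Set Ω) (r : ℕ) {B s : ℝ} (hB0 : 0 ≤ B) (hs : 0 < s + 1 - r)
    (hB : ∀ V : Finset ν, V.card = r → prob {ω | V ⊆ S ω ∧ ω ∈ good} ≤ B) :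
    prob {ω | s ≤ ((S ω).card : ℝ) ∧ ω ∈ good} ≤
      (Fintype.card ν : ℝ) ^ r * B / (s + 1 - r) ^ r := by
  classical
  have hM : (0 : ℝ) < Fintype.card Ω := by exact_mod_cast Fintype.card_pos
  have hsr : 0 < (s + 1 - r) ^ r := pow_pos hs r
  have hB' : ∀ V ∈ Finset.powersetCard r (Finset.univ : Finset ν),
      ∑ ω, (if V ⊆ S ω ∧ ω ∈ good then (1 : ℝ) else 0) ≤ B * Fintype.card Ω := by
    intro V hV
    have h1 := hB V (Finset.mem_powersetCard.1 hV).2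
    rw [prob, Nat.card_eq_fintype_card, div_le_iff₀ hM] at h1
    refine le_trans (le_of_eq ?_) h1
    rw [← Finset.sum_filter, Finset.sum_const, nsmul_eq_mul, mul_one, ← Set.ncard_coe_finset]
    congr 2
    ext; simp
  apply prob_le_of_sum_le
  rw [div_mul_eq_mul_div, le_div_iff₀ hsr, Finset.sum_mul]
  have hpt : ∀ ω, (if ω ∈ {ω | s ≤ ((S ω).card : ℝ) ∧ ω ∈ good} then (1 : ℝ) else 0) *
      (s + 1 - r) ^ r ≤ r.factorial *
        ∑ V ∈ Finset.powersetCard r (Finset.univ : Finset ν),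
          (if V ⊆ S ω ∧ ω ∈ good then (1 : ℝ) else 0) := by
    intro ω
    by_cases h : s ≤ ((S ω).card : ℝ) ∧ ω ∈ good
    · rw [if_pos (by exact h), one_mul, ← Finset.sum_filter, Finset.sum_const, nsmul_eq_mul, mul_one]
      have h1 : (Finset.powersetCard r (Finset.univ : Finset ν)).filter
          (fun V => V ⊆ S ω ∧ ω ∈ good) = Finset.powersetCard r (S ω) := by
        ext V
        simp only [Finset.mem_filter, Finset.mem_powersetCard, Finset.subset_univ, true_and, h.2,
          and_true]
        exact and_comm
      rw [h1, Finset.card_powersetCard]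
      have h2 := Nat.pow_sub_le_descFactorial (S ω).card r
      rw [Nat.descFactorial_eq_factorial_mul_choose] at h2
      have hlt : r ≤ (S ω).card + 1 := by
        have : (r : ℝ) ≤ (((S ω).card + 1 : ℕ) : ℝ) := by push_cast; linarith [h.1]
        exact_mod_cast this
      have h3 : (s + 1 - r) ^ r ≤ (((S ω).card + 1 - r : ℕ) : ℝ) ^ r := by
        apply pow_le_pow_left₀ hs.le
        rw [Nat.cast_sub hlt]; push_cast; linarith [h.1]
      refine h3.trans ?_
      exact_mod_cast h2
    · rw [if_neg (by exact h), zero_mul]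
      positivity
  refine (Finset.sum_le_sum fun ω _ => hpt ω).trans ?_
  rw [← Finset.mul_sum, Finset.sum_comm]
  refine (mul_le_mul_of_nonneg_left (Finset.sum_le_sum hB') (Nat.cast_nonneg _)).trans ?_
  rw [Finset.sum_const, Finset.card_powersetCard, Finset.card_univ, nsmul_eq_mul, ← mul_assoc,
    mul_assoc _ B]
  apply mul_le_mul_of_nonneg_right _ (mul_nonneg hB0 hM.le)
  have := Nat.descFactorial_le_pow (Fintype.card ν) r
  rw [Nat.descFactorial_eq_factorial_mul_choose] at this
  exact_mod_cast this

theorem prob_preimage_of_surjective_fst {Ω₁ Ω₂ Ω₃ : Type} [Finite Ω₁] [Finite Ω₂] [Finite Ω₃]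
    [Nonempty Ω₃] (E : Set (Ω₁ × Ω₂)) :
    prob {ω : Ω₁ × Ω₂ × Ω₃ | (ω.1, ω.2.1) ∈ E} = prob E := by
  have h1 : {ω : Ω₁ × Ω₂ × Ω₃ | (ω.1, ω.2.1) ∈ E} =
      (Equiv.prodAssoc Ω₁ Ω₂ Ω₃) '' (E ×ˢ Set.univ) := by
    ext ω
    constructor
    · intro h
      exact ⟨((ω.1, ω.2.1), ω.2.2), ⟨h, trivial⟩, rfl⟩
    · rintro ⟨⟨x, y⟩, ⟨hx, _⟩, rfl⟩
      exact hx
  have h3 : (Nat.card Ω₃ : ℝ) ≠ 0 := by exact_mod_cast Nat.card_pos.ne'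
  unfold prob
  rw [h1, Set.ncard_image_of_injective _ (Equiv.injective _), Set.ncard_prod, Set.ncard_univ,
    Nat.card_prod, Nat.card_prod, Nat.card_prod, ← mul_assoc]
  push_cast
  rw [mul_div_mul_right _ _ h3]

end Prob

theorem nonempty_pairing {n d : ℕ} (h : Even (n * d)) : Nonempty (Pairing n d) := by
  obtain ⟨m, hm⟩ := h
  have e : HalfEdge n d ≃ Fin m × Bool := Fintype.equivOfCardEq (by simp [hm, mul_two])
  let g : Equiv.Perm (Fin m × Bool) := Equiv.prodCongr (Equiv.refl _) Equiv.boolNot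
  have hg : ∀ y, g (g y) = y := by
    rintro ⟨i, b⟩
    simp [g]
  refine ⟨⟨(e.trans g).trans e.symm, fun x => ⟨?_, fun hx => ?_⟩⟩⟩
  · simp [hg]
  · have h1 : g (e x) = e x := by
      apply e.symm.injective
      simpa using hx
    have h2 := congrArg Prod.snd h1
    simp [g] at h2

instance {n k : ℕ} : Nonempty (Selection n k) :=
  ⟨fun _ A => ⟨(Finset.powersetCard_nonempty.2 (min_le_right k A.card)).choose,
    (Finset.powersetCard_nonempty.2 (min_le_right k A.card)).choose_spec⟩⟩

section Bounds

variable {n d p : ℕ} {t : Fin n}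

theorem prob_card_lv_lt_le [Nonempty (Pairing n d)] (hd : 2 ≤ d) (hp : 2 ≤ p) (hpd : 4 * p ≤ d)
    (j : ℕ) (hj : 6000 * fullSize d p (j + 1) ≤ n) {η : ℝ} (hη : 0 < η) :
    prob {ω : Pairing n d × Selection n p |
      ((lv t ω (j + 1)).card : ℝ) < (1 - η) * fullSize d p (j + 1)} ≤
    (44 * fullSize d p (j + 1) / n + (j + 1) * (n * Real.exp (-(5 * d)))) / η := by
  have h1 : 1 ≤ fullSize d p (j + 1) := one_le_fullSize (by omega) (by omega) _
  refine prob_lt_le (by exact_mod_cast h1) hη (fun ω => by exact_mod_cast card_lv_le (j + 1)) ?_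
  have := le_sum_card_lv (t := t) hd hp hpd (j + 1) hj
  push_cast at this
  exact this

theorem prob_lvWeight_lt_le [Nonempty (Pairing n d)] (hd : 2 ≤ d) (hp : 2 ≤ p) (hpd : 4 * p ≤ d)
    (j : ℕ) (hj : 6000 * fullSize d p (j + 1) ≤ n) {η : ℝ} (hη : 0 < η) :
    prob {ω : Pairing n d × Selection n p |
      lvWeight t ω j < (1 - η) * fullSize d p (j + 1)} ≤
    (44 * fullSize d p j / n + (j + 1) * (n * Real.exp (-(5 * d)))) / η := by
  have h1 : 1 ≤ fullSize d p (j + 1) := one_le_fullSize (by omega) (by omega) _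
  have h2 : fullSize d p j ≤ fullSize d p (j + 1) :=
    fullSize_mono (by omega) (by omega) (Nat.le_succ j)
  exact prob_lt_le (by exact_mod_cast h1) hη
    (fun ω => lvWeight_le_fullSize (by omega) (by omega) j)
    (le_sum_lvWeight_mean (t := t) hd hp hpd j (by omega))

theorem prob_le_card_outer_le [Nonempty (Pairing n d)] (hd : 2 ≤ d) (hp : 2 ≤ p) (hpd : 4 * p ≤ d)
    {j : ℕ} (hj : 1 ≤ j) (hj' : 6000 * fullSize d p (j + 1) ≤ n) (r : ℕ)
    (hr : 12 * (r + 2) * fullSize d p (j + 1) ≤ n) {δ s : ℝ} (hδ0 : 0 < δ) (hδ1 : δ ≤ 1)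
    (hs : 0 < s + 1 - r) :
    prob {ω : Pairing n d × Selection n p | s ≤ ((outer t ω (j + 1)).card : ℝ)} ≤
    (44 * fullSize d p j / n + (j + 1) * (n * Real.exp (-(5 * d)))) / δ +
      (n * Real.exp (-(fullSize d p (j + 1) * d / n)) / (s + 1 - r)) ^ r *
      Real.exp (r * (fullSize d p (j + 1) * d / n * δ + fullSize d p (j + 1) / n +
      60 * (r + 1) ^ 2 * (fullSize d p (j + 1) * d / n * (fullSize d p j / n)))) := by
  classical
  set good : Set (Pairing n d × Selection n p) :=
    {ω | (1 - δ) * fullSize d p (j + 1) ≤ lvWeight t ω j} with hgood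
  have h1 : {ω : Pairing n d × Selection n p | s ≤ ((outer t ω (j + 1)).card : ℝ)} ⊆
      {ω : Pairing n d × Selection n p | lvWeight t ω j < (1 - δ) * fullSize d p (j + 1)} ∪
      {ω | s ≤ ((outer t ω (j + 1)).card : ℝ) ∧ ω ∈ good} := by
    intro ω hω
    rcases lt_or_ge (lvWeight t ω j) ((1 - δ) * fullSize d p (j + 1)) with h | h
    · exact Or.inl h
    · exact Or.inr ⟨hω, h⟩
  refine (prob_mono h1).trans ((prob_union_le _ _).trans (add_le_add
    (prob_lvWeight_lt_le hd hp hpd j hj' hδ0) ?_))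
  refine (prob_card_le (fun ω => outer t ω (j + 1)) good r (B := Real.exp (r *
    (-(fullSize d p (j + 1) * d / n) + fullSize d p (j + 1) * d / n * δ +
      fullSize d p (j + 1) / n +
      60 * (r + 1) ^ 2 * (fullSize d p (j + 1) * d / n * (fullSize d p j / n)))))
    (Real.exp_pos _).le hs fun V hV => ?_).trans (le_of_eq ?_)
  · apply prob_le_of_sum_le
    have h2 := sum_avoids_le_exp (t := t) hd hp (by omega) hj V hδ0.le hδ1 (by rw [hV]; exact hr)
    rw [hV] at h2
    refine le_trans (Finset.sum_le_sum fun ω _ => ?_) h2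
    by_cases h3 : V ⊆ outer t ω (j + 1) ∧ ω ∈ good
    · rw [if_pos (by exact h3), if_pos]
      refine ⟨⟨Finset.disjoint_left.2 fun v hv hv' => ?_, fun v hv => (mem_outer.1 (h3.1 hv)).2⟩,
        h3.2⟩
      exact (mem_outer.1 (h3.1 hv)).1 (past_mono (Nat.le_succ _) hv')
    · rw [if_neg (by exact h3)]
      split_ifs <;> norm_num
  · have hsplit : ∀ x y : ℝ, Real.exp (r * (-x + y)) = Real.exp (-x) ^ r * Real.exp (r * y) :=
      fun x y => by rw [← Real.exp_nat_mul, ← Real.exp_add]; ring_nf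
    rw [Fintype.card_fin, add_assoc, add_assoc, hsplit, div_pow, mul_pow, add_assoc]
    ring

theorem prob_exists_deep_le [Nonempty (Pairing n d)] (hd : 2 ≤ d) (hp : 2 ≤ p)
    (j : ℕ) (hj : 6000 * fullSize d p (j + 1) ≤ n) {X s : ℝ} (hX : 0 < X) (hX1 : X ≤ 1)
    (hs : s * X + 1 ≤ X ^ 2 * (n - 4 * fullSize d p (j + 1) - 2)) :
    prob {ω : Pairing n d × Selection n p |
      (∃ v, Deep t ω v (j + 1)) ∧ ((outer t ω (j + 1)).card : ℝ) ≤ s} ≤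
    n * (X ^ d * Real.exp (4 * X⁻¹ * d * (fullSize d p j / n))) := by
  classical
  have hn' : (0 : ℝ) < n := by exact_mod_cast t.pos
  have hP1 := fullPast_succ_le hd hp j
  have hP2 := fullPast_succ_le hd hp (j + 1)
  have h2 := two_mul_fullSize_le hd hp j
  apply prob_le_of_sum_le
  have hv : ∀ v ∈ (Finset.univ : Finset (Fin n)), ∑ ω : Pairing n d × Selection n p,
      (if Deep t ω v (j + 1) ∧ ((outer t ω (j + 1)).card : ℝ) ≤ s then (1 : ℝ) else 0) ≤
      X ^ d * Real.exp (4 * X⁻¹ * d * (fullSize d p j / n)) *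
        Fintype.card (Pairing n d × Selection n p) := by
    intro v _
    refine (sum_deep_le (t := t) (by omega) (j + 1) v hX hX1 (hs.trans ?_) (by omega)).trans ?_
    · apply mul_le_mul_of_nonneg_left _ (sq_nonneg X)
      have : (fullPast d p (j + 1 + 1) : ℝ) ≤ 2 * fullSize d p (j + 1) := by exact_mod_cast hP2
      linarith
    · apply mul_le_mul_of_nonneg_right _ (Nat.cast_nonneg _)
      apply mul_le_mul_of_nonneg_left _ (by positivity)
      apply Real.exp_le_exp.2
      have h3 : (fullPast d p (j + 1) : ℝ) ≤ 2 * fullSize d p j := by exact_mod_cast hP1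
      have h4 : X⁻¹ - 1 ≤ X⁻¹ := by linarith
      have h5 : 0 ≤ X⁻¹ - 1 := by linarith [(one_le_inv₀ hX).2 hX1]
      calc (X⁻¹ - 1) * (2 * d / n) * fullPast d p (j + 1)
          ≤ X⁻¹ * (2 * d / n) * (2 * fullSize d p j) := by gcongr
        _ = _ := by ring
  have hsum := Finset.sum_le_sum hv
  rw [Finset.sum_const, Finset.card_univ, Fintype.card_fin, nsmul_eq_mul, ← mul_assoc] at hsum
  refine le_trans ?_ hsum
  rw [Finset.sum_comm]
  apply Finset.sum_le_sum
  intro ω _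
  by_cases h : (∃ v, Deep t ω v (j + 1)) ∧ ((outer t ω (j + 1)).card : ℝ) ≤ s
  · rw [if_pos (by exact h)]
    obtain ⟨⟨v, hv'⟩, h3⟩ := h
    refine le_trans (le_of_eq ?_) (Finset.single_le_sum (f := fun v =>
      if Deep t ω v (j + 1) ∧ ((outer t ω (j + 1)).card : ℝ) ≤ s then (1 : ℝ) else 0)
      (fun v _ => ?_) (Finset.mem_univ v))
    · simp only [if_pos (And.intro hv' h3)]
    · split_ifs <;> norm_num
  · rw [if_neg (by exact h)]
    exact Finset.sum_nonneg fun v _ => by split_ifs <;> norm_num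

end Bounds

section Parameters

variable {n d p : ℕ}

theorem one_le_numLevels : 1 ≤ numLevels n d p := le_max_left _ _

theorem lam_eq : lam n d p = fullSize d p (numLevels n d p + 1) * d / n := by
  rw [lam, fullSize_succ]; push_cast; ring

theorem half_le_lam (hn : 0 < n) (hd : 0 < d) (hp : 2 ≤ p) : 1 / 2 ≤ lam n d p := by
  have hn' : (0 : ℝ) < n := by exact_mod_cast hn
  have hd' : (0 : ℝ) < d := by exact_mod_cast hd
  have hp' : (1 : ℝ) < p := by exact_mod_cast (by omega : 1 < p)
  have h1 : Real.logb p ((n : ℝ) / (2 * (d : ℝ) ^ 2)) ≤ numLevels n d p :=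
    (Nat.le_ceil _).trans (Nat.cast_le.2 (le_max_right _ _))
  rw [Real.logb_le_iff_le_rpow hp' (by positivity), Real.rpow_natCast,
    div_le_iff₀ (by positivity)] at h1
  rw [lam, div_le_div_iff₀ (by norm_num) hn']
  linarith

theorem lam_le_of_two_le_numLevels (hn : 0 < n) (hd : 0 < d) (hp : 2 ≤ p)
    (h : 2 ≤ numLevels n d p) : lam n d p ≤ p / 2 := by
  have hn' : (0 : ℝ) < n := by exact_mod_cast hn
  have hd' : (0 : ℝ) < d := by exact_mod_cast hd
  have hp' : (1 : ℝ) < p := by exact_mod_cast (by omega : 1 < p)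
  obtain ⟨m, hm⟩ : ∃ m, numLevels n d p = m + 2 := ⟨numLevels n d p - 2, by omega⟩
  have h1 : m + 2 ≤ ⌈Real.logb p ((n : ℝ) / (2 * (d : ℝ) ^ 2))⌉₊ := by
    rw [numLevels] at hm; omega
  have h2 : ((m + 1 : ℕ) : ℝ) < Real.logb p ((n : ℝ) / (2 * (d : ℝ) ^ 2)) :=
    Nat.lt_ceil.1 (by omega)
  rw [Real.lt_logb_iff_rpow_lt hp' (by positivity), Real.rpow_natCast,
    lt_div_iff₀ (by positivity)] at h2
  rw [lam, hm, div_le_div_iff₀ hn' (by norm_num), pow_succ]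
  nlinarith

theorem fullSize_div_mul {l : ℕ} (hl : 1 ≤ l) :
    (fullSize d p l / n : ℝ) * p = fullSize d p (l + 1) / n := by
  obtain ⟨m, rfl⟩ : ∃ m, l = m + 1 := ⟨l - 1, by omega⟩
  rw [fullSize_succ, fullSize_succ, pow_succ]; push_cast; ring

theorem lam_mul_le (hn : 0 < n) (hd : 0 < d) (hp : 2 ≤ p) :
    lam n d p * (fullSize d p (numLevels n d p) / n) ≤
      fullSize d p (numLevels n d p + 1) / n + √(lam n d p ^ 3 / n) := by
  have hn' : (0 : ℝ) < n := by exact_mod_cast hn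
  have hp' : (1 : ℝ) < p := by exact_mod_cast (by omega : 1 < p)
  rcases one_le_numLevels.eq_or_lt with h | h
  · rw [← h]
    refine le_trans ?_ (le_add_of_nonneg_left (by positivity))
    apply Real.le_sqrt_of_sq_le
    have h1 : lam n d p = p * d ^ 2 / n := by rw [lam, ← h, pow_one]
    have h2 : (fullSize d p 1 : ℝ) = d := by rw [fullSize_succ]; simp
    have h3 : 0 ≤ lam n d p := by unfold lam; positivity
    rw [h2, mul_pow, pow_succ (lam n d p) 2, mul_div_assoc]
    apply mul_le_mul_of_nonneg_left _ (sq_nonneg _)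
    rw [h1, div_pow, div_div, sq (n : ℝ)]
    gcongr
    nlinarith [sq_nonneg (d : ℝ)]
  · refine le_trans ?_ (le_add_of_nonneg_right (Real.sqrt_nonneg _))
    have h1 := lam_le_of_two_le_numLevels hn hd hp h
    rw [← fullSize_div_mul h.le, mul_comm _ (p : ℝ)]
    apply mul_le_mul_of_nonneg_right _ (by positivity)
    linarith

end Parameters

section Asymptotics

/-- The maximal size of the last waypoint level, relative to the number of nodes. -/
noncomputable def lastDensity (n d p : ℕ) : ℝ := fullSize d p (numLevels n d p + 1) / n

/-- The maximal size of the level before the last waypoint level, relative to the number of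
nodes. -/
noncomputable def prevDensity (n d p : ℕ) : ℝ := fullSize d p (numLevels n d p) / n

/-- A bound for the expected relative defect of the weight of the level before the last waypoint
level. -/
noncomputable def defect (n d p : ℕ) : ℝ :=
  44 * prevDensity n d p + (numLevels n d p + 1) * (n * Real.exp (-(5 * d)))

/-- The probability that there are at least `s` nodes in the outer ring. -/
noncomputable def outerProb (n d p : ℕ) (t : Fin n) (s : ℝ) : ℝ :=
  prob {ω : Pairing n d × Selection n p | s ≤ ((outer t ω (numLevels n d p + 1)).card : ℝ)}

section Fixed

variable {n d p : ℕ}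

theorem prevDensity_nonneg : 0 ≤ prevDensity n d p := by unfold prevDensity; positivity

theorem lam_nonneg : 0 ≤ lam n d p := by unfold lam; positivity

theorem two_mul_prevDensity_le (hd : 2 ≤ d) (hp : 2 ≤ p) :
    2 * prevDensity n d p ≤ lastDensity n d p := by
  unfold prevDensity lastDensity
  rw [mul_div_assoc']
  apply div_le_div_of_nonneg_right _ (Nat.cast_nonneg n)
  exact_mod_cast two_mul_fullSize_le hd hp _

theorem ten_le_of_log_le (hd : 2 * (Real.log n + 5) ≤ (d : ℝ)) : 10 ≤ d := by
  have h1 : 0 ≤ Real.log n := Real.log_natCast_nonneg n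
  have h2 : (10 : ℝ) ≤ d := by linarith
  exact_mod_cast h2

theorem collision_le (hn : 0 < n) (hd : 2 * (Real.log n + 5) ≤ (d : ℝ)) (hp : 2 ≤ p)
    (h : lastDensity n d p ≤ 1) :
    (numLevels n d p + 1) * (n * Real.exp (-(5 * d))) ≤ 1 / (n : ℝ) ^ 2 := by
  have hn' : (0 : ℝ) < n := by exact_mod_cast hn
  have hd10 := ten_le_of_log_le hd
  have h1 : numLevels n d p + 1 ≤ fullSize d p (numLevels n d p + 1) := by
    rw [fullSize_succ]
    calc numLevels n d p + 1 ≤ 2 ^ numLevels n d p := Nat.lt_two_pow_self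
      _ ≤ p ^ numLevels n d p := Nat.pow_le_pow_left hp _
      _ ≤ _ := Nat.le_mul_of_pos_right _ (by omega)
  have h2 : (numLevels n d p : ℝ) + 1 ≤ n := by
    rw [lastDensity, div_le_one hn'] at h
    refine le_trans ?_ h
    exact_mod_cast h1
  have h3 : Real.exp (-(5 * d)) ≤ ((n : ℝ) ^ 4)⁻¹ := by
    have h4 : ((n : ℝ) ^ 4)⁻¹ = Real.exp (-(4 * Real.log n)) := by
      rw [Real.exp_neg, mul_comm, Real.exp_mul, Real.exp_log hn']
      norm_cast
    rw [h4]
    apply Real.exp_le_exp.2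
    have : 0 ≤ Real.log n := Real.log_natCast_nonneg n
    linarith
  calc _ ≤ (n : ℝ) * (n * ((n : ℝ) ^ 4)⁻¹) := by gcongr
    _ = 1 / (n : ℝ) ^ 2 := by field_simp

end Fixed

/-- The assumptions on the parameters. -/
structure Growth (n d p : ℕ → ℕ) : Prop where
  tendsto_n : Tendsto n atTop atTop
  even : ∀ k, Even (n k * d k)
  log_le : ∀ k, 2 * (Real.log (n k) + 5) ≤ (d k : ℝ)
  two_le : ∀ k, 2 ≤ p k
  four_mul_le : ∀ k, 4 * p k ≤ d k
  size : Tendsto (fun k => (p k : ℝ) ^ numLevels (n k) (d k) (p k) * (d k : ℝ) / (n k : ℝ))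
    atTop (𝓝 0)

variable {n d p : ℕ → ℕ} {t : ∀ k, Fin (n k)} (hG : Growth n d p)

include hG

theorem Growth.tendsto_lastDensity :
    Tendsto (fun k => lastDensity (n k) (d k) (p k)) atTop (𝓝 0) := by
  refine hG.size.congr fun k => ?_
  rw [lastDensity, fullSize_succ]; push_cast; rfl

theorem Growth.two_le_d (k : ℕ) : 2 ≤ d k :=
  le_trans (by norm_num) (ten_le_of_log_le (hG.log_le k))

theorem Growth.tendsto_prevDensity :
    Tendsto (fun k => prevDensity (n k) (d k) (p k)) atTop (𝓝 0) := by
  refine squeeze_zero (fun k => prevDensity_nonneg) (fun k => ?_) hG.tendsto_lastDensity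
  have := two_mul_prevDensity_le (n := n k) (hG.two_le_d k) (hG.two_le k)
  have := prevDensity_nonneg (n := n k) (d := d k) (p := p k)
  linarith

theorem Growth.nonempty (k : ℕ) : Nonempty (Pairing (n k) (d k)) := nonempty_pairing (hG.even k)

theorem Growth.eventually_mul_fullSize_le (t : ∀ k, Fin (n k)) (C : ℕ) : ∀ᶠ k in atTop,
    C * fullSize (d k) (p k) (numLevels (n k) (d k) (p k) + 1) ≤ n k := by
  have h : (0 : ℝ) < 1 / (C + 1) := by positivity
  filter_upwards [hG.tendsto_lastDensity.eventually (gt_mem_nhds h)] with k hk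
  have hn' : (0 : ℝ) < n k := by exact_mod_cast (t k).pos
  rw [lastDensity, div_lt_div_iff₀ hn' (by positivity)] at hk
  have h2 : (C : ℝ) * fullSize (d k) (p k) (numLevels (n k) (d k) (p k) + 1) ≤ n k := by
    have : (0 : ℝ) ≤ fullSize (d k) (p k) (numLevels (n k) (d k) (p k) + 1) := Nat.cast_nonneg _
    linarith
  exact_mod_cast h2

theorem Growth.tendsto_inv_n :
    Tendsto (fun k => 1 / (n k : ℝ)) atTop (𝓝 0) :=
  tendsto_one_div_atTop_nhds_zero_nat.comp hG.tendsto_n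

theorem Growth.eventually_collision_le (t : ∀ k, Fin (n k)) : ∀ᶠ k in atTop,
    (numLevels (n k) (d k) (p k) + 1) * (n k * Real.exp (-(5 * d k))) ≤ 1 / (n k : ℝ) ^ 2 := by
  filter_upwards [hG.tendsto_lastDensity.eventually (gt_mem_nhds one_pos)] with k hk
  exact collision_le (t k).pos (hG.log_le k) (hG.two_le k) hk.le

theorem Growth.one_le_n (t : ∀ k, Fin (n k)) (k : ℕ) : (1 : ℝ) ≤ n k := by
  exact_mod_cast (t k).pos

theorem Growth.tendsto_defect (t : ∀ k, Fin (n k)) :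
    Tendsto (fun k => defect (n k) (d k) (p k)) atTop (𝓝 0) := by
  have h1 : Tendsto (fun k => 44 * prevDensity (n k) (d k) (p k) + 1 / (n k : ℝ)) atTop (𝓝 0) := by
    simpa using ((hG.tendsto_prevDensity).const_mul 44).add (hG.tendsto_inv_n)
  refine squeeze_zero' (Eventually.of_forall fun k => ?_) ?_ h1
  · have := prevDensity_nonneg (n := n k) (d := d k) (p := p k)
    unfold defect; positivity
  · filter_upwards [hG.eventually_collision_le t] with k hk
    unfold defect
    have h2 := hG.one_le_n t k
    have h3 : 1 / (n k : ℝ) ^ 2 ≤ 1 / n k := by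
      apply one_div_le_one_div_of_le (by linarith)
      nlinarith
    linarith

theorem Growth.tendsto_lv (t : ∀ k, Fin (n k)) {η : ℝ} (hη : 0 < η) :
    Tendsto (fun k => prob {ω : Pairing (n k) (d k) × Selection (n k) (p k) |
      ((lv (t k) ω (numLevels (n k) (d k) (p k) + 1)).card : ℝ) <
        (1 - η) * fullSize (d k) (p k) (numLevels (n k) (d k) (p k) + 1)}) atTop (𝓝 0) := by
  have h1 : Tendsto (fun k => (44 * lastDensity (n k) (d k) (p k) + 1 / (n k : ℝ)) / η)
      atTop (𝓝 0) := by
    simpa using ((hG.tendsto_lastDensity.const_mul 44).add (hG.tendsto_inv_n)).div_const η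
  refine squeeze_zero' (Eventually.of_forall fun k => prob_nonneg _) ?_ h1
  filter_upwards [hG.eventually_collision_le t, hG.eventually_mul_fullSize_le t 6000] with k hk hk'
  have := hG.nonempty k
  refine (prob_card_lv_lt_le (hG.two_le_d k) (hG.two_le k) (hG.four_mul_le k) _ hk' hη).trans ?_
  have h2 := hG.one_le_n t k
  have h3 : 1 / (n k : ℝ) ^ 2 ≤ 1 / n k := by
    apply one_div_le_one_div_of_le (by linarith)
    nlinarith
  have h4 : 44 * lastDensity (n k) (d k) (p k) =
    44 * fullSize (d k) (p k) (numLevels (n k) (d k) (p k) + 1) / n k := by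
    rw [lastDensity, mul_div_assoc]
  rw [h4]
  gcongr
  exact hk.trans h3

theorem Growth.outerProb_le (t : ∀ k, Fin (n k)) (r : ℕ) : ∀ᶠ k in atTop, ∀ δ s : ℝ, 0 < δ → δ ≤ 1 →
    0 < s + 1 - r → outerProb (n k) (d k) (p k) (t k) s ≤ defect (n k) (d k) (p k) / δ +
      (n k * Real.exp (-lam (n k) (d k) (p k)) / (s + 1 - r)) ^ r *
      Real.exp (r * (lam (n k) (d k) (p k) * δ + lastDensity (n k) (d k) (p k) +
        60 * (r + 1) ^ 2 * (lam (n k) (d k) (p k) * prevDensity (n k) (d k) (p k)))) := by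
  filter_upwards [hG.eventually_mul_fullSize_le t 6000,
    hG.eventually_mul_fullSize_le t (12 * (r + 2))] with k h1 h2 δ s hδ0 hδ1 hs
  have := hG.nonempty k
  have h3 := prob_le_card_outer_le (t := t k) (hG.two_le_d k) (hG.two_le k) (hG.four_mul_le k)
    one_le_numLevels h1 r h2 hδ0 hδ1 hs
  rw [← lam_eq] at h3
  unfold outerProb defect prevDensity lastDensity
  rw [mul_div_assoc']
  exact h3

variable {L : Filter ℕ}

theorem Growth.tendsto_lam_mul_prevDensity (t : ∀ k, Fin (n k)) (hL : L ≤ atTop)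
    (hlam : ∀ᶠ k in L, lam (n k) (d k) (p k) ≤ 3 * Real.log (n k)) :
    Tendsto (fun k => lam (n k) (d k) (p k) * prevDensity (n k) (d k) (p k)) L (𝓝 0) := by
  have h0 : Tendsto (fun x : ℝ => √(27 * (Real.log x ^ 3 / x))) atTop (𝓝 0) := by
    have := ((Real.isLittleO_pow_log_id_atTop (n := 3)).tendsto_div_nhds_zero).const_mul 27
    rw [mul_zero] at this
    simpa using this.sqrt
  have h1 := h0.comp (tendsto_natCast_atTop_atTop.comp hG.tendsto_n)
  have h2 := (hG.tendsto_lastDensity.add h1).mono_left hL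
  rw [add_zero] at h2
  refine squeeze_zero' (Eventually.of_forall fun k => mul_nonneg lam_nonneg prevDensity_nonneg)
    ?_ h2
  filter_upwards [hlam] with k hk
  refine (lam_mul_le (t k).pos (by have := hG.two_le_d k; omega) (hG.two_le k)).trans ?_
  unfold lastDensity
  apply add_le_add le_rfl
  apply Real.sqrt_le_sqrt
  simp only [Function.comp]
  rw [mul_div_assoc']
  apply div_le_div_of_nonneg_right _ (Nat.cast_nonneg _)
  calc lam (n k) (d k) (p k) ^ 3 ≤ (3 * Real.log (n k)) ^ 3 := pow_le_pow_left₀ lam_nonneg hk 3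
    _ = _ := by ring

theorem Growth.tendsto_lam_mul_defect (t : ∀ k, Fin (n k)) (hL : L ≤ atTop)
    (hlam : ∀ᶠ k in L, lam (n k) (d k) (p k) ≤ 3 * Real.log (n k)) :
    Tendsto (fun k => lam (n k) (d k) (p k) * defect (n k) (d k) (p k)) L (𝓝 0) := by
  have h1 := ((hG.tendsto_lam_mul_prevDensity t hL hlam).const_mul 44).add
    (((hG.tendsto_inv_n).const_mul 3).mono_left hL)
  rw [mul_zero, mul_zero, add_zero] at h1
  refine squeeze_zero' (Eventually.of_forall fun k => mul_nonneg lam_nonneg ?_) ?_ h1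
  · have := prevDensity_nonneg (n := n k) (d := d k) (p := p k)
    unfold defect; positivity
  · filter_upwards [hlam, (hG.eventually_collision_le t).filter_mono hL] with k hk hk'
    have hn := hG.one_le_n t k
    have hn0 : (0 : ℝ) < n k := by linarith
    have h2 : Real.log (n k) ≤ n k := by linarith [Real.log_le_sub_one_of_pos hn0]
    have h3 := mul_le_mul (hk.trans (mul_le_mul_of_nonneg_left h2 (by norm_num))) hk'
      (by positivity) (by positivity)
    have h4 : 3 * (n k : ℝ) * (1 / (n k : ℝ) ^ 2) = 3 * (1 / n k) := by field_simp
    unfold defect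
    linarith

/-- Tail bounds for the size of the outer ring, if `lam` is at most logarithmic. -/
theorem Growth.outerProb_le_of_lam_le (t : ∀ k, Fin (n k)) (hL : L ≤ atTop)
    (hlam : ∀ᶠ k in L, lam (n k) (d k) (p k) ≤ 3 * Real.log (n k)) :
    ∃ (g : ℕ → ℝ) (H : ℕ → ℕ → ℝ), Tendsto g L (𝓝 0) ∧ (∀ r, Tendsto (H r) L (𝓝 1)) ∧
      ∀ r : ℕ, ∀ᶠ k in L, ∀ s : ℝ, 0 < s + 1 - r → outerProb (n k) (d k) (p k) (t k) s ≤
        g k + (n k * Real.exp (-lam (n k) (d k) (p k)) / (s + 1 - r)) ^ r * H r k := by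
  set g : ℕ → ℝ := fun k => √(lam (n k) (d k) (p k) * defect (n k) (d k) (p k)) with hgdef
  have hg : Tendsto g L (𝓝 0) := by simpa using (hG.tendsto_lam_mul_defect t hL hlam).sqrt
  refine ⟨g, fun r k => Real.exp (r * (g k + lastDensity (n k) (d k) (p k) +
    60 * (r + 1) ^ 2 * (lam (n k) (d k) (p k) * prevDensity (n k) (d k) (p k)))), hg,
    fun r => ?_, fun r => ?_⟩
  · have h1 := (((hg.add (hG.tendsto_lastDensity.mono_left hL)).add
      ((hG.tendsto_lam_mul_prevDensity t hL hlam).const_mul (60 * ((r : ℝ) + 1) ^ 2))).const_mul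
      (r : ℝ)).rexp
    simpa using h1
  · filter_upwards [(hG.outerProb_le t r).filter_mono hL,
      hg.eventually (gt_mem_nhds (by norm_num : (0 : ℝ) < 1 / 2))] with k h1 h2 s hs
    have hl : 1 / 2 ≤ lam (n k) (d k) (p k) :=
      half_le_lam (t k).pos (by have := hG.two_le_d k; omega) (hG.two_le k)
    have hn0 : (0 : ℝ) < n k := by linarith [hG.one_le_n t k]
    have hdef : 0 < defect (n k) (d k) (p k) := by
      have := prevDensity_nonneg (n := n k) (d := d k) (p := p k)
      unfold defect; positivity
    set x := lam (n k) (d k) (p k) with hx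
    set y := defect (n k) (d k) (p k) with hy
    have hx0 : 0 < x := by linarith
    have hgk : g k = √(x * y) := rfl
    have hgk0 : 0 < g k := by rw [hgk]; positivity
    have hsq : g k * g k = x * y := by rw [hgk, Real.mul_self_sqrt (by positivity)]
    have h3 := h1 (g k / x) s (by positivity) (by rw [div_le_one hx0]; linarith) hs
    have h4 : y / (g k / x) = g k := by
      rw [div_div_eq_mul_div, div_eq_iff hgk0.ne', hsq, mul_comm]
    rw [h4, mul_div_cancel₀ _ hx0.ne'] at h3
    exact h3

theorem Growth.tendsto_outerProb_of_le (t : ∀ k, Fin (n k)) (hL : L ≤ atTop)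
    (hlam : ∀ᶠ k in L, lam (n k) (d k) (p k) ≤ 3 * Real.log (n k)) {η : ℝ} (hη : 0 < η)
    {s : ℕ → ℝ} (hs : ∀ r : ℕ, ∀ᶠ k in L,
      (1 + η) * (n k * Real.exp (-lam (n k) (d k) (p k))) ≤ s k + 1 - r) :
    Tendsto (fun k => outerProb (n k) (d k) (p k) (t k) (s k)) L (𝓝 0) := by
  obtain ⟨g, H, hg, hH, hle⟩ := hG.outerProb_le_of_lam_le t hL hlam
  have h0 : ∀ k, 0 ≤ outerProb (n k) (d k) (p k) (t k) (s k) := fun k => prob_nonneg _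
  refine tendsto_order.2 ⟨fun a ha => Eventually.of_forall fun k => ha.trans_le (h0 k),
    fun a ha => ?_⟩
  have hlt : 1 / (1 + η) < 1 := by rw [div_lt_one (by linarith)]; linarith
  obtain ⟨r, hr⟩ := exists_pow_lt_of_lt_one (by positivity : 0 < a / 4) hlt
  filter_upwards [hle r, hs r, hg.eventually (gt_mem_nhds (by positivity : 0 < a / 2)),
    (hH r).eventually (gt_mem_nhds (by norm_num : (1 : ℝ) < 2)),
    (hH r).eventually (lt_mem_nhds (by norm_num : (0 : ℝ) < 1))] with k h1 h2 h3 h4 h5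
  set m := n k * Real.exp (-lam (n k) (d k) (p k)) with hm
  have hm0 : 0 < m := mul_pos (by linarith [hG.one_le_n t k]) (Real.exp_pos _)
  have hpos : 0 < s k + 1 - r := lt_of_lt_of_le (by positivity) h2
  have h6 : m / (s k + 1 - r) ≤ 1 / (1 + η) := by
    rw [div_le_div_iff₀ hpos (by positivity)]; linarith
  have h7 : (m / (s k + 1 - r)) ^ r ≤ (1 / (1 + η)) ^ r := pow_le_pow_left₀ (by positivity) h6 r
  have h8 : (m / (s k + 1 - r)) ^ r * H r k ≤ a / 4 * 2 :=
    mul_le_mul (h7.trans hr.le) h4.le h5.le (by positivity)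
  have := h1 (s k) hpos
  linarith

theorem Growth.tendsto_outerProb_one_of_tendsto (t : ∀ k, Fin (n k)) (hL : L ≤ atTop)
    (hlam : ∀ᶠ k in L, lam (n k) (d k) (p k) ≤ 3 * Real.log (n k))
    (h : Tendsto (fun k => (n k : ℝ) * Real.exp (-lam (n k) (d k) (p k))) L (𝓝 0)) :
    Tendsto (fun k => outerProb (n k) (d k) (p k) (t k) 1) L (𝓝 0) := by
  obtain ⟨g, H, hg, hH, hle⟩ := hG.outerProb_le_of_lam_le t hL hlam
  have h1 := hg.add (h.mul (hH 1))
  rw [zero_mul, add_zero] at h1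
  refine squeeze_zero' (Eventually.of_forall fun k => prob_nonneg _) ?_ h1
  filter_upwards [hle 1] with k hk
  have := hk 1 (by norm_num)
  simpa using this

/-- If `lam` is large then the outer ring is empty with high probability. -/
theorem Growth.tendsto_outerProb_one_of_lt (t : ∀ k, Fin (n k)) (hL : L ≤ atTop)
    (hlam : ∀ᶠ k in L, 3 * Real.log (n k) < lam (n k) (d k) (p k)) :
    Tendsto (fun k => outerProb (n k) (d k) (p k) (t k) 1) L (𝓝 0) := by
  have h1 := ((((hG.tendsto_defect t).div_const (1 / 6)).add
    ((hG.tendsto_inv_n).const_mul (Real.exp 1)))).mono_left hL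
  rw [zero_div, mul_zero, add_zero] at h1
  refine squeeze_zero' (Eventually.of_forall fun k => prob_nonneg _) ?_ h1
  filter_upwards [hlam, (hG.outerProb_le t 1).filter_mono hL,
    (hG.tendsto_lastDensity.mono_left hL).eventually (gt_mem_nhds one_pos),
    ((hG.tendsto_prevDensity).mono_left hL).eventually
      (gt_mem_nhds (by norm_num : (0 : ℝ) < 1 / 1440))] with k h1 h2 h3 h4
  refine (h2 (1 / 6) 1 (by norm_num) (by norm_num) (by norm_num)).trans ?_
  apply add_le_add le_rfl
  have hn0 : (0 : ℝ) < n k := by linarith [hG.one_le_n t k]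
  have hlog : 0 ≤ Real.log (n k) := Real.log_natCast_nonneg _
  set x := lam (n k) (d k) (p k) with hx
  have hx0 : 0 ≤ x := lam_nonneg
  have h5 := mul_le_mul_of_nonneg_left h4.le hx0
  have h6 : Real.exp 1 * (1 / n k) = n k * Real.exp (1 - 2 * Real.log (n k)) := by
    rw [Real.exp_sub, mul_comm 2, Real.exp_mul, Real.exp_log hn0, Real.rpow_two]
    field_simp
  rw [h6, pow_one, Nat.cast_one, add_sub_cancel_right, div_one, one_mul, mul_assoc,
    ← Real.exp_add]
  apply mul_le_mul_of_nonneg_left _ hn0.le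
  apply Real.exp_le_exp.2
  linarith

end Asymptotics

section Rings

variable {n d p : ℕ → ℕ} (hG : Growth n d p)

theorem outerProb_anti {n d p : ℕ} {t : Fin n} {s s' : ℝ} (h : s ≤ s') :
    outerProb n d p t s' ≤ outerProb n d p t s := prob_mono fun _ hω => h.trans hω

theorem tendsto_of_inf_principal {f : ℕ → ℝ} {x : ℝ} (S : Set ℕ)
    (h1 : Tendsto f (atTop ⊓ 𝓟 S) (𝓝 x)) (h2 : Tendsto f (atTop ⊓ 𝓟 Sᶜ) (𝓝 x)) :
    Tendsto f atTop (𝓝 x) := by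
  have := h1.sup h2
  rwa [← inf_sup_left, sup_principal, Set.union_compl_self, principal_univ, inf_top_eq] at this

include hG

theorem Growth.tendsto_outerProb_add (t : ∀ k, Fin (n k)) {η : ℝ} (hη : 0 < η) :
    Tendsto (fun k => outerProb (n k) (d k) (p k) (t k)
      ((Real.exp (-lam (n k) (d k) (p k)) + η) * n k)) atTop (𝓝 0) := by
  have hcast : Tendsto (fun k => (n k : ℝ)) atTop atTop :=
    tendsto_natCast_atTop_atTop.comp hG.tendsto_n
  apply tendsto_of_inf_principal {k | lam (n k) (d k) (p k) ≤ 3 * Real.log (n k)}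
  · refine hG.tendsto_outerProb_of_le t inf_le_left (mem_inf_of_right (mem_principal_self _))
      (half_pos hη) fun r => ?_
    filter_upwards [(hcast.eventually_ge_atTop (r / (η / 2))).filter_mono inf_le_left] with k hk
    rw [div_le_iff₀ (half_pos hη)] at hk
    have h1 : Real.exp (-lam (n k) (d k) (p k)) ≤ 1 :=
      Real.exp_le_one_iff.2 (neg_nonpos.2 lam_nonneg)
    have h2 := mul_le_mul_of_nonneg_left h1
      (by positivity : 0 ≤ η / 2 * (n k : ℝ))
    linarith
  · refine squeeze_zero' (Eventually.of_forall fun k => prob_nonneg _) ?_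
      (hG.tendsto_outerProb_one_of_lt t inf_le_left ?_)
    · filter_upwards [(hcast.eventually_ge_atTop (1 / η)).filter_mono inf_le_left] with k hk
      rw [div_le_iff₀ hη] at hk
      apply outerProb_anti
      have := mul_nonneg (Real.exp_pos (-lam (n k) (d k) (p k))).le (Nat.cast_nonneg (α := ℝ) (n k))
      linarith
    · filter_upwards [mem_inf_of_right (mem_principal_self _)] with k hk
      exact not_le.1 hk

theorem Growth.tendsto_outerProb_mul (t : ∀ k, Fin (n k))
    (h : Tendsto (fun k => (n k : ℝ) * Real.exp (-lam (n k) (d k) (p k))) atTop atTop)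
    {η : ℝ} (hη : 0 < η) :
    Tendsto (fun k => outerProb (n k) (d k) (p k) (t k)
      ((1 + η) * (n k * Real.exp (-lam (n k) (d k) (p k))))) atTop (𝓝 0) := by
  refine hG.tendsto_outerProb_of_le t le_rfl ?_ (half_pos hη) fun r => ?_
  · filter_upwards [h.eventually_ge_atTop 1] with k hk
    have hn : (1 : ℝ) ≤ n k := hG.one_le_n t k
    have h1 := Real.log_le_log one_pos hk
    rw [Real.log_one, Real.log_mul (by linarith) (Real.exp_pos _).ne', Real.log_exp] at h1
    have := Real.log_nonneg hn
    linarith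
  · filter_upwards [h.eventually_ge_atTop (r / (η / 2))] with k hk
    rw [div_le_iff₀ (half_pos hη)] at hk
    linarith

theorem Growth.tendsto_outerProb_one (t : ∀ k, Fin (n k))
    (h : Tendsto (fun k => (n k : ℝ) * Real.exp (-lam (n k) (d k) (p k))) atTop (𝓝 0)) :
    Tendsto (fun k => outerProb (n k) (d k) (p k) (t k) 1) atTop (𝓝 0) := by
  apply tendsto_of_inf_principal {k | lam (n k) (d k) (p k) ≤ 3 * Real.log (n k)}
  · exact hG.tendsto_outerProb_one_of_tendsto t inf_le_left
      (mem_inf_of_right (mem_principal_self _)) (h.mono_left inf_le_left)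
  · refine hG.tendsto_outerProb_one_of_lt t inf_le_left ?_
    filter_upwards [mem_inf_of_right (mem_principal_self _)] with k hk
    exact not_le.1 hk

/-- With high probability every node of the outer ring has a neighbour in the inner ring. -/
theorem Growth.tendsto_deep (t : ∀ k, Fin (n k)) {c : ℝ} (hc : 1 < c)
    (hlam : ∀ k, c * Real.log (n k) ≤ lam (n k) (d k) (p k) * (d k : ℝ)) :
    Tendsto (fun k => prob {ω : Pairing (n k) (d k) × Selection (n k) (p k) |
      ∃ v, Deep (t k) ω v (numLevels (n k) (d k) (p k) + 1)}) atTop (𝓝 0) := by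
  have hcast : Tendsto (fun k => (n k : ℝ)) atTop atTop :=
    tendsto_natCast_atTop_atTop.comp hG.tendsto_n
  set c' := min c 20 with hc'
  have hc1 : 1 < c' := lt_min hc (by norm_num)
  set ζ := (c' - 1) / (4 * c') with hζ
  have hζ0 : 0 < ζ := div_pos (by linarith) (by linarith)
  have hζ1 : ζ ≤ 1 / 4 := by
    rw [hζ, div_le_div_iff₀ (by linarith) (by norm_num)]; linarith
  have hζc : (1 - 2 * ζ) * c' = (c' + 1) / 2 := by
    rw [hζ]
    have : c' ≠ 0 := by linarith
    field_simp; ring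
  set E := Real.exp (-10) with hE
  have hE0 : 0 < E := Real.exp_pos _
  set η := E * ζ / 8 with hη
  have hη0 : 0 < η := by positivity
  have hκ : Tendsto (fun k => Real.exp (-((c' - 1) / 2 * Real.log (n k)))) atTop (𝓝 0) := by
    have h1 : Tendsto (fun k => Real.log (n k)) atTop atTop := Real.tendsto_log_atTop.comp hcast
    exact Real.tendsto_exp_neg_atTop_nhds_zero.comp
      (h1.const_mul_atTop (by linarith : 0 < (c' - 1) / 2))
  have hsum := hκ.add (hG.tendsto_outerProb_add t hη0)
  rw [add_zero] at hsum
  refine squeeze_zero' (Eventually.of_forall fun k => prob_nonneg _) ?_ hsum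
  filter_upwards [hG.eventually_mul_fullSize_le t 6000,
    hG.tendsto_lastDensity.eventually (gt_mem_nhds (by positivity : 0 < η / 4)),
    hG.tendsto_prevDensity.eventually (gt_mem_nhds (by positivity : 0 < ζ * E / 8)),
    hG.tendsto_inv_n.eventually (gt_mem_nhds (by positivity : 0 < η * E / 4))]
    with k h6000 hε hq hinv
  have := hG.nonempty k
  set x := lam (n k) (d k) (p k) with hx
  set l := numLevels (n k) (d k) (p k) with hl
  have hn1 : (1 : ℝ) ≤ n k := hG.one_le_n t k
  have hn0 : (0 : ℝ) < n k := by linarith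
  have hlog : 0 ≤ Real.log (n k) := Real.log_nonneg hn1
  have hx0 : 1 / 2 ≤ x := half_le_lam (t k).pos (by have := hG.two_le_d k; omega) (hG.two_le k)
  set μ := min x 10 with hμ
  have hμx : μ ≤ x := min_le_left _ _
  have hμ10 : μ ≤ 10 := min_le_right _ _
  have hμ0 : 1 / 2 ≤ μ := le_min hx0 (by norm_num)
  have hμd : c' * Real.log (n k) ≤ μ * d k := by
    rcases min_choice x 10 with h | h
    · rw [hμ, h]
      exact (mul_le_mul_of_nonneg_right (min_le_left _ _) hlog).trans (hlam k)
    · rw [hμ, h]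
      have h1 := mul_le_mul_of_nonneg_right (min_le_right c 20) hlog
      have h2 := hG.log_le k
      linarith
  set X := Real.exp (-(μ * (1 - ζ))) with hX
  have hX0 : 0 < X := Real.exp_pos _
  have hX1 : X ≤ 1 := Real.exp_le_one_iff.2 (neg_nonpos.2 (mul_nonneg (by linarith) (by linarith)))
  have hXE : E ≤ X := by
    apply Real.exp_le_exp.2
    have : μ * (1 - ζ) ≤ 10 * 1 := mul_le_mul hμ10 (by linarith) (by linarith) (by norm_num)
    linarith
  have hXinv : X⁻¹ ≤ E⁻¹ := inv_anti₀ hE0 hXE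
  have hgap : Real.exp (-x) + 4 * η ≤ X := by
    have h1 : Real.exp (-x) ≤ Real.exp (-μ) := Real.exp_le_exp.2 (neg_le_neg hμx)
    have h2 : X = Real.exp (-μ) * Real.exp (μ * ζ) := by
      rw [hX, ← Real.exp_add]; ring_nf
    have h3 : 1 + ζ / 2 ≤ Real.exp (μ * ζ) := by
      have := Real.add_one_le_exp (μ * ζ)
      have := mul_le_mul_of_nonneg_right hμ0 hζ0.le
      linarith
    have h4 : E ≤ Real.exp (-μ) := Real.exp_le_exp.2 (neg_le_neg hμ10)
    have h5 := mul_le_mul_of_nonneg_left h3 (Real.exp_pos (-μ)).le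
    have h6 := mul_le_mul_of_nonneg_right h4 hζ0.le
    rw [h2, hη]
    linarith
  set F : ℝ := (fullSize (d k) (p k) (l + 1) : ℝ) with hF
  have hFn : F ≤ η / 4 * n k := by
    have : F / n k < η / 4 := hε
    rw [div_lt_iff₀ hn0] at this
    exact this.le
  have hone : 1 ≤ η * E / 4 * n k := by
    rw [div_lt_iff₀ hn0] at hinv
    exact hinv.le
  have hE1 : E ≤ 1 := hXE.trans hX1
  have hs : (Real.exp (-x) + η) * n k * X + 1 ≤ X ^ 2 * (n k - 4 * F - 2) := by
    have h1 : η * E / 4 * n k ≤ X * (η / 4 * n k) := by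
      have := mul_le_mul_of_nonneg_right hXE (by positivity : 0 ≤ η / 4 * n k)
      linarith
    have h2 : (1 : ℝ) ≤ η / 4 * n k := by
      have := mul_le_mul_of_nonneg_right hX1 (by positivity : 0 ≤ η / 4 * n k)
      linarith
    have h3 : 4 * F + 2 ≤ 3 / 2 * η * n k := by linarith
    have h4 : X * (4 * F + 2) ≤ 1 * (3 / 2 * η * n k) :=
      mul_le_mul hX1 h3 (by positivity) (by norm_num)
    have h5 := mul_le_mul_of_nonneg_right hgap hn0.le
    have h6 : (Real.exp (-x) + η) * n k + η / 4 * n k ≤ X * (n k - 4 * F - 2) := by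
      have : 0 ≤ η * n k := by positivity
      linarith
    have h7 := mul_le_mul_of_nonneg_left h6 hX0.le
    linarith
  have hdeep := prob_exists_deep_le (t := t k) (hG.two_le_d k) (hG.two_le k) l h6000 hX0 hX1 hs
  have hsplit : {ω : Pairing (n k) (d k) × Selection (n k) (p k) | ∃ v, Deep (t k) ω v (l + 1)} ⊆
      {ω | (∃ v, Deep (t k) ω v (l + 1)) ∧
        ((outer (t k) ω (l + 1)).card : ℝ) ≤ (Real.exp (-x) + η) * n k} ∪
      {ω | (Real.exp (-x) + η) * n k ≤ ((outer (t k) ω (l + 1)).card : ℝ)} := by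
    intro ω hω
    rcases le_total ((outer (t k) ω (l + 1)).card : ℝ) ((Real.exp (-x) + η) * n k) with h | h
    · exact Or.inl ⟨hω, h⟩
    · exact Or.inr h
  refine (prob_mono hsplit).trans ((prob_union_le _ _).trans (add_le_add (hdeep.trans ?_) le_rfl))
  have hnexp : (n k : ℝ) = Real.exp (Real.log (n k)) := (Real.exp_log hn0).symm
  calc (n k : ℝ) * (X ^ d k * Real.exp (4 * X⁻¹ * d k * (fullSize (d k) (p k) l / n k)))
      = Real.exp (Real.log (n k) + (d k * -(μ * (1 - ζ)) +
          4 * X⁻¹ * d k * (fullSize (d k) (p k) l / n k))) := by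
        rw [Real.exp_add, Real.exp_add, ← hnexp, Real.exp_nat_mul]
    _ ≤ _ := by
        apply Real.exp_le_exp.2
        have hq' : (fullSize (d k) (p k) l / n k : ℝ) ≤ ζ * E / 8 := hq.le
        have h1 : 4 * X⁻¹ * d k * (fullSize (d k) (p k) l / n k) ≤
            4 * E⁻¹ * d k * (ζ * E / 8) := by gcongr
        have h2 : 4 * E⁻¹ * d k * (ζ * E / 8) = d k * (ζ / 2) := by
          field_simp; ring
        have h3 : (d k : ℝ) * (ζ / 2) ≤ d k * (μ * ζ) := by
          apply mul_le_mul_of_nonneg_left _ (Nat.cast_nonneg _)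
          have := mul_le_mul_of_nonneg_right hμ0 hζ0.le
          linarith
        have h4 := mul_le_mul_of_nonneg_left hμd (by linarith : 0 ≤ 1 - 2 * ζ)
        have h5 : (1 - 2 * ζ) * (c' * Real.log (n k)) = (c' + 1) / 2 * Real.log (n k) := by
          rw [← hζc]; ring
        linarith

end Rings

section Final

/-- A threshold that tends to zero so slowly that the probabilities still tend to one. -/
theorem exists_tendsto_diagonal {a : ℕ → ℝ → ℝ} (h0 : ∀ k η, 0 ≤ a k η) (h1 : ∀ k η, a k η ≤ 1)
    (hmono : ∀ k, Monotone (a k)) (h : ∀ η, 0 < η → Tendsto (fun k => a k η) atTop (𝓝 1)) :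
    ∃ δ : ℕ → ℝ, Tendsto δ atTop (𝓝 0) ∧ ∀ δ' : ℕ → ℝ, (∀ k, δ k ≤ δ' k) →
      Tendsto (fun k => a k (δ' k)) atTop (𝓝 1) := by
  set S : ℕ → Set ℝ := fun k => {η | 0 < η ∧ 1 - a k η ≤ η} with hS
  have hbdd : ∀ k, BddBelow (S k) := fun k => ⟨0, fun η hη => hη.1.le⟩
  have hne : ∀ k, (S k).Nonempty := fun k => ⟨1, one_pos, by linarith [h0 k 1]⟩
  have hpos : ∀ k, 0 ≤ sInf (S k) := fun k => le_csInf (hne k) fun η hη => hη.1.le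
  have hinf : Tendsto (fun k => sInf (S k)) atTop (𝓝 0) := by
    refine tendsto_order.2 ⟨fun b hb => Eventually.of_forall fun k => hb.trans_le (hpos k),
      fun b hb => ?_⟩
    filter_upwards [(h (b / 2) (by linarith)).eventually
      (lt_mem_nhds (by linarith : 1 - b / 2 < 1))] with k hk
    have : sInf (S k) ≤ b / 2 := csInf_le (hbdd k) ⟨by linarith, by linarith⟩
    linarith
  have hδ : Tendsto (fun k : ℕ => sInf (S k) + 1 / ((k : ℝ) + 1)) atTop (𝓝 0) := by
    simpa using hinf.add tendsto_one_div_add_atTop_nhds_zero_nat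
  refine ⟨_, hδ, fun δ' hδ' => ?_⟩
  have hlow : Tendsto (fun k : ℕ => 1 - (sInf (S k) + 1 / ((k : ℝ) + 1))) atTop (𝓝 1) := by
    simpa using hδ.const_sub 1
  refine tendsto_of_tendsto_of_tendsto_of_le_of_le hlow tendsto_const_nhds (fun k => ?_)
    fun k => h1 k _
  have hlt : sInf (S k) < sInf (S k) + 1 / ((k : ℝ) + 1) := by
    have : 0 < 1 / ((k : ℝ) + 1) := by positivity
    linarith
  obtain ⟨η, hη, hηlt⟩ := exists_lt_of_csInf_lt (hne k) hlt
  have h2 := hmono k (hηlt.le.trans (hδ' k))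
  have h3 := hη.2
  change 1 - _ ≤ _
  linarith

end Final

section Events

variable {n d p h : ℕ}

variable (h) in
/-- The path lengths are distributed as claimed, up to relative errors `η`. -/
def lengthsEvent (p : ℕ) (t : Fin n) (η : ℝ) : Set (Outcome n d p h) :=
  {ω | pathCount ω t 1 = d ∧
    (∀ i, 2 ≤ i → i ≤ numLevels n d p + 2 →
      (1 - η) * ((p : ℝ) ^ (i - 2) * (d : ℝ) ^ 2) ≤ (pathCount ω t i : ℝ) ∧
      (pathCount ω t i : ℝ) ≤ (1 + η) * ((p : ℝ) ^ (i - 2) * (d : ℝ) ^ 2)) ∧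
    (pathCount ω t (numLevels n d p + 4) : ℝ) ≤ (Real.exp (-lam n d p) + η) * ((n : ℝ) * (d : ℝ)) ∧
    (∀ e, (∀ i, 1 ≤ i → i ≤ numLevels n d p + 2 → ¬ HasLength ω t e i) →
      ¬ HasLength ω t e (numLevels n d p + 4) → HasLength ω t e (numLevels n d p + 3))}

variable (h) in
/-- The number of longest paths is at most as claimed, up to a relative error `η`. -/
def longestEvent (p : ℕ) (t : Fin n) (η : ℝ) : Set (Outcome n d p h) :=
  {ω | (pathCount ω t (numLevels n d p + 4) : ℝ) ≤
    (1 + η) * Real.exp (-lam n d p) * ((n : ℝ) * (d : ℝ))}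

theorem lengthsEvent_mono (t : Fin n) {η η' : ℝ} (hη : η ≤ η') :
    (lengthsEvent h p t η : Set (Outcome n d p h)) ⊆ lengthsEvent h p t η' := by
  rintro ω ⟨h1, h2, h3, h4⟩
  refine ⟨h1, fun i hi hi' => ⟨?_, ?_⟩, h3.trans ?_, h4⟩
  · exact le_trans (by gcongr) (h2 i hi hi').1
  · exact (h2 i hi hi').2.trans (by gcongr)
  · gcongr

theorem longestEvent_mono (t : Fin n) {η η' : ℝ} (hη : η ≤ η') :
    (longestEvent h p t η : Set (Outcome n d p h)) ⊆ longestEvent h p t η' := by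
  intro ω hω
  simp only [longestEvent, Set.mem_ofPred_eq] at hω ⊢
  exact hω.trans (by gcongr)

theorem card_lv_add_le {t : Fin n} {ω : Pairing n d × Selection n p} (j i : ℕ) :
    (lv t ω (j + 1 + i)).card ≤ p ^ i * (lv t ω (j + 1)).card := by
  induction i with
  | zero => simp
  | succ i ih =>
    refine (card_lv_succ_le (j + 1 + i)).trans ?_
    have : quota d p (j + 1 + i) = p := by rw [add_right_comm]; rfl
    rw [this, pow_succ, mul_comm (p ^ i) p, mul_assoc]
    exact Nat.mul_le_mul_left p ih

theorem mem_lengthsEvent (hh : 1 ≤ h) (hp : 0 < p) {t : Fin n} {η : ℝ} (hη : 0 < η)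
    {ω : Outcome n d p h}
    (hlv : (1 - η) * fullSize d p (numLevels n d p + 1) ≤
      ((lv t ω.base (numLevels n d p + 1)).card : ℝ))
    (hdeep : ∀ v, ¬ Deep t ω.base v (numLevels n d p + 1))
    (hout : ((outer t ω.base (numLevels n d p + 1)).card : ℝ) ≤
      (Real.exp (-lam n d p) + η) * n) : ω ∈ lengthsEvent h p t η := by
  refine ⟨pathCount_one hh, fun i hi hi' => ?_, ?_, hasLength_inner hh hdeep⟩
  · obtain ⟨j, rfl⟩ : ∃ j, i = j + 2 := ⟨i - 2, by omega⟩
    have hcount := pathCount_lv hh hdeep (show j + 1 ≤ numLevels n d p + 1 by omega)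
    have hupper : (((lv t ω.base (j + 1)).card : ℕ) : ℝ) ≤ p ^ j * d := by
      have := card_lv_le (t := t) (ω := ω.base) (j + 1)
      rw [fullSize_succ] at this
      exact_mod_cast this
    have hd0 : (0 : ℝ) ≤ d := Nat.cast_nonneg _
    rw [show j + 2 = j + 1 + 1 from rfl, hcount, show j + 1 + 1 - 2 = j from rfl]
    push_cast
    constructor
    · have hlower : (1 - η) * (p ^ j * d : ℝ) ≤ ((lv t ω.base (j + 1)).card : ℝ) := by
        have h1 := card_lv_add_le (t := t) (ω := ω.base) j (numLevels n d p - j)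
        rw [show j + 1 + (numLevels n d p - j) = numLevels n d p + 1 by omega] at h1
        have h2 : ((lv t ω.base (numLevels n d p + 1)).card : ℝ) ≤
            p ^ (numLevels n d p - j) * ((lv t ω.base (j + 1)).card : ℝ) := by exact_mod_cast h1
        have h3 : (fullSize d p (numLevels n d p + 1) : ℝ) =
            p ^ (numLevels n d p - j) * (p ^ j * d) := by
          rw [fullSize_succ, ← mul_assoc, ← pow_add, Nat.sub_add_cancel (by omega)]
          push_cast; rfl
        have h4 : (0 : ℝ) < p ^ (numLevels n d p - j) := pow_pos (by exact_mod_cast hp) _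
        have h5 := hlv.trans h2
        rw [h3] at h5
        exact le_of_mul_le_mul_left (by linarith) h4
      have := mul_le_mul_of_nonneg_right hlower hd0
      linarith
    · have h1 := mul_le_mul_of_nonneg_right hupper hd0
      have h2 : 0 ≤ η * ((p : ℝ) ^ j * d ^ 2) := by positivity
      linarith
  · have h1 : (pathCount ω t (numLevels n d p + 4) : ℝ) ≤
        (outer t ω.base (numLevels n d p + 1)).card * d := by
      exact_mod_cast pathCount_outer_le hh
    have h2 := mul_le_mul_of_nonneg_right hout (Nat.cast_nonneg (α := ℝ) d)
    linarith

theorem le_prob_of_base [Nonempty (Pairing n d)] {E : Set (Outcome n d p h)}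
    {B : Set (Pairing n d × Selection n p)} (hE : ∀ ω : Outcome n d p h, ω.base ∉ B → ω ∈ E) :
    1 - prob B ≤ prob E := by
  have h1 : prob Eᶜ ≤ prob B := by
    rw [← prob_preimage_of_surjective_fst (Ω₃ := Selection n h) B]
    exact prob_mono fun ω hω => by_contra fun h' => hω (hE ω h')
  have := prob_add_prob_compl E
  linarith

end Events

section Main

variable {n d p h : ℕ → ℕ} (hG : Growth n d p)

include hG

theorem Growth.tendsto_lengthsEvent (t : ∀ k, Fin (n k)) (hh : ∀ k, 1 ≤ h k) {c : ℝ} (hc : 1 < c)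
    (hlam : ∀ k, c * Real.log (n k) ≤ lam (n k) (d k) (p k) * (d k : ℝ)) {η : ℝ} (hη : 0 < η) :
    Tendsto (fun k => prob (lengthsEvent (h k) (p k) (t k) η :
      Set (Outcome (n k) (d k) (p k) (h k)))) atTop (𝓝 1) := by
  have hlow := (((hG.tendsto_lv t hη).add (hG.tendsto_deep t hc hlam)).add
    (hG.tendsto_outerProb_add t hη)).const_sub 1
  rw [add_zero, add_zero, sub_zero] at hlow
  have hne := hG.nonempty
  refine tendsto_of_tendsto_of_tendsto_of_le_of_le hlow tendsto_const_nhds (fun k => ?_)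
    fun k => prob_le_one _
  refine (sub_le_sub_left ((prob_union_le _ _).trans
    (add_le_add (prob_union_le _ _) le_rfl)) 1).trans (le_prob_of_base fun ω hω => ?_)
  · simp only [Set.mem_union, not_or] at hω
    refine mem_lengthsEvent (hh k) (by have := hG.two_le k; omega) hη (not_lt.1 hω.1.1)
      (fun v hv => hω.1.2 ⟨v, hv⟩) (not_le.1 hω.2).le

theorem Growth.tendsto_longestEvent (t : ∀ k, Fin (n k)) (hh : ∀ k, 1 ≤ h k)
    (hext : Tendsto (fun k => (n k : ℝ) * Real.exp (-lam (n k) (d k) (p k))) atTop atTop ∨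
      Tendsto (fun k => (n k : ℝ) * Real.exp (-lam (n k) (d k) (p k))) atTop (𝓝 0))
    {η : ℝ} (hη : 0 < η) :
    Tendsto (fun k => prob (longestEvent (h k) (p k) (t k) η :
      Set (Outcome (n k) (d k) (p k) (h k)))) atTop (𝓝 1) := by
  have hne := hG.nonempty
  have hcount : ∀ k (ω : Outcome (n k) (d k) (p k) (h k)),
      ((outer (t k) ω.base (numLevels (n k) (d k) (p k) + 1)).card : ℝ) ≤
        (1 + η) * (n k * Real.exp (-lam (n k) (d k) (p k))) →
      ω ∈ (longestEvent (h k) (p k) (t k) η : Set (Outcome (n k) (d k) (p k) (h k))) := by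
    intro k ω hω
    have h1 : (pathCount ω (t k) (numLevels (n k) (d k) (p k) + 4) : ℝ) ≤
        (outer (t k) ω.base (numLevels (n k) (d k) (p k) + 1)).card * d k := by
      exact_mod_cast pathCount_outer_le (hh k)
    have h2 := mul_le_mul_of_nonneg_right hω (Nat.cast_nonneg (α := ℝ) (d k))
    refine h1.trans (h2.trans (le_of_eq ?_))
    ring
  rcases hext with hext | hext
  · have hlow := (hG.tendsto_outerProb_mul t hext hη).const_sub 1
    rw [sub_zero] at hlow
    refine tendsto_of_tendsto_of_tendsto_of_le_of_le hlow tendsto_const_nhds (fun k => ?_)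
      fun k => prob_le_one _
    exact le_prob_of_base fun ω hω => hcount k ω (not_le.1 hω).le
  · have hlow := (hG.tendsto_outerProb_one t hext).const_sub 1
    rw [sub_zero] at hlow
    refine tendsto_of_tendsto_of_tendsto_of_le_of_le hlow tendsto_const_nhds (fun k => ?_)
      fun k => prob_le_one _
    refine le_prob_of_base fun ω hω => hcount k ω ?_
    have h1 : ((outer (t k) ω.base (numLevels (n k) (d k) (p k) + 1)).card : ℝ) < 1 := not_le.1 hω
    have h2 : (outer (t k) ω.base (numLevels (n k) (d k) (p k) + 1)).card = 0 := by
      have : (outer (t k) ω.base (numLevels (n k) (d k) (p k) + 1)).card < 1 := by exact_mod_cast h1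
      omega
    rw [h2, Nat.cast_zero]
    positivity

end Main

end Spraypoint

open Spraypoint in
theorem mainTheorem2
    (n d p h : ℕ → ℕ) (t : (k : ℕ) → Fin (n k))
    (hn : Tendsto n atTop atTop)
    (heven : ∀ k, Even (n k * d k))
    (hd : ∀ k, 2 * (Real.log (n k) + 5) ≤ (d k : ℝ))
    (hp : ∀ k, 2 ≤ p k) (hpd : ∀ k, 4 * p k ≤ d k)
    (hh : ∀ k, 1 ≤ h k)
    (hsize : Tendsto
      (fun k => (p k : ℝ) ^ numLevels (n k) (d k) (p k) * (d k : ℝ) / (n k : ℝ)) atTop (𝓝 0))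
    (c : ℝ) (hc : 1 < c)
    (hlam : ∀ k, c * Real.log (n k) ≤ lam (n k) (d k) (p k) * (d k : ℝ)) :
    ∃ δ : ℕ → ℝ, Tendsto δ atTop (𝓝 0) ∧
      Tendsto (fun k => prob {ω : Outcome (n k) (d k) (p k) (h k) |
        pathCount ω (t k) 1 = d k ∧
        (∀ i, 2 ≤ i → i ≤ numLevels (n k) (d k) (p k) + 2 →
          (1 - δ k) * ((p k : ℝ) ^ (i - 2) * (d k : ℝ) ^ 2) ≤ (pathCount ω (t k) i : ℝ) ∧
          (pathCount ω (t k) i : ℝ) ≤ (1 + δ k) * ((p k : ℝ) ^ (i - 2) * (d k : ℝ) ^ 2)) ∧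
        (pathCount ω (t k) (numLevels (n k) (d k) (p k) + 4) : ℝ)
          ≤ (Real.exp (-lam (n k) (d k) (p k)) + δ k) * ((n k : ℝ) * (d k : ℝ)) ∧
        (∀ e, (∀ i, 1 ≤ i → i ≤ numLevels (n k) (d k) (p k) + 2 → ¬ HasLength ω (t k) e i) →
          ¬ HasLength ω (t k) e (numLevels (n k) (d k) (p k) + 4) →
          HasLength ω (t k) e (numLevels (n k) (d k) (p k) + 3))}) atTop (𝓝 1) ∧
      ((Tendsto (fun k => (n k : ℝ) * Real.exp (-lam (n k) (d k) (p k))) atTop atTop ∨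
          Tendsto (fun k => (n k : ℝ) * Real.exp (-lam (n k) (d k) (p k))) atTop (𝓝 0)) →
        Tendsto (fun k => prob {ω : Outcome (n k) (d k) (p k) (h k) |
          (pathCount ω (t k) (numLevels (n k) (d k) (p k) + 4) : ℝ)
            ≤ (1 + δ k) * Real.exp (-lam (n k) (d k) (p k)) * ((n k : ℝ) * (d k : ℝ))})
          atTop (𝓝 1)) := by
  have hG : Growth n d p := ⟨hn, heven, hd, hp, hpd, hsize⟩
  have hne := hG.nonempty
  obtain ⟨δ₁, hδ₁, h₁⟩ := exists_tendsto_diagonal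
    (a := fun k η => prob (lengthsEvent (h k) (p k) (t k) η :
      Set (Outcome (n k) (d k) (p k) (h k))))
    (fun k η => prob_nonneg _) (fun k η => prob_le_one _)
    (fun k η η' hη => prob_mono (lengthsEvent_mono (t k) hη))
    (fun η hη => hG.tendsto_lengthsEvent t hh hc hlam hη)
  by_cases hext : Tendsto (fun k => (n k : ℝ) * Real.exp (-lam (n k) (d k) (p k))) atTop atTop ∨
      Tendsto (fun k => (n k : ℝ) * Real.exp (-lam (n k) (d k) (p k))) atTop (𝓝 0)
  · obtain ⟨δ₂, hδ₂, h₂⟩ := exists_tendsto_diagonal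
      (a := fun k η => prob (longestEvent (h k) (p k) (t k) η :
        Set (Outcome (n k) (d k) (p k) (h k))))
      (fun k η => prob_nonneg _) (fun k η => prob_le_one _)
      (fun k η η' hη => prob_mono (longestEvent_mono (t k) hη))
      (fun η hη => hG.tendsto_longestEvent t hh hext hη)
    refine ⟨fun k => max (δ₁ k) (δ₂ k), by simpa using hδ₁.max hδ₂,
      h₁ _ fun k => le_max_left _ _, fun _ => h₂ _ fun k => le_max_right _ _⟩
  · exact ⟨δ₁, hδ₁, h₁ _ fun k => le_rfl, fun h' => absurd h' hext⟩
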